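/- Let $N\ge 0$ be an even integer; all gradings are by $\mathbb Z/N$ (so $N=0$ means $\mathbb Z$-graded and $N=2$ means $\mathbb Z/2\mathbb Z$-graded). Let $\mathbb K$ be a field and $n\ge 2$, and let $\mathcal A$ be a cohomologically unital $A_\infty$-algebra over $\mathbb K$ whose cohomology algebra $A=H^*(\mathcal A)$ is isomorphic, as a graded algebra, to $\mathbb K[u]$ with $\deg(u)=1-n$. (An example is the wrapped Floer $A_\infty$-algebra $\mathcal A=CW^*(F,F;\mathbb K)$ of a cotangent fibre $F\subset T^*S^n$ over the Novikov field $\mathbb K$.) Let $\mathrm{mod}^{A_\infty}(\mathcal A)$ be the dg category of graded, cohomologically unital right $A_\infty$-modules over $\mathcal A$; its morphisms are the pre-module homomorphisms $t=(t^d)_{d\ge 1}$, $t^d:\mathcal M\otimes\mathcal A^{\otimes (d-1)}\to\mathcal P$. Its cohomology category has the same objects, and its morphisms of degree $k$ are the degree $k$ cohomology groups of the morphism complexes. Let $\mathrm{mod}(A)$ be the graded category of graded right $A$-modules, whose morphisms of degree $k$ from $M$ to $P$ form the total $\mathrm{Ext}^k_A(M,P)$ (homological degree plus internal degree), composed by the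 Yoneda product. Then passing to cohomology gives a quasi-equivalence from $\mathrm{mod}^{A_\infty}(\mathcal A)$ to $\mathrm{mod}(A)$, meaning that it induces an equivalence of categories on cohomology. That is, there is a $\mathbb K$-linear, degree-preserving functor $H$ from the cohomology category of $\mathrm{mod}^{A_\infty}(\mathcal A)$ to $\mathrm{mod}(A)$ such that: 1. on objects, $H(\mathcal M)=H^*(\mathcal M)$; 2. for every closed $t:\mathcal M\to\mathcal P$ of degree $k$, the component of $H([t])\in\mathrm{Ext}^k_A(H^*\mathcal M,H^*\mathcal P)$ in $\mathrm{Hom}^k_A(H^*\mathcal M,H^*\mathcal P)$ is the map induced on cohomology by $t^1$; 3. $H$ is bijective on morphisms of every degree, and every graded right $A$-module is isomorphic in degree $0$ to an object in the image of $H$. Consequently, $\mathrm{mod}(A)$ is equivalent, as a graded $\mathbb K$-linear category, to the cohomology category of $\mathrm{mod}^{A_\infty}(\mathcal A)$. -/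

import Mathlib

universe u v w v' w'

namespace AInf

/-- The Koszul sign `(-1)^g` of a degree `g ∈ ℤ/N` (for even `N`; recall `ZMod 0 = ℤ`). -/
def sgn (𝕜 : Type u) [Field 𝕜] {N : ℕ} (g : ZMod N) : 𝕜 := (-1) ^ g.val

section Sign

variable (𝕜 : Type u) [Field 𝕜] {N : ℕ}

theorem sgn_zero : sgn 𝕜 (0 : ZMod N) = 1 := by
  simp [sgn]

theorem sgn_mul_self (g : ZMod N) : sgn 𝕜 g * sgn 𝕜 g = 1 := by
  simp only [sgn, ← mul_pow]; simp

variable [hN : Fact (Even N)]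

theorem sgn_add (g h : ZMod N) : sgn 𝕜 (g + h) = sgn 𝕜 g * sgn 𝕜 h := by
  obtain ⟨M, rfl⟩ := hN.out
  simp only [sgn, ← pow_add]
  rcases Nat.eq_zero_or_pos M with rfl | hM
  · have key : ∀ a b : ℤ, ((-1 : 𝕜)) ^ (a + b).natAbs = (-1) ^ (a.natAbs + b.natAbs) := by
      intro a b
      rw [neg_one_pow_eq_pow_mod_two, neg_one_pow_eq_pow_mod_two (n := a.natAbs + b.natAbs)]
      congr 1
      omega
    exact key g h
  · have : NeZero (M + M) := ⟨by omega⟩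
    rw [ZMod.val_add, neg_one_pow_eq_pow_mod_two,
      neg_one_pow_eq_pow_mod_two (n := g.val + h.val)]
    congr 1
    exact Nat.mod_mod_of_dvd _ ⟨M, (two_mul M).symm⟩

theorem sgn_one : sgn 𝕜 (1 : ZMod N) = -1 := by
  obtain ⟨M, rfl⟩ := hN.out
  rcases Nat.eq_zero_or_pos M with rfl | hM
  · have : sgn 𝕜 (1 : ZMod (0 + 0)) = (-1) ^ (1 : ℤ).natAbs := rfl
    rw [this]; simp
  · have : Fact (1 < M + M) := ⟨by omega⟩
    simp [sgn, ZMod.val_one]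

end Sign

section Internal

variable {𝕜 : Type u} [Field 𝕜] {ι : Type v} [DecidableEq ι] {V : Type w} [AddCommGroup V]
  [Module 𝕜 V]

/-- The linear endomorphism acting as `c i` on the summand `W i` of an internal direct sum. -/
noncomputable def diag (W : ι → Submodule 𝕜 V) (h : DirectSum.IsInternal W) (c : ι → 𝕜) :
    V →ₗ[𝕜] V :=
  (DirectSum.toModule 𝕜 ι V fun i => c i • (W i).subtype) ∘ₗ
    (LinearEquiv.ofBijective (DirectSum.coeLinearMap W)
      (show Function.Bijective (DirectSum.coeLinearMap W) from h)).symm.toLinearMap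

theorem diag_of_mem {W : ι → Submodule 𝕜 V} (h : DirectSum.IsInternal W) (c : ι → 𝕜) {i : ι}
    {x : V} (hx : x ∈ W i) : diag W h c x = c i • x := by
  have : (LinearEquiv.ofBijective (DirectSum.coeLinearMap W)
      (show Function.Bijective (DirectSum.coeLinearMap W) from h)).symm x
      = DirectSum.lof 𝕜 ι (fun i => W i) i ⟨x, hx⟩ := by
    rw [LinearEquiv.symm_apply_eq]
    simp
  simp only [diag, LinearMap.comp_apply, LinearEquiv.coe_coe, this, DirectSum.toModule_lof]
  simp

theorem internal_induction {W : ι → Submodule 𝕜 V} (h : DirectSum.IsInternal W) {p : V → Prop}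
    (x : V) (hom : ∀ i, ∀ y ∈ W i, p y) (zero : p 0) (add : ∀ y z, p y → p z → p (y + z)) :
    p x :=
  Submodule.iSup_induction W (motive := p)
    (by rw [h.submodule_iSup_eq_top]; exact Submodule.mem_top) hom zero add

theorem internal_of_diag (W : ι → Submodule 𝕜 V) (π : ι → V →ₗ[𝕜] V)
    (h1 : ∀ i, ∀ x ∈ W i, π i x = x) (h2 : ∀ i j, i ≠ j → ∀ x ∈ W j, π i x = 0)
    (h3 : ∀ x, x ∈ ⨆ i, W i) : DirectSum.IsInternal W := by
  rw [DirectSum.isInternal_submodule_iff_iSupIndep_and_iSup_eq_top]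
  refine ⟨?_, by rw [eq_top_iff]; exact fun x _ => h3 x⟩
  intro i
  rw [Submodule.disjoint_def]
  intro x hx hx'
  have : (⨆ j, ⨆ (_ : j ≠ i), W j) ≤ LinearMap.ker (π i) :=
    iSup_le fun j => iSup_le fun hj y hy => h2 i j hj.symm y hy
  rw [← h1 i x hx]
  exact this hx'

end Internal

/-- A `ℤ/N`-graded vector space, with its grading given by submodules. -/
structure GVec (𝕜 : Type u) [Field 𝕜] (N : ℕ) where
  carrier : Type u
  [addCommGroup : AddCommGroup carrier]
  [module : Module 𝕜 carrier]
  deg : ZMod N → Submodule 𝕜 carrier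
  internal : DirectSum.IsInternal deg

attribute [instance] GVec.addCommGroup GVec.module

instance (𝕜 : Type u) [Field 𝕜] (N : ℕ) : CoeSort (GVec 𝕜 N) (Type u) := ⟨GVec.carrier⟩

namespace GVec

variable {𝕜 : Type u} [Field 𝕜] {N : ℕ}

/-- `x ↦ (-1)^{|x|} x`. -/
noncomputable def σ (V : GVec 𝕜 N) : V →ₗ[𝕜] V := diag V.deg V.internal (sgn 𝕜)

/-- `x ↦ (-1)^{|x| - 1} x`. -/
noncomputable def τ (V : GVec 𝕜 N) : V →ₗ[𝕜] V := -V.σ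

/-- The projection to the summand of degree `g`. -/
noncomputable def proj (V : GVec 𝕜 N) (g : ZMod N) : V →ₗ[𝕜] V :=
  diag V.deg V.internal (Pi.single g 1)

theorem proj_of_mem (V : GVec 𝕜 N) {g : ZMod N} {x : V} (hx : x ∈ V.deg g) :
    V.proj g x = x := by
  simp [proj, diag_of_mem V.internal _ hx]

theorem proj_of_mem_ne (V : GVec 𝕜 N) {g h : ZMod N} (hgh : g ≠ h) {x : V} (hx : x ∈ V.deg h) :
    V.proj g x = 0 := by
  simp [proj, diag_of_mem V.internal _ hx, hgh.symm]

theorem proj_mem (V : GVec 𝕜 N) (g : ZMod N) (x : V) : V.proj g x ∈ V.deg g := by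
  induction x using internal_induction V.internal with
  | hom h y hy =>
    by_cases hgh : g = h
    · subst hgh; rwa [V.proj_of_mem hy]
    · rw [V.proj_of_mem_ne hgh hy]; exact zero_mem _
  | zero => simp
  | add y z hy hz => rw [map_add]; exact add_mem hy hz

theorem mem_of_proj_mem (V : GVec 𝕜 N) (S : Submodule 𝕜 V) (x : V)
    (hS : ∀ g, V.proj g x ∈ S) : x ∈ S := by
  classical
  obtain ⟨y, rfl⟩ := V.internal.2 x
  have key : ∀ g, V.proj g (DirectSum.coeLinearMap V.deg y) = (y g : V) := by
    intro g
    have : V.proj g ∘ₗ DirectSum.coeLinearMap V.deg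
        = (V.deg g).subtype ∘ₗ DirectSum.component 𝕜 _ _ g := by
      refine DirectSum.linearMap_ext 𝕜 fun i => LinearMap.ext fun z => ?_
      simp only [LinearMap.comp_apply, DirectSum.coeLinearMap_lof]
      by_cases h : g = i
      · subst h
        rw [V.proj_of_mem z.2, DirectSum.component.lof_self]; rfl
      · rw [V.proj_of_mem_ne h z.2, DirectSum.component.of, dif_neg (Ne.symm h)]; simp
    exact LinearMap.congr_fun this y
  have h2 : DirectSum.coeLinearMap V.deg y ∈ S := by
    rw [DirectSum.coeLinearMap_eq_dfinsuppSum, DFinsupp.sum]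
    exact Submodule.sum_mem _ fun g _ => key g ▸ hS g
  exact h2

theorem σ_of_mem (V : GVec 𝕜 N) {g : ZMod N} {x : V} (hx : x ∈ V.deg g) :
    V.σ x = sgn 𝕜 g • x := diag_of_mem V.internal _ hx

end GVec

section SplitSum

variable {α : Type u} {Z : Type v} [AddCommGroup Z]

/-- The sum of `f x y` over all ways `l = x ++ y` of cutting the list `l` in two. -/
def splitSum (f : List α → List α → Z) (l : List α) : Z :=
  ∑ i ∈ Finset.range (l.length + 1), f (l.take i) (l.drop i)

theorem splitSum_nil (f : List α → List α → Z) : splitSum f [] = f [] [] := by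
  simp [splitSum]

theorem splitSum_cons (f : List α → List α → Z) (a : α) (l : List α) :
    splitSum f (a :: l) = f [] (a :: l) + splitSum (fun x y => f (a :: x) y) l := by
  simp only [splitSum, List.length_cons]
  rw [Finset.sum_range_succ', add_comm]
  simp

theorem splitSum_add (f g : List α → List α → Z) (l : List α) :
    splitSum (fun x y => f x y + g x y) l = splitSum f l + splitSum g l := by
  simp [splitSum, Finset.sum_add_distrib]

theorem splitSum_map {Y : Type w} [AddCommGroup Y] (φ : Z →+ Y) (f : List α → List α → Z)
    (l : List α) : splitSum (fun x y => φ (f x y)) l = φ (splitSum f l) := by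
  simp [splitSum]

theorem splitSum_zero (l : List α) : splitSum (fun _ _ => (0 : Z)) l = 0 := by
  simp [splitSum]

theorem splitSum_assoc (f : List α → List α → List α → Z) (l : List α) :
    splitSum (fun w z => splitSum (fun x y => f x y z) w) l
      = splitSum (fun x w => splitSum (fun y z => f x y z) w) l := by
  induction l generalizing f with
  | nil => simp [splitSum_nil]
  | cons a l ih =>
    simp only [splitSum_cons, splitSum_nil, splitSum_add, ih, add_assoc]

theorem splitSum_listMap (φ : α → α) (f : List α → List α → Z) (l : List α) :
    splitSum f (l.map φ) = splitSum (fun x y => f (x.map φ) (y.map φ)) l := by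
  simp [splitSum, List.map_take, List.map_drop]

theorem splitSum_eq_zero (f : List α → List α → Z) (l : List α) (h : ∀ x y, f x y = 0) :
    splitSum f l = 0 := by
  simp [splitSum, h]

theorem splitSum_smul {R : Type w} [Semiring R] [Module R Z] (r : R) (f : List α → List α → Z)
    (l : List α) : splitSum (fun x y => r • f x y) l = r • splitSum f l := by
  simp [splitSum, Finset.smul_sum]

end SplitSum

section Multilin

variable (𝕜 : Type u) [Field 𝕜] {A : Type u} [AddCommGroup A] [Module 𝕜 A]
  {V : Type u} [AddCommGroup V] [Module 𝕜 V] {W : Type u} [AddCommGroup W] [Module 𝕜 W]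

/-- A function of finite lists is multilinear if it is linear in each entry. Such a function is
the same as a sequence of `d`-linear maps `A × ⋯ × A → V`, one for each `d ≥ 0`. -/
def IsMultilin (f : List A → V) : Prop :=
  ∀ x y : List A, IsLinearMap 𝕜 fun a => f (x ++ a :: y)

variable {𝕜}

theorem IsMultilin.head {f : List A → V} (h : IsMultilin 𝕜 f) (l : List A) :
    IsLinearMap 𝕜 fun a => f (a :: l) := h [] l

theorem IsMultilin.tail {f : List A → V} (h : IsMultilin 𝕜 f) (a : A) :
    IsMultilin 𝕜 fun l => f (a :: l) := fun x y => h (a :: x) y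

theorem IsMultilin.comp_left {f : List A → V} (h : IsMultilin 𝕜 f) (φ : V →ₗ[𝕜] W) :
    IsMultilin 𝕜 fun l => φ (f l) := fun x y =>
  ⟨fun a b => by simp [(h x y).map_add a b], fun c a => by simp [(h x y).map_smul c a]⟩

theorem IsMultilin.comp_map {f : List A → V} (h : IsMultilin 𝕜 f) (φ : A →ₗ[𝕜] A) :
    IsMultilin 𝕜 fun l => f (l.map φ) := fun x y =>
  ⟨fun a b => by simp [(h (x.map φ) (y.map φ)).map_add (φ a) (φ b)],
    fun c a => by simp [(h (x.map φ) (y.map φ)).map_smul c (φ a)]⟩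

theorem IsMultilin.add {f g : List A → V} (hf : IsMultilin 𝕜 f) (hg : IsMultilin 𝕜 g) :
    IsMultilin 𝕜 fun l => f l + g l := fun x y =>
  ⟨fun a b => by simp only [(hf x y).map_add a b, (hg x y).map_add a b]; abel,
    fun c a => by simp only [(hf x y).map_smul c a, (hg x y).map_smul c a, smul_add]⟩

theorem IsMultilin.smul {f : List A → V} (hf : IsMultilin 𝕜 f) (r : 𝕜) :
    IsMultilin 𝕜 fun l => r • f l := hf.comp_left (r • LinearMap.id)

theorem isMultilin_zero : IsMultilin 𝕜 fun _ : List A => (0 : V) := fun _ _ =>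
  ⟨by simp, by simp⟩

theorem isLinearMap_splitSum (f : A → List A → List A → V) (l : List A)
    (h : ∀ x y, IsLinearMap 𝕜 fun a => f a x y) :
    IsLinearMap 𝕜 fun a => splitSum (f a) l :=
  ⟨fun a b => by simp only [splitSum, (h _ _).map_add a b, Finset.sum_add_distrib],
    fun c a => by simp only [splitSum, (h _ _).map_smul c a, Finset.smul_sum]⟩

theorem isMultilin_splitSum (f : List A → List A → V) (h1 : ∀ y, IsMultilin 𝕜 fun x => f x y)
    (h2 : ∀ x, IsMultilin 𝕜 fun y => f x y) : IsMultilin 𝕜 (splitSum f) := by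
  intro x
  induction x generalizing f with
  | nil =>
    intro y
    simp only [List.nil_append, splitSum_cons]
    have e1 := h2 [] [] y
    have e2 := isLinearMap_splitSum (fun a x y => f (a :: x) y) y fun x z => h1 z [] x
    exact ⟨fun a b => by
        have := e1.map_add a b; have h' := e2.map_add a b
        simp only [List.nil_append] at this h'
        rw [this, h']; abel,
      fun c a => by
        have := e1.map_smul c a; have h' := e2.map_smul c a
        simp only [List.nil_append] at this h'
        rw [this, h', smul_add]⟩
  | cons b x ih =>
    intro y
    simp only [List.cons_append, splitSum_cons]
    have e1 := h2 [] (b :: x) y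
    have e2 := ih (fun x y => f (b :: x) y) (fun z => (h1 z).tail b) (fun z => h2 (b :: z)) y
    exact ⟨fun a b => by
        have := e1.map_add a b; have h' := e2.map_add a b
        simp only [List.cons_append] at this h'
        rw [this, h']; abel,
      fun c a => by
        have := e1.map_smul c a; have h' := e2.map_smul c a
        simp only [List.cons_append] at this h'
        rw [this, h', smul_add]⟩

/-- The insertion operator: the sum of `f (τ x₁, …, τ xᵢ, μ (y₁, …, yⱼ), z₁, …, zₖ)` over all
ways `l = x ++ y ++ z` of cutting `l` in three. With `τ` the reduced sign `a ↦ (-1)^{|a| - 1} a`,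
this is `∑ (-1)^{|x₁| + ⋯ + |xᵢ| - i} f (x, μ y, z)`. -/
def insertSum (τ : A →ₗ[𝕜] A) (μ : List A → A) (f : List A → V) (l : List A) : V :=
  splitSum (fun x w => splitSum (fun y z => f (x.map τ ++ μ y :: z)) w) l

variable (τ : A →ₗ[𝕜] A) (μ : List A → A)

set_option linter.unusedSectionVars false

theorem insertSum_nil (f : List A → V) : insertSum τ μ f [] = f [μ []] := by
  simp [insertSum, splitSum_nil]

theorem insertSum_cons (f : List A → V) (a : A) (l : List A) :
    insertSum τ μ f (a :: l) = splitSum (fun y z => f (μ y :: z)) (a :: l)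
      + insertSum τ μ (fun l => f (τ a :: l)) l := by
  simp [insertSum, splitSum_cons (f := fun x w => splitSum _ w)]

theorem insertSum_add (f g : List A → V) (l : List A) :
    insertSum τ μ (fun l => f l + g l) l = insertSum τ μ f l + insertSum τ μ g l := by
  simp [insertSum, splitSum_add]

theorem insertSum_map (φ : V →+ W) (f : List A → V) (l : List A) :
    insertSum τ μ (fun l => φ (f l)) l = φ (insertSum τ μ f l) := by
  simp only [insertSum, splitSum_map]

theorem insertSum_zero (l : List A) : insertSum τ μ (fun _ => (0 : V)) l = 0 := by
  simp [insertSum, splitSum_zero]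

theorem isMultilin_insertSum {f : List A → V} (hf : IsMultilin 𝕜 f) (hμ : IsMultilin 𝕜 μ) :
    IsMultilin 𝕜 (insertSum τ μ f) := by
  refine isMultilin_splitSum _ (fun w => ?_) (fun x => ?_)
  · intro x x'
    refine isLinearMap_splitSum (fun a y z => f ((x ++ a :: x').map τ ++ μ y :: z)) w fun y z => ?_
    refine ⟨fun a b => ?_, fun c a => ?_⟩
    · simpa using (hf (x.map τ) (x'.map τ ++ μ y :: z)).map_add (τ a) (τ b)
    · simpa using (hf (x.map τ) (x'.map τ ++ μ y :: z)).map_smul c (τ a)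
  · refine isMultilin_splitSum _ (fun z => ?_) (fun y => ?_)
    · exact hμ.comp_left (IsLinearMap.mk' _ (hf (x.map τ) z))
    · intro z z'
      refine ⟨fun a b => ?_, fun c a => ?_⟩
      · simpa using (hf (x.map τ ++ μ y :: z) z').map_add a b
      · simpa using (hf (x.map τ ++ μ y :: z) z').map_smul c a

/-- Insertion is a (twisted) derivation. -/
theorem insertSum_splitSum (g : List A → List A → V) (l : List A) :
    insertSum τ μ (splitSum g) l
      = splitSum (fun x y => insertSum τ μ (fun x' => g x' y) x) l
        + splitSum (fun x y => insertSum τ μ (fun y' => g (x.map τ) y') y) l := by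
  induction l generalizing g with
  | nil => simp [insertSum_nil, splitSum_nil, splitSum_cons, add_comm]
  | cons a l ih =>
    have e1 : insertSum τ μ (fun l => splitSum g (τ a :: l)) l
        = insertSum τ μ (fun l => g [] (τ a :: l)) l
          + insertSum τ μ (splitSum fun x y => g (τ a :: x) y) l := by
      rw [← insertSum_add]
      simp only [splitSum_cons]
    have e2 : splitSum (fun y z => splitSum g (μ y :: z)) (a :: l)
        = splitSum (fun y z => g [] (μ y :: z)) (a :: l)
          + splitSum (fun w v => splitSum (fun x u => g (μ x :: u) v) w) (a :: l) := by
      rw [splitSum_assoc, ← splitSum_add]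
      simp only [splitSum_cons]
    rw [insertSum_cons, e1, e2, ih, splitSum_cons (f := fun w v => splitSum _ w),
      splitSum_cons (f := fun x y => insertSum τ μ (fun x' => g x' y) x),
      splitSum_cons (f := fun x y => insertSum τ μ (fun y' => g (x.map τ) y') y)]
    simp only [insertSum_nil, insertSum_cons, splitSum_nil, splitSum_add, List.map_nil,
      List.map_cons]
    abel

/-- For a square-zero coderivation, insertion squares to zero. -/
theorem insertSum_insertSum (hτ : ∀ a, τ (τ a) = a) (hμ : IsMultilin 𝕜 μ) (hμ0 : μ [] = 0)
    (hτμ : ∀ l, μ (l.map τ) = -τ (μ l)) (hrel : ∀ l, insertSum τ μ μ l = 0)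
    {f : List A → V} (hf : IsMultilin 𝕜 f) (l : List A) :
    insertSum τ μ (insertSum τ μ f) l = 0 := by
  have z : ∀ (g : List A → V), IsMultilin 𝕜 g → ∀ l, g (0 :: l) = 0 := fun g hg l =>
    (IsLinearMap.mk' _ (hg.head l)).map_zero
  induction l generalizing f with
  | nil => rw [insertSum_nil, hμ0, z _ (isMultilin_insertSum τ μ hf hμ)]
  | cons a l ih =>
    have hI := isMultilin_insertSum τ μ hf hμ
    have hz : ∀ l, μ (0 :: l) = 0 := fun l => (IsLinearMap.mk' _ (hμ.head l)).map_zero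
    -- the four contributions
    have e1 : splitSum (fun y w => insertSum τ μ f (μ y :: w)) (a :: l)
        = splitSum (fun w v => f (splitSum (fun x u => μ (μ (a :: x) :: u)) w :: v)) l
          + splitSum (fun x w => insertSum τ μ (fun l => f (τ (μ (a :: x)) :: l)) w) l := by
      rw [splitSum_cons, hμ0, z _ hI, zero_add]
      simp only [insertSum_cons, splitSum_add]
      congr 1
      simp only [splitSum_cons, hμ0, z _ hf, zero_add]
      rw [← splitSum_assoc]
      congr 1
      funext w v
      exact splitSum_map (IsLinearMap.mk' _ (hf.head v)).toAddMonoidHom _ _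
    have e2 : insertSum τ μ (fun l => insertSum τ μ f (τ a :: l)) l
        = splitSum (fun w v => f (insertSum τ μ (fun x => μ (τ a :: x)) w :: v)) l
          - splitSum (fun x w => insertSum τ μ (fun l => f (τ (μ (a :: x)) :: l)) w) l := by
      have e3 : (fun l => insertSum τ μ f (τ a :: l)) = fun l =>
          splitSum (fun y w => f (μ (τ a :: y) :: w)) l
            + insertSum τ μ (fun l => f (a :: l)) l := by
        funext l
        rw [insertSum_cons, splitSum_cons, hμ0, z _ hf, zero_add, hτ]
      rw [e3, insertSum_add, ih (hf.tail a), add_zero, insertSum_splitSum, sub_eq_add_neg]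
      congr 1
      · congr 1
        funext w v
        exact insertSum_map τ μ (IsLinearMap.mk' _ (hf.head v)).toAddMonoidHom _ _
      · have : ∀ (g : List A → List A → V) (l : List A),
            splitSum (fun x y => -g x y) l = -splitSum g l := fun g l => by simp [splitSum]
        rw [← this]
        congr 1
        funext x w
        have h1 : ∀ l, f (μ (τ a :: x.map τ) :: l) = -f (τ (μ (a :: x)) :: l) := by
          intro l
          rw [← List.map_cons (f := τ), hτμ]
          exact (IsLinearMap.mk' _ (hf.head l)).map_neg _
        simp only [h1]
        exact insertSum_map τ μ (-AddMonoidHom.id V) _ _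
    have e4 : ∀ w v, f (splitSum (fun x u => μ (μ (a :: x) :: u)) w :: v)
        + f (insertSum τ μ (fun x => μ (τ a :: x)) w :: v) = 0 := by
      intro w v
      rw [← (hf.head v).map_add]
      have := hrel (a :: w)
      rw [insertSum_cons, splitSum_cons, hμ0, hz,
        zero_add] at this
      rw [this, z _ hf]
    rw [insertSum_cons, e1, e2]
    have e5 : splitSum (fun w v => f (splitSum (fun x u => μ (μ (a :: x) :: u)) w :: v)) l
        + splitSum (fun w v => f (insertSum τ μ (fun x => μ (τ a :: x)) w :: v)) l = 0 := by
      rw [← splitSum_add]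
      exact splitSum_eq_zero _ _ e4
    rw [← e5]
    abel

end Multilin

section Structures

variable {𝕜 : Type u} [Field 𝕜] {N : ℕ}

/-- `RDeg V l r`: the entries of the list `l` are homogeneous and `r` is the sum of their reduced
degrees `|a| - 1`. -/
inductive RDeg (V : GVec 𝕜 N) : List V → ZMod N → Prop
  | nil : RDeg V [] 0
  | cons {a : V} {l : List V} {g r : ZMod N} :
      a ∈ V.deg g → RDeg V l r → RDeg V (a :: l) (g - 1 + r)

end Structures

/-- A cohomologically unital `A∞`-algebra over a field, graded by `ℤ/N`: operations
`μ (a₁, …, a_d)`, `d ≥ 1`, multilinear of degree `2 - d`, with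
`∑ (-1)^{|a₁| + ⋯ + |aᵢ| - i} μ (a₁, …, aᵢ, μ (aᵢ₊₁, …, aⱼ), aⱼ₊₁, …, a_d) = 0`.
The product of the cohomology algebra is `[a] [b] = (-1)^{|a|} [μ (a, b)]`, and `one` represents
a two-sided unit for it. -/
structure AInfAlg (𝕜 : Type u) [Field 𝕜] (N : ℕ) extends GVec 𝕜 N where
  mu : List carrier → carrier
  mu_nil : mu [] = 0
  mu_multilin : IsMultilin 𝕜 mu
  mu_deg : ∀ l r, RDeg toGVec l r → mu l ∈ deg (r + 2)
  rel : ∀ l, insertSum toGVec.τ mu mu l = 0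
  one : carrier
  one_deg : one ∈ deg 0
  mu_one : mu [one] = 0
  one_mul : ∀ a, mu [a] = 0 → ∃ b, mu [one, a] = a + mu [b]
  mul_one : ∀ a, mu [a] = 0 → ∃ b, mu [toGVec.σ a, one] = a + mu [b]

instance (𝕜 : Type u) [Field 𝕜] (N : ℕ) : CoeSort (AInfAlg 𝕜 N) (Type u) :=
  ⟨fun A => A.carrier⟩

/-- A (cohomologically unital) right `A∞`-module over an `A∞`-algebra: operations
`μ (m; a₁, …, a_d)`, `d ≥ 0`, written `mu [a₁, …, a_d] m`, multilinear of degree `1 - d`, with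
`∑ μ (μ (m; a₁, …, aᵢ); aᵢ₊₁, …, a_d)
  + ∑ (-1)^{|m| + |a₁| + ⋯ + |aᵢ| - i - 1} μ (m; a₁, …, μ (aᵢ₊₁, …, aⱼ), …, a_d) = 0`.
The action on cohomology is `[m] [a] = (-1)^{|m|} [μ (m; a)]`. -/
structure AInfMod {𝕜 : Type u} [Field 𝕜] {N : ℕ} (A : AInfAlg 𝕜 N) extends GVec 𝕜 N where
  mu : List A → carrier →ₗ[𝕜] carrier
  mu_multilin : IsMultilin 𝕜 mu
  mu_deg : ∀ l r, RDeg A.toGVec l r → ∀ g, ∀ m ∈ deg g, mu l m ∈ deg (g + r + 1)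
  rel : ∀ l m, splitSum (fun x y => mu y (mu x m)) l
    + insertSum A.τ A.mu mu l (toGVec.τ m) = 0
  mul_one : ∀ m, mu [] m = 0 → ∃ n, mu [A.one] (toGVec.σ m) = m + mu [] n

instance {𝕜 : Type u} [Field 𝕜] {N : ℕ} (A : AInfAlg 𝕜 N) : CoeSort (AInfMod A) (Type u) :=
  ⟨fun M => M.carrier⟩

section Homogeneous

variable {𝕜 : Type u} [Field 𝕜] {N : ℕ}

theorem RDeg.append {V : GVec 𝕜 N} {x y : List V} {r s : ZMod N} (hx : RDeg V x r)
    (hy : RDeg V y s) : RDeg V (x ++ y) (r + s) := by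
  induction hx with
  | nil => simpa using hy
  | cons ha _ ih => rw [List.cons_append, add_assoc]; exact RDeg.cons ha ih

theorem RDeg.singleton {V : GVec 𝕜 N} {a : V} {g : ZMod N} (ha : a ∈ V.deg g) :
    RDeg V [a] (g - 1) := by
  simpa using RDeg.cons ha (RDeg.nil (V := V))

theorem RDeg.split {V : GVec 𝕜 N} (l : List V) {r : ZMod N} (h : RDeg V l r) (i : ℕ) :
    ∃ s t, s + t = r ∧ RDeg V (l.take i) s ∧ RDeg V (l.drop i) t := by
  induction h generalizing i with
  | nil => exact ⟨0, 0, by simp, by simpa using RDeg.nil, by simpa using RDeg.nil⟩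
  | @cons a l g r ha hl ih =>
    cases i with
    | zero => exact ⟨0, g - 1 + r, by simp, by simpa using RDeg.nil, by
        simpa using RDeg.cons ha hl⟩
    | succ i =>
      obtain ⟨s, t, hst, hs, ht⟩ := ih i
      exact ⟨g - 1 + s, t, by rw [← hst]; ring, by simpa using RDeg.cons ha hs, by simpa using ht⟩

theorem splitSum_mem {V : GVec 𝕜 N} {W : Type v} [AddCommGroup W] [Module 𝕜 W]
    (S : Submodule 𝕜 W)
    (f : List V → List V → W) (l : List V) {r : ZMod N} (h : RDeg V l r)
    (hf : ∀ x y s t, s + t = r → RDeg V x s → RDeg V y t → f x y ∈ S) : splitSum f l ∈ S := by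
  refine Submodule.sum_mem _ fun i _ => ?_
  obtain ⟨s, t, hst, hs, ht⟩ := h.split l i
  exact hf _ _ s t hst hs ht

/-- Multilinear functions that agree on homogeneous inputs are equal. -/
theorem IsMultilin.ext_homogeneous {V : GVec 𝕜 N} {W : Type u} [AddCommGroup W] [Module 𝕜 W]
    {f g : List V → W} (hf : IsMultilin 𝕜 f) (hg : IsMultilin 𝕜 g)
    (h : ∀ l r, RDeg V l r → f l = g l) (l : List V) : f l = g l := by
  suffices ∀ y x r, RDeg V x r → f (x ++ y) = g (x ++ y) from this l [] 0 RDeg.nil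
  intro y
  induction y with
  | nil => intro x r hx; simpa using h x r hx
  | cons a y ih =>
    intro x r hx
    induction a using internal_induction V.internal with
    | hom i a ha => simpa using ih (x ++ [a]) _ (hx.append (RDeg.singleton ha))
    | zero =>
      exact ((IsLinearMap.mk' _ (hf x y)).map_zero).trans
        ((IsLinearMap.mk' _ (hg x y)).map_zero).symm
    | add a b ha hb => rw [(hf x y).map_add, (hg x y).map_add, ha, hb]

variable [Fact (Even N)]

namespace GVec

theorem σ_σ (V : GVec 𝕜 N) (x : V) : V.σ (V.σ x) = x := by
  induction x using internal_induction V.internal with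
  | hom i y hy => rw [V.σ_of_mem hy, map_smul, V.σ_of_mem hy, smul_smul, sgn_mul_self, one_smul]
  | zero => simp
  | add y z hy hz => rw [map_add, map_add, hy, hz]

theorem τ_τ (V : GVec 𝕜 N) (x : V) : V.τ (V.τ x) = x := by
  simp [τ, σ_σ]

theorem τ_of_mem (V : GVec 𝕜 N) {g : ZMod N} {x : V} (hx : x ∈ V.deg g) :
    V.τ x = sgn 𝕜 (g - 1) • x := by
  have h : sgn 𝕜 g = -sgn 𝕜 (g - 1) := by
    have := sgn_add 𝕜 (g - 1) 1
    rw [sub_add_cancel, sgn_one] at this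
    rw [this]; ring
  rw [τ, LinearMap.neg_apply, V.σ_of_mem hx, h, neg_smul, neg_neg]

end GVec

theorem map_τ_of_RDeg {V : GVec 𝕜 N} {W : Type u} [AddCommGroup W] [Module 𝕜 W]
    {f : List V → W} (hf : IsMultilin 𝕜 f) {l : List V} {r : ZMod N} (h : RDeg V l r) :
    f (l.map V.τ) = sgn 𝕜 r • f l := by
  induction h generalizing f with
  | nil => simp [sgn_zero]
  | @cons a l g r ha hl ih =>
    rw [List.map_cons, V.τ_of_mem ha, (hf.head _).map_smul, ih (hf.tail a), sgn_add, smul_smul]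

theorem AInfAlg.mu_map_τ (A : AInfAlg 𝕜 N) (l : List A) :
    A.mu (l.map A.τ) = -A.τ (A.mu l) := by
  refine IsMultilin.ext_homogeneous (A.mu_multilin.comp_map A.τ)
    (A.mu_multilin.comp_left (-A.τ)) (fun l r h => ?_) l
  rw [map_τ_of_RDeg A.mu_multilin h, LinearMap.neg_apply, A.τ_of_mem (A.mu_deg l r h), ← neg_smul]
  congr 1
  rw [show r + 2 - 1 = r + 1 by ring, sgn_add, sgn_one]
  ring

end Homogeneous

section Modules

variable {𝕜 : Type u} [Field 𝕜] {N : ℕ} {A : AInfAlg 𝕜 N}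

/-- Sequences of maps `t (m; a₁, …, a_d) = t [a₁, …, a_d] m`, `d ≥ 0`, linear in `m`. -/
abbrev PreHom (M P : AInfMod A) : Type u := List A → M →ₗ[𝕜] P

/-- The pre-module homomorphisms of degree `k`: multilinear, with `t (m; a₁, …, a_d)` of degree
`|m| + |a₁| + ⋯ + |a_d| - d + k`. -/
def homDeg (M P : AInfMod A) (k : ZMod N) : Submodule 𝕜 (PreHom M P) where
  carrier := {t | IsMultilin 𝕜 t ∧
    ∀ l r, RDeg A.toGVec l r → ∀ g, ∀ m ∈ M.deg g, t l m ∈ P.deg (g + r + k)}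
  add_mem' := fun {_ _} hs ht => ⟨hs.1.add ht.1, fun l r hl g m hm =>
    add_mem (hs.2 l r hl g m hm) (ht.2 l r hl g m hm)⟩
  zero_mem' := ⟨isMultilin_zero, fun _ _ _ _ _ _ => zero_mem _⟩
  smul_mem' := fun c _ ht => ⟨ht.1.smul c, fun l r hl g m hm =>
    Submodule.smul_mem _ c (ht.2 l r hl g m hm)⟩

/-- Composition: `(t ∘ s) (m; a₁, …, a_d) = ∑ t (s (m; a₁, …, aᵢ); aᵢ₊₁, …, a_d)`. -/
def preComp (M P Q : AInfMod A) : PreHom P Q →ₗ[𝕜] PreHom M P →ₗ[𝕜] PreHom M Q :=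
  LinearMap.mk₂ 𝕜 (fun t s l => splitSum (fun x y => t y ∘ₗ s x) l)
    (fun t t' s => by funext l; simp only [Pi.add_apply, LinearMap.add_comp, splitSum_add])
    (fun c t s => by funext l; simp only [Pi.smul_apply, LinearMap.smul_comp, splitSum_smul])
    (fun t s s' => by funext l; simp only [Pi.add_apply, LinearMap.comp_add, splitSum_add])
    (fun c t s => by funext l; simp only [Pi.smul_apply, LinearMap.comp_smul, splitSum_smul])

/-- The identity pre-module homomorphism. -/
def preId (M : AInfMod A) : PreHom M M
  | [] => LinearMap.id
  | _ :: _ => 0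

/-- `(D t) (m; a₁, …, a_d)
  = ∑ (-1)^{|m| + |a₁| + ⋯ + |aᵢ| - i - 1} t (m; a₁, …, μ (aᵢ₊₁, …, aⱼ), …, a_d)`. -/
noncomputable def preIns (M P : AInfMod A) : PreHom M P →ₗ[𝕜] PreHom M P where
  toFun t l := insertSum A.τ A.mu t l ∘ₗ M.τ
  map_add' s t := by
    funext l
    simp only [Pi.add_apply, ← LinearMap.add_comp]
    congr 1
    exact insertSum_add _ _ s t l
  map_smul' c t := by
    funext l
    simp only [Pi.smul_apply, RingHom.id_apply, ← LinearMap.smul_comp]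
    congr 1
    exact insertSum_map A.τ A.mu
      (c • (LinearMap.id : (M →ₗ[𝕜] P) →ₗ[𝕜] (M →ₗ[𝕜] P))).toAddMonoidHom t l

/-- The differential of a pre-module homomorphism of degree `k`:
`∂ t = μ ∘ t - (-1)^k (t ∘ μ + D t)`. -/
noncomputable def preD (M P : AInfMod A) (k : ZMod N) : PreHom M P →ₗ[𝕜] PreHom M P :=
  preComp M P P P.mu - sgn 𝕜 k • ((preComp M M P).flip M.mu + preIns M P)

theorem preComp_apply {M P Q : AInfMod A} (t : PreHom P Q) (s : PreHom M P) (l : List A) :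
    preComp M P Q t s l = splitSum (fun x y => t y ∘ₗ s x) l := rfl

theorem preIns_apply {M P : AInfMod A} (t : PreHom M P) (l : List A) :
    preIns M P t l = insertSum A.τ A.mu t l ∘ₗ M.τ := rfl

theorem preD_apply {M P : AInfMod A} (k : ZMod N) (t : PreHom M P) :
    preD M P k t
      = preComp M P P P.mu t - sgn 𝕜 k • (preComp M M P t M.mu + preIns M P t) := rfl

theorem preComp_assoc {M P Q R : AInfMod A} (r : PreHom Q R) (t : PreHom P Q) (s : PreHom M P) :
    preComp M P R (preComp P Q R r t) s = preComp M Q R r (preComp M P Q t s) := by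
  funext l
  simp only [preComp_apply]
  have e1 : ∀ x y : List A, splitSum (fun x y => r y ∘ₗ t x) y ∘ₗ s x
      = splitSum (fun u v => (r v ∘ₗ t u) ∘ₗ s x) y := fun x y =>
    (splitSum_map (LinearMap.lcomp 𝕜 R (s x)).toAddMonoidHom _ _).symm
  have e2 : ∀ x y : List A, r y ∘ₗ splitSum (fun x y => t y ∘ₗ s x) x
      = splitSum (fun u v => r y ∘ₗ (t v ∘ₗ s u)) x := fun x y =>
    (splitSum_map (LinearMap.llcomp 𝕜 M Q R (r y)).toAddMonoidHom _ _).symm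
  simp only [e1, e2, LinearMap.comp_assoc]
  exact (splitSum_assoc (fun x y z => r z ∘ₗ t y ∘ₗ s x) l).symm

theorem preId_comp {M P : AInfMod A} (t : PreHom M P) : preComp M P P (preId P) t = t := by
  funext l
  rw [preComp_apply]
  induction l generalizing t with
  | nil => simp [splitSum_nil, preId]
  | cons a l ih =>
    rw [splitSum_cons, ih (fun l => t (a :: l))]
    simp [preId]

theorem preComp_id {M P : AInfMod A} (t : PreHom M P) : preComp M M P t (preId M) = t := by
  funext l
  rw [preComp_apply]
  cases l with
  | nil => simp [splitSum_nil, preId]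
  | cons a l => rw [splitSum_cons, splitSum_eq_zero] <;> simp [preId]

theorem preId_mem (M : AInfMod A) : preId M ∈ homDeg M M 0 := by
  refine ⟨fun x y => ?_, fun l r hl g m hm => ?_⟩
  · have : ∀ a, preId M (x ++ a :: y) = 0 := fun a => by cases x <;> rfl
    simp only [this]
    exact ⟨by simp, by simp⟩
  · cases hl with
    | nil => simpa [preId] using hm
    | cons _ _ => exact zero_mem _

theorem isMultilin_preComp {M P Q : AInfMod A} {t : PreHom P Q} {s : PreHom M P}
    (ht : IsMultilin 𝕜 t) (hs : IsMultilin 𝕜 s) : IsMultilin 𝕜 (preComp M P Q t s) :=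
  isMultilin_splitSum _ (fun y => hs.comp_left (LinearMap.llcomp 𝕜 M P Q (t y)))
    (fun x => ht.comp_left (LinearMap.lcomp 𝕜 Q (s x)))

theorem mu_mem_homDeg (M : AInfMod A) : M.mu ∈ homDeg M M 1 := ⟨M.mu_multilin, M.mu_deg⟩

theorem splitSum_apply {M P : Type u} [AddCommGroup M] [Module 𝕜 M] [AddCommGroup P] [Module 𝕜 P]
    (f : List A → List A → M →ₗ[𝕜] P) (l : List A) (m : M) :
    splitSum f l m = splitSum (fun x y => f x y m) l := by
  simp [splitSum]

theorem preComp_mem {M P Q : AInfMod A} {j k : ZMod N} {t : PreHom P Q} {s : PreHom M P}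
    (ht : t ∈ homDeg P Q j) (hs : s ∈ homDeg M P k) : preComp M P Q t s ∈ homDeg M Q (j + k) := by
  refine ⟨isMultilin_preComp ht.1 hs.1, fun l r hl g m hm => ?_⟩
  rw [preComp_apply, splitSum_apply]
  refine splitSum_mem _ _ l hl fun x y a b hab hx hy => ?_
  have := ht.2 y b hy _ _ (hs.2 x a hx g m hm)
  rw [LinearMap.comp_apply, show g + r + (j + k) = g + a + k + b + j by rw [← hab]; ring]
  exact this

variable [Fact (Even N)]

theorem GVec.τ_mem (V : GVec 𝕜 N) {g : ZMod N} {x : V} (hx : x ∈ V.deg g) : V.τ x ∈ V.deg g := by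
  rw [V.τ_of_mem hx]
  exact Submodule.smul_mem _ _ hx

theorem RDeg.map_τ {V : GVec 𝕜 N} {l : List V} {r : ZMod N} (h : RDeg V l r) :
    RDeg V (l.map V.τ) r := by
  induction h with
  | nil => exact RDeg.nil
  | cons ha _ ih => exact RDeg.cons (V.τ_mem ha) ih

theorem preIns_mem {M P : AInfMod A} {k : ZMod N} {t : PreHom M P} (ht : t ∈ homDeg M P k) :
    preIns M P t ∈ homDeg M P (k + 1) := by
  refine ⟨(isMultilin_insertSum A.τ A.mu ht.1 A.mu_multilin).comp_left (LinearMap.lcomp 𝕜 P M.τ),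
    fun l r hl g m hm => ?_⟩
  have hm' := M.τ_mem hm
  rw [preIns_apply, LinearMap.comp_apply]
  generalize M.τ m = m' at hm'
  rw [insertSum, splitSum_apply]
  refine splitSum_mem _ _ l hl fun x w a b hab hx hw => ?_
  rw [splitSum_apply]
  refine splitSum_mem _ _ w hw fun y z c d hcd hy hz => ?_
  have := ht.2 _ _ (hx.map_τ.append (RDeg.cons (A.mu_deg y c hy) hz)) g m' hm'
  rw [show g + r + (k + 1) = g + (a + (c + 2 - 1 + d)) + k by rw [← hab, ← hcd]; ring]
  exact this

theorem preD_mem {M P : AInfMod A} {k : ZMod N} {t : PreHom M P} (ht : t ∈ homDeg M P k) :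
    preD M P k t ∈ homDeg M P (k + 1) := by
  rw [preD_apply]
  refine sub_mem ?_ (Submodule.smul_mem _ _ (add_mem ?_ (preIns_mem ht)))
  · rw [add_comm k 1]; exact preComp_mem (mu_mem_homDeg P) ht
  · exact preComp_mem ht (mu_mem_homDeg M)

/-- The sign rule for a pre-module homomorphism of degree `k`. -/
theorem homDeg_τ {M P : AInfMod A} {k : ZMod N} {t : PreHom M P} (ht : t ∈ homDeg M P k)
    (l : List A) : t (l.map A.τ) ∘ₗ M.τ = sgn 𝕜 k • (P.τ ∘ₗ t l) := by
  refine IsMultilin.ext_homogeneous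
    (f := fun l => t (l.map A.τ) ∘ₗ M.τ) (g := fun l => sgn 𝕜 k • (P.τ ∘ₗ t l))
    ((ht.1.comp_map A.τ).comp_left (LinearMap.lcomp 𝕜 P M.τ))
    ((ht.1.comp_left (LinearMap.llcomp 𝕜 M P P P.τ)).smul _) (fun l r hl => ?_) l
  ext m
  induction m using internal_induction M.internal with
  | hom g m hm =>
    simp only [LinearMap.comp_apply, LinearMap.smul_apply]
    rw [M.τ_of_mem hm, map_smul, map_τ_of_RDeg ht.1 hl, P.τ_of_mem (ht.2 l r hl g m hm),
      LinearMap.smul_apply, smul_smul, smul_smul]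
    congr 1
    rw [← sgn_add, show g + r + k - 1 = (g - 1 + r) + k by ring, sgn_add 𝕜 (g - 1 + r) k,
      mul_comm (sgn 𝕜 k), mul_assoc, sgn_mul_self, mul_one]
  | zero => simp
  | add y z hy hz => rw [map_add, map_add, hy, hz]

theorem preIns_comp {M P Q : AInfMod A} {k : ZMod N} (t : PreHom P Q) {s : PreHom M P}
    (hs : s ∈ homDeg M P k) :
    preIns M Q (preComp M P Q t s)
      = preComp M P Q t (preIns M P s) + sgn 𝕜 k • preComp M P Q (preIns P Q t) s := by
  funext l
  have h0 : preComp M P Q t s = splitSum fun x y => t y ∘ₗ s x := rfl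
  rw [preIns_apply, h0, insertSum_splitSum, LinearMap.add_comp, Pi.add_apply, Pi.smul_apply,
    preComp_apply, preComp_apply, ← splitSum_smul]
  congr 1
  · refine (splitSum_map (LinearMap.lcomp 𝕜 Q M.τ).toAddMonoidHom _ _).symm.trans ?_
    congr 1
    funext x y
    have := insertSum_map A.τ A.mu (LinearMap.llcomp 𝕜 M P Q (t y)).toAddMonoidHom s x
    simp only [LinearMap.toAddMonoidHom_coe, LinearMap.llcomp_apply', LinearMap.lcomp_apply'] at *
    rw [this, preIns_apply, LinearMap.comp_assoc]
  · refine (splitSum_map (LinearMap.lcomp 𝕜 Q M.τ).toAddMonoidHom _ _).symm.trans ?_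
    congr 1
    funext x y
    have := insertSum_map A.τ A.mu (LinearMap.lcomp 𝕜 Q (s (x.map A.τ))).toAddMonoidHom t y
    simp only [LinearMap.toAddMonoidHom_coe, LinearMap.lcomp_apply'] at *
    rw [this, preIns_apply, LinearMap.comp_assoc, homDeg_τ hs, LinearMap.comp_smul,
      LinearMap.comp_assoc]

theorem preIns_preIns {M P : AInfMod A} {k : ZMod N} {t : PreHom M P} (ht : t ∈ homDeg M P k) :
    preIns M P (preIns M P t) = 0 := by
  funext l
  have h1 : insertSum A.τ A.mu (preIns M P t) l
      = insertSum A.τ A.mu (insertSum A.τ A.mu t) l ∘ₗ M.τ :=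
    insertSum_map A.τ A.mu (LinearMap.lcomp 𝕜 P M.τ).toAddMonoidHom (insertSum A.τ A.mu t) l
  rw [preIns_apply, h1, insertSum_insertSum A.τ A.mu A.τ_τ A.mu_multilin A.mu_nil A.mu_map_τ
    A.rel ht.1]
  simp

theorem mu_rel (M : AInfMod A) : preComp M M M M.mu M.mu + preIns M M M.mu = 0 := by
  funext l
  ext m
  have := M.rel l m
  simpa [preComp_apply, preIns_apply, splitSum_apply] using this

theorem preD_comp {M P Q : AInfMod A} {j k : ZMod N} {t : PreHom P Q} {s : PreHom M P}
    (hs : s ∈ homDeg M P k) :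
    preD M Q (j + k) (preComp M P Q t s)
      = preComp M P Q (preD P Q j t) s + sgn 𝕜 j • preComp M P Q t (preD M P k s) := by
  simp only [preD_apply, map_sub, map_add, map_smul, LinearMap.sub_apply, LinearMap.add_apply,
    LinearMap.smul_apply, preComp_assoc, preIns_comp t hs, sgn_add]
  have h := sgn_mul_self 𝕜 k
  simp only [smul_add, smul_sub, smul_smul, mul_assoc, h, mul_one]
  abel

theorem preD_preD {M P : AInfMod A} {k : ZMod N} {t : PreHom M P} (ht : t ∈ homDeg M P k) :
    preD M P (k + 1) (preD M P k t) = 0 := by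
  have h := sgn_mul_self 𝕜 k
  have e1 := mu_rel M
  have e2 := mu_rel P
  have e3 : preIns M M M.mu = -preComp M M M M.mu M.mu := (neg_eq_of_add_eq_zero_right e1).symm
  have e4 : preIns P P P.mu = -preComp P P P P.mu P.mu := (neg_eq_of_add_eq_zero_right e2).symm
  simp only [preD_apply, map_sub, map_add, map_smul, LinearMap.sub_apply, LinearMap.add_apply,
    LinearMap.smul_apply, preComp_assoc, preIns_comp _ ht, preIns_comp _ (mu_mem_homDeg M),
    preIns_preIns ht, e3, e4, sgn_add, sgn_one, map_neg, LinearMap.neg_apply]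
  simp only [smul_add, smul_sub, smul_smul, smul_neg, mul_neg, mul_one, neg_smul, one_smul,
    neg_mul, h]
  abel

end Modules

/-- A graded `𝕜`-linear category, with morphism spaces `Hom X Y k` in each degree `k ∈ ℤ/N`.
`comp h g f` is the composite `g ∘ f`. -/
structure GrCat (𝕜 : Type u) [Field 𝕜] (N : ℕ) where
  Obj : Type v
  Hom : Obj → Obj → ZMod N → Type w
  [addCommGroup : ∀ X Y k, AddCommGroup (Hom X Y k)]
  [module : ∀ X Y k, Module 𝕜 (Hom X Y k)]
  id : ∀ X, Hom X X 0
  comp : ∀ {X Y Z : Obj} {j k l : ZMod N}, j + k = l →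
    (Hom Y Z j →ₗ[𝕜] Hom X Y k →ₗ[𝕜] Hom X Z l)
  id_comp : ∀ {X Y : Obj} {k : ZMod N} (f : Hom X Y k), comp (zero_add k) (id Y) f = f
  comp_id : ∀ {X Y : Obj} {k : ZMod N} (f : Hom X Y k), comp (add_zero k) f (id X) = f
  assoc : ∀ {W X Y Z : Obj} {i j k ij jk l : ZMod N} (hij : i + j = ij) (hjk : j + k = jk)
    (h1 : ij + k = l) (h2 : i + jk = l) (f : Hom Y Z i) (g : Hom X Y j) (h : Hom W X k),
    comp h1 (comp hij f g) h = comp h2 f (comp hjk g h)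

attribute [instance] GrCat.addCommGroup GrCat.module

/-- A degree-preserving `𝕜`-linear functor between graded categories, with object map `obj`. -/
structure GrFunctor {𝕜 : Type u} [Field 𝕜] {N : ℕ} (C : GrCat.{u, v, w} 𝕜 N)
    (D : GrCat.{u, v', w'} 𝕜 N) (obj : C.Obj → D.Obj) where
  map : ∀ {X Y : C.Obj} {k : ZMod N}, C.Hom X Y k →ₗ[𝕜] D.Hom (obj X) (obj Y) k
  map_id : ∀ X, map (C.id X) = D.id (obj X)
  map_comp : ∀ {X Y Z : C.Obj} {j k l : ZMod N} (h : j + k = l) (g : C.Hom Y Z j)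
    (f : C.Hom X Y k), map (C.comp h g f) = D.comp h (map g) (map f)

section GrCat

variable {𝕜 : Type u} [Field 𝕜] {N : ℕ}

/-- `f` and `g` are mutually inverse isomorphisms of degree `0`. -/
def GrCat.IsInverse (C : GrCat.{u, v, w} 𝕜 N) {X Y : C.Obj} (f : C.Hom X Y 0)
    (g : C.Hom Y X 0) : Prop :=
  C.comp (add_zero 0) g f = C.id X ∧ C.comp (add_zero 0) f g = C.id Y

/-- Fully faithful on morphisms of every degree, and essentially surjective. -/
def GrFunctor.IsEquivalence {C : GrCat.{u, v, w} 𝕜 N} {D : GrCat.{u, v', w'} 𝕜 N}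
    {a : C.Obj → D.Obj} (F : GrFunctor C D a) : Prop :=
  (∀ (X Y : C.Obj) (k : ZMod N),
    Function.Bijective (F.map : C.Hom X Y k →ₗ[𝕜] D.Hom (a X) (a Y) k)) ∧
  ∀ Y : D.Obj, ∃ (X : C.Obj) (f : D.Hom (a X) Y 0) (g : D.Hom Y (a X) 0), D.IsInverse f g

/-- The identity functor. -/
def GrFunctor.refl (C : GrCat.{u, v, w} 𝕜 N) : GrFunctor C C fun X => X where
  map := LinearMap.id
  map_id _ := rfl
  map_comp _ _ _ := rfl

/-- The composite of two functors, `F` first. -/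
def GrFunctor.trans {C : GrCat.{u, v, w} 𝕜 N} {D : GrCat.{u, v', w'} 𝕜 N}
    {E : GrCat.{u, v, w} 𝕜 N} {a : C.Obj → D.Obj} {b : D.Obj → E.Obj} (F : GrFunctor C D a)
    (G : GrFunctor D E b) : GrFunctor C E fun X => b (a X) where
  map := G.map ∘ₗ F.map
  map_id X := by simp [F.map_id, G.map_id]
  map_comp h g f := by simp [F.map_comp, G.map_comp]

/-- The functors `F` and `G` are isomorphic, by a natural isomorphism of degree `0`. -/
def GrFunctor.IsIsomorphic {C : GrCat.{u, v, w} 𝕜 N} {D : GrCat.{u, v', w'} 𝕜 N}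
    {a b : C.Obj → D.Obj} (F : GrFunctor C D a) (G : GrFunctor C D b) : Prop :=
  ∃ (η : ∀ X, D.Hom (a X) (b X) 0) (θ : ∀ X, D.Hom (b X) (a X) 0),
    (∀ X, D.IsInverse (η X) (θ X)) ∧
    ∀ (X Y : C.Obj) (k : ZMod N) (f : C.Hom X Y k),
      D.comp (zero_add k) (η Y) (F.map f) = D.comp (add_zero k) (G.map f) (η X)

/-- Two graded categories are equivalent if there are mutually quasi-inverse functors. -/
def GrCat.IsEquivalent (C : GrCat.{u, v, w} 𝕜 N) (D : GrCat.{u, v', w'} 𝕜 N) : Prop :=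
  ∃ (a : C.Obj → D.Obj) (b : D.Obj → C.Obj) (F : GrFunctor C D a) (G : GrFunctor D C b),
    (F.trans G).IsIsomorphic (GrFunctor.refl C) ∧ (G.trans F).IsIsomorphic (GrFunctor.refl D)

end GrCat

/-- A differential `ℤ/N`-graded category. The morphisms of degree `k` from `X` to `Y` form the
subspace `hom X Y k` of an ambient vector space `Hom X Y`, and `d k` is the differential
`hom X Y k → hom X Y (k + 1)`; only the values on these subspaces matter. -/
structure DGCat (𝕜 : Type u) [Field 𝕜] (N : ℕ) where
  Obj : Type v
  Hom : Obj → Obj → Type w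
  [addCommGroup : ∀ X Y, AddCommGroup (Hom X Y)]
  [module : ∀ X Y, Module 𝕜 (Hom X Y)]
  hom : ∀ X Y, ZMod N → Submodule 𝕜 (Hom X Y)
  id : ∀ X, Hom X X
  id_mem : ∀ X, id X ∈ hom X X 0
  comp : ∀ {X Y Z : Obj}, Hom Y Z →ₗ[𝕜] Hom X Y →ₗ[𝕜] Hom X Z
  comp_mem : ∀ {X Y Z : Obj} {j k : ZMod N} {g : Hom Y Z} {f : Hom X Y},
    g ∈ hom Y Z j → f ∈ hom X Y k → comp g f ∈ hom X Z (j + k)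
  id_comp : ∀ {X Y : Obj} (f : Hom X Y), comp (id Y) f = f
  comp_id : ∀ {X Y : Obj} (f : Hom X Y), comp f (id X) = f
  assoc : ∀ {W X Y Z : Obj} (f : Hom Y Z) (g : Hom X Y) (h : Hom W X),
    comp (comp f g) h = comp f (comp g h)
  d : ∀ {X Y : Obj}, ZMod N → (Hom X Y →ₗ[𝕜] Hom X Y)
  d_mem : ∀ {X Y : Obj} {k : ZMod N} {f : Hom X Y}, f ∈ hom X Y k → d k f ∈ hom X Y (k + 1)
  d_d : ∀ {X Y : Obj} {k : ZMod N} {f : Hom X Y}, f ∈ hom X Y k → d (k + 1) (d k f) = 0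
  d_comp : ∀ {X Y Z : Obj} {j k : ZMod N} {g : Hom Y Z} {f : Hom X Y},
    g ∈ hom Y Z j → f ∈ hom X Y k →
      d (j + k) (comp g f) = comp (d j g) f + sgn 𝕜 j • comp g (d k f)

attribute [instance] DGCat.addCommGroup DGCat.module

namespace DGCat

variable {𝕜 : Type u} [Field 𝕜] {N : ℕ} (C : DGCat.{u, v, w} 𝕜 N)

/-- The closed morphisms of degree `k`. -/
def Z (X Y : C.Obj) (k : ZMod N) : Submodule 𝕜 (C.Hom X Y) := C.hom X Y k ⊓ LinearMap.ker (C.d k)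

/-- The exact morphisms of degree `k`. -/
def B (X Y : C.Obj) (k : ZMod N) : Submodule 𝕜 (C.Hom X Y) :=
  (C.hom X Y (k - 1)).map (C.d (k - 1))

/-- The cohomology in degree `k` of the complex of morphisms. -/
abbrev Coh (X Y : C.Obj) (k : ZMod N) : Type w := C.Z X Y k ⧸ (C.B X Y k).submoduleOf (C.Z X Y k)

/-- The cohomology class of a closed morphism. -/
abbrev cls {X Y : C.Obj} {k : ZMod N} : C.Z X Y k →ₗ[𝕜] C.Coh X Y k :=
  ((C.B X Y k).submoduleOf (C.Z X Y k)).mkQ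

theorem d_id (X : C.Obj) : C.d 0 (C.id X) = 0 := by
  have h := C.d_comp (C.id_mem X) (C.id_mem X)
  rw [C.id_comp, C.comp_id, C.id_comp, sgn_zero, one_smul, add_zero] at h
  simpa using h

theorem comp_mem_Z {X Y Z : C.Obj} {j k : ZMod N} {g : C.Hom Y Z} {f : C.Hom X Y}
    (hg : g ∈ C.Z Y Z j) (hf : f ∈ C.Z X Y k) : C.comp g f ∈ C.Z X Z (j + k) := by
  refine ⟨C.comp_mem hg.1 hf.1, ?_⟩
  change C.d (j + k) (C.comp g f) = 0
  rw [C.d_comp hg.1 hf.1, LinearMap.mem_ker.1 hg.2, LinearMap.mem_ker.1 hf.2]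
  simp

theorem comp_mem_B_left {X Y Z : C.Obj} {j k : ZMod N} {g : C.Hom Y Z} {f : C.Hom X Y}
    (hg : g ∈ C.B Y Z j) (hf : f ∈ C.Z X Y k) : C.comp g f ∈ C.B X Z (j + k) := by
  obtain ⟨g', hg', rfl⟩ := hg
  have e : j + k - 1 = j - 1 + k := by ring
  refine ⟨C.comp g' f, ?_, ?_⟩
  · rw [e]; exact C.comp_mem hg' hf.1
  · rw [e, C.d_comp hg' hf.1, LinearMap.mem_ker.1 hf.2]
    simp

theorem comp_mem_B_right {X Y Z : C.Obj} {j k : ZMod N} {g : C.Hom Y Z} {f : C.Hom X Y}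
    (hg : g ∈ C.Z Y Z j) (hf : f ∈ C.B X Y k) : C.comp g f ∈ C.B X Z (j + k) := by
  obtain ⟨f', hf', rfl⟩ := hf
  have e : j + k - 1 = j + (k - 1) := by ring
  refine ⟨sgn 𝕜 j • C.comp g f', ?_, ?_⟩
  · rw [e]; exact Submodule.smul_mem _ _ (C.comp_mem hg.1 hf')
  · rw [e, map_smul, C.d_comp hg.1 hf', LinearMap.mem_ker.1 hg.2]
    simp [smul_smul, sgn_mul_self]

/-- Composition of closed morphisms. -/
def compZ {X Y Z : C.Obj} {j k l : ZMod N} (h : j + k = l) :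
    C.Z Y Z j →ₗ[𝕜] C.Z X Y k →ₗ[𝕜] C.Z X Z l :=
  LinearMap.mk₂ 𝕜 (fun g f => ⟨C.comp g.1 f.1, h ▸ C.comp_mem_Z g.2 f.2⟩)
    (fun _ _ _ => Subtype.ext (by simp)) (fun _ _ _ => Subtype.ext (by simp))
    (fun _ _ _ => Subtype.ext (by simp)) (fun _ _ _ => Subtype.ext (by simp))

/-- Composition of cohomology classes: `[g] ∘ [f] = [g ∘ f]`. -/
def compCoh {X Y Z : C.Obj} {j k l : ZMod N} (h : j + k = l) :
    C.Coh Y Z j →ₗ[𝕜] C.Coh X Y k →ₗ[𝕜] C.Coh X Z l :=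
  Submodule.liftQ _
    ({ toFun := fun g => Submodule.liftQ _ (C.cls ∘ₗ C.compZ h g) (by
          intro f hf
          rw [LinearMap.mem_ker, LinearMap.comp_apply, Submodule.mkQ_apply,
            Submodule.Quotient.mk_eq_zero]
          subst h
          exact C.comp_mem_B_right g.2 hf)
       map_add' := fun g g' => by
          refine Submodule.linearMap_qext _ (LinearMap.ext fun f => ?_)
          simp
       map_smul' := fun c g => by
          refine Submodule.linearMap_qext _ (LinearMap.ext fun f => ?_)
          simp } : C.Z Y Z j →ₗ[𝕜] C.Coh X Y k →ₗ[𝕜] C.Coh X Z l)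
    (by
      intro g hg
      rw [LinearMap.mem_ker]
      refine Submodule.linearMap_qext _ (LinearMap.ext fun f => ?_)
      change C.cls (C.compZ h g f) = 0
      rw [Submodule.mkQ_apply, Submodule.Quotient.mk_eq_zero]
      subst h
      exact C.comp_mem_B_left hg f.2)

theorem compCoh_cls {X Y Z : C.Obj} {j k l : ZMod N} (h : j + k = l) (g : C.Z Y Z j)
    (f : C.Z X Y k) : C.compCoh h (C.cls g) (C.cls f) = C.cls (C.compZ h g f) := rfl

/-- The cohomology category of a dg category. -/
def cohomology : GrCat.{u, v, w} 𝕜 N where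
  Obj := C.Obj
  Hom := C.Coh
  id X := C.cls ⟨C.id X, C.id_mem X, C.d_id X⟩
  comp h := C.compCoh h
  id_comp f := by
    obtain ⟨f, rfl⟩ := Submodule.mkQ_surjective _ f
    rw [compCoh_cls]
    exact congrArg _ (Subtype.ext (C.id_comp f.1))
  comp_id f := by
    obtain ⟨f, rfl⟩ := Submodule.mkQ_surjective _ f
    rw [compCoh_cls]
    exact congrArg _ (Subtype.ext (C.comp_id f.1))
  assoc hij hjk h1 h2 f g h := by
    obtain ⟨f, rfl⟩ := Submodule.mkQ_surjective _ f
    obtain ⟨g, rfl⟩ := Submodule.mkQ_surjective _ g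
    obtain ⟨h, rfl⟩ := Submodule.mkQ_surjective _ h
    simp only [compCoh_cls]
    exact congrArg _ (Subtype.ext (C.assoc f.1 g.1 h.1))

end DGCat

/-- The dg category `mod^{A∞}(A)` of right `A∞`-modules over `A`. -/
noncomputable def AInfAlg.modDG {𝕜 : Type u} [Field 𝕜] {N : ℕ} [Fact (Even N)]
    (A : AInfAlg 𝕜 N) : DGCat.{u, u + 1, u} 𝕜 N where
  Obj := AInfMod A
  Hom := PreHom
  hom := homDeg
  id := preId
  id_mem := preId_mem
  comp := preComp _ _ _
  comp_mem := preComp_mem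
  id_comp := preId_comp
  comp_id := preComp_id
  assoc := preComp_assoc
  d := preD _ _
  d_mem := preD_mem
  d_d := preD_preD
  d_comp _ hf := preD_comp hf

section GMod

variable {𝕜 : Type u} [Field 𝕜] {N : ℕ} {A : Type u} [Ring A] [Algebra 𝕜 A]

/-- A graded right module over the `𝕜`-algebra `A` with grading `𝒜`. -/
structure GMod (𝒜 : ZMod N → Submodule 𝕜 A) extends GVec 𝕜 N where
  [opModule : Module Aᵐᵒᵖ carrier]
  [isScalarTower : IsScalarTower 𝕜 Aᵐᵒᵖ carrier]
  smul_mem : ∀ (g h : ZMod N) (a : A) (m : carrier), a ∈ 𝒜 h → m ∈ deg g →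
    MulOpposite.op a • m ∈ deg (g + h)

attribute [instance] GMod.opModule GMod.isScalarTower

instance (𝒜 : ZMod N → Submodule 𝕜 A) : CoeSort (GMod 𝒜) (Type u) := ⟨fun M => M.carrier⟩

end GMod

section Cohomology

variable {𝕜 : Type u} [Field 𝕜] {N : ℕ}

/-- The cohomology of a graded vector space with a differential `d`. -/
abbrev CohOf {V : Type u} [AddCommGroup V] [Module 𝕜 V] (d : V →ₗ[𝕜] V) : Type u :=
  LinearMap.ker d ⧸ (LinearMap.range d).submoduleOf (LinearMap.ker d)

/-- The grading of the cohomology: degree `g` classes are those of degree `g` cocycles. -/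
def cohDeg (V : GVec 𝕜 N) (d : V →ₗ[𝕜] V) (g : ZMod N) : Submodule 𝕜 (CohOf d) :=
  ((V.deg g).submoduleOf (LinearMap.ker d)).map (Submodule.mkQ _)

theorem GVec.d_proj {V : GVec 𝕜 N} {d : V →ₗ[𝕜] V}
    (hd : ∀ g, ∀ x ∈ V.deg g, d x ∈ V.deg (g + 1)) (g : ZMod N) (x : V) :
    d (V.proj g x) = V.proj (g + 1) (d x) := by
  induction x using internal_induction V.internal with
  | hom h y hy =>
    by_cases hgh : g = h
    · subst hgh; rw [V.proj_of_mem hy, V.proj_of_mem (hd _ _ hy)]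
    · rw [V.proj_of_mem_ne hgh hy,
        V.proj_of_mem_ne (fun e => hgh (add_right_cancel e)) (hd _ _ hy), map_zero]
  | zero => simp
  | add y z hy hz => simp only [map_add, hy, hz]

theorem cohDeg_internal (V : GVec 𝕜 N) (d : V →ₗ[𝕜] V)
    (hd : ∀ g, ∀ x ∈ V.deg g, d x ∈ V.deg (g + 1)) : DirectSum.IsInternal (cohDeg V d) := by
  have hker : ∀ g, ∀ x ∈ LinearMap.ker d, V.proj g x ∈ LinearMap.ker d := fun g x hx => by
    rw [LinearMap.mem_ker, V.d_proj hd, LinearMap.mem_ker.1 hx, map_zero]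
  have hran : ∀ g, (LinearMap.range d).submoduleOf (LinearMap.ker d) ≤
      ((LinearMap.range d).submoduleOf (LinearMap.ker d)).comap
        ((V.proj g).restrict (hker g)) := by
    rintro g ⟨x, hx⟩ ⟨y, rfl⟩
    refine ⟨V.proj (g - 1) y, ?_⟩
    rw [V.d_proj hd, sub_add_cancel]; rfl
  refine internal_of_diag _ (fun g => Submodule.mapQ _ _ _ (hran g)) ?_ ?_ ?_
  · rintro g _ ⟨x, hx, rfl⟩
    rw [Submodule.mkQ_apply, Submodule.mapQ_apply]
    congr 1
    exact Subtype.ext (V.proj_of_mem hx)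
  · rintro g h hgh _ ⟨x, hx, rfl⟩
    rw [Submodule.mkQ_apply, Submodule.mapQ_apply]
    have : (V.proj g).restrict (hker g) x = 0 := Subtype.ext (V.proj_of_mem_ne hgh hx)
    rw [this]; simp
  · intro q
    obtain ⟨x, rfl⟩ := Submodule.mkQ_surjective _ q
    have := V.mem_of_proj_mem
      (((⨆ g, cohDeg V d g).comap (Submodule.mkQ _)).map (LinearMap.ker d).subtype) x.1 fun g => ?_
    · obtain ⟨y, hy, hyx⟩ := this
      rwa [Subtype.ext hyx] at hy
    · refine ⟨⟨V.proj g x.1, hker g _ x.2⟩, ?_, rfl⟩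
      refine Submodule.mem_iSup_of_mem g (Submodule.mem_map_of_mem ?_)
      exact V.proj_mem g x.1

end Cohomology

section AInfCohomology

variable {𝕜 : Type u} [Field 𝕜] {N : ℕ}

/-- The differential `a ↦ μ (a)`. -/
abbrev AInfAlg.diff (A : AInfAlg 𝕜 N) : A →ₗ[𝕜] A := IsLinearMap.mk' _ (A.mu_multilin.head [])

/-- The algebra as a right module over itself. -/
def AInfAlg.self (A : AInfAlg 𝕜 N) : AInfMod A where
  toGVec := A.toGVec
  mu l := IsLinearMap.mk' _ (A.mu_multilin.head l)
  mu_multilin x y :=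
    ⟨fun a b => LinearMap.ext fun c => (A.mu_multilin (c :: x) y).map_add a b,
      fun r a => LinearMap.ext fun c => (A.mu_multilin (c :: x) y).map_smul r a⟩
  mu_deg l r hl g m hm := by
    have := A.mu_deg _ _ (RDeg.cons hm hl)
    rw [show g + r + 1 = g - 1 + r + 2 by ring]
    exact this
  rel l m := by
    have h := A.rel (m :: l)
    have h0 : A.mu (0 :: m :: l) = 0 := (IsLinearMap.mk' _ (A.mu_multilin.head (m :: l))).map_zero
    rw [insertSum_cons, splitSum_cons, A.mu_nil, h0, zero_add] at h
    rw [← h]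
    congr 1
    exact (insertSum_map A.τ A.mu (LinearMap.applyₗ (R := 𝕜) (A.τ m)).toAddMonoidHom
      (fun l => IsLinearMap.mk' _ (A.mu_multilin.head l)) l).symm
  mul_one m hm := A.mul_one m hm

namespace AInfMod

variable {A : AInfAlg 𝕜 N} (M : AInfMod A)

/-- The underlying cochain complex has differential `m ↦ μ (m)`. -/
abbrev diff : M →ₗ[𝕜] M := M.mu []

theorem mu_zero (x y : List A) : M.mu (x ++ 0 :: y) = 0 :=
  (IsLinearMap.mk' _ (M.mu_multilin x y)).map_zero

theorem mu_zero_cons (y : List A) : M.mu (0 :: y) = 0 := M.mu_zero [] y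

theorem mu_zero_one (a : A) : M.mu [a, 0] = 0 := M.mu_zero [a] []

theorem mu_zero_two (a b : A) : M.mu [a, 0, b] = 0 := M.mu_zero [a] [b]

theorem mu_zero_three (a b : A) : M.mu [a, b, 0] = 0 := M.mu_zero [a, b] []

theorem mu_neg_cons (a : A) (y : List A) : M.mu (-a :: y) = -M.mu (a :: y) :=
  (IsLinearMap.mk' _ (M.mu_multilin.head y)).map_neg a

theorem diff_mem (g : ZMod N) (x : M) (hx : x ∈ M.deg g) : M.diff x ∈ M.deg (g + 1) := by
  simpa using M.mu_deg [] 0 RDeg.nil g x hx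

/-- The cohomology of an `A∞`-module, as a graded vector space. -/
abbrev H : GVec 𝕜 N where
  carrier := CohOf M.diff
  deg := cohDeg M.toGVec M.diff
  internal := cohDeg_internal M.toGVec M.diff M.diff_mem

theorem rel_one (a : A) (m : M) :
    M.mu [] (M.mu [a] m) + M.mu [a] (M.mu [] m) + M.mu [A.mu [a]] (M.τ m) = 0 := by
  have := M.rel [a] m
  simp only [insertSum_cons, insertSum_nil, splitSum_cons, splitSum_nil, A.mu_nil, mu_zero_cons]
    at this
  rw [← this]
  simp [mu_zero_one]
  abel

theorem rel_two (a b : A) (m : M) :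
    M.mu [] (M.mu [a, b] m) + M.mu [b] (M.mu [a] m) + M.mu [a, b] (M.mu [] m)
      + M.mu [A.mu [a, b]] (M.τ m) + M.mu [A.mu [a], b] (M.τ m)
      + M.mu [A.τ a, A.mu [b]] (M.τ m) = 0 := by
  have := M.rel [a, b] m
  simp only [insertSum_cons, insertSum_nil, splitSum_cons, splitSum_nil, A.mu_nil, mu_zero_cons]
    at this
  rw [← this]
  simp [mu_zero_two, mu_zero_three]
  abel

variable [Fact (Even N)]

theorem σ_mu (l : List A) (m : M) : M.σ (M.mu l m) = M.mu (l.map A.τ) (M.τ m) := by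
  have := LinearMap.congr_fun (homDeg_τ (mu_mem_homDeg M) l) m
  simp only [LinearMap.comp_apply, LinearMap.smul_apply, sgn_one] at this
  rw [this]
  simp [GVec.τ]

theorem diff_σ (m : M) : M.mu [] (M.σ m) = -M.σ (M.mu [] m) := by
  rw [M.σ_mu]
  simp [GVec.τ]

/-- The action of cocycles on cocycles: `(m, a) ↦ (-1)^{|m|} μ (m; a)`. -/
noncomputable def actZ :
    LinearMap.ker M.diff →ₗ[𝕜] LinearMap.ker A.diff →ₗ[𝕜] LinearMap.ker M.diff :=
  LinearMap.mk₂ 𝕜 (fun m a => ⟨M.mu [a.1] (M.σ m.1), by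
      have h := M.rel_one a.1 (M.σ m.1)
      have ha : A.mu [a.1] = 0 := a.2
      have hm : M.mu [] m.1 = 0 := m.2
      rw [M.diff_σ, hm, ha, mu_zero_cons] at h
      simpa using h⟩)
    (fun _ _ _ => Subtype.ext (by simp)) (fun _ _ _ => Subtype.ext (by simp))
    (fun m a b => Subtype.ext
      (LinearMap.congr_fun ((M.mu_multilin.head []).map_add a.1 b.1) (M.σ m.1)))
    (fun c m a => Subtype.ext
      (LinearMap.congr_fun ((M.mu_multilin.head []).map_smul c a.1) (M.σ m.1)))

end AInfMod

/-- The underlying vector space of the cohomology algebra. -/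
def AInfAlg.H (A : AInfAlg 𝕜 N) : Type u := CohOf A.diff

instance (A : AInfAlg 𝕜 N) : AddCommGroup A.H := inferInstanceAs (AddCommGroup (CohOf A.diff))

instance (A : AInfAlg 𝕜 N) : Module 𝕜 A.H := inferInstanceAs (Module 𝕜 (CohOf A.diff))

/-- The grading of the cohomology algebra. -/
def AInfAlg.degH (A : AInfAlg 𝕜 N) : ZMod N → Submodule 𝕜 A.H := cohDeg A.toGVec A.diff

namespace AInfMod

variable {A : AInfAlg 𝕜 N} (M : AInfMod A)

/-- The cohomology class of a cocycle in a module. -/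
abbrev cls : LinearMap.ker M.diff →ₗ[𝕜] M.H := Submodule.mkQ _

/-- The cohomology class of a cocycle in the algebra. -/
abbrev _root_.AInf.AInfAlg.cls (A : AInfAlg 𝕜 N) : LinearMap.ker A.diff →ₗ[𝕜] A.H :=
  Submodule.mkQ _

theorem _root_.AInf.AInfAlg.cls_surjective (A : AInfAlg 𝕜 N) : Function.Surjective A.cls :=
  Submodule.mkQ_surjective _

theorem cls_eq {x y : LinearMap.ker M.diff} (z : M) (h : x.1 = y.1 + M.mu [] z) :
    M.cls x = M.cls y := by
  rw [← sub_eq_zero, ← map_sub, Submodule.mkQ_apply, Submodule.Quotient.mk_eq_zero]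
  exact ⟨z, by simp [h]⟩

variable [Fact (Even N)]

/-- The action of cohomology classes: `[m] [a] = (-1)^{|m|} [μ (m; a)]`. -/
noncomputable def act : M.H →ₗ[𝕜] A.H →ₗ[𝕜] M.H :=
  Submodule.liftQ _
    ({ toFun := fun m => Submodule.liftQ _ (M.cls ∘ₗ M.actZ m) (by
          rintro ⟨_, ha'⟩ ⟨a, rfl⟩
          rw [LinearMap.mem_ker, LinearMap.comp_apply, Submodule.mkQ_apply,
            Submodule.Quotient.mk_eq_zero]
          have h := M.rel_one a (M.τ (M.σ m.1))
          have hm : M.mu [] m.1 = 0 := m.2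
          have h2 : M.mu [] (M.τ (M.σ m.1)) = 0 := by simp [GVec.τ, GVec.σ_σ, hm]
          rw [h2, map_zero, add_zero, M.τ_τ] at h
          refine ⟨-M.mu [a] (M.τ (M.σ m.1)), ?_⟩
          rw [map_neg]
          exact neg_eq_of_add_eq_zero_right h)
       map_add' := fun m m' => by
          refine Submodule.linearMap_qext _ (LinearMap.ext fun a => ?_)
          change M.cls (M.actZ (m + m') a) = M.cls (M.actZ m a) + M.cls (M.actZ m' a)
          rw [map_add, LinearMap.add_apply, map_add]
       map_smul' := fun c m => by
          refine Submodule.linearMap_qext _ (LinearMap.ext fun a => ?_)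
          change M.cls (M.actZ (c • m) a) = c • M.cls (M.actZ m a)
          rw [map_smul, LinearMap.smul_apply, map_smul] } : LinearMap.ker M.diff →ₗ[𝕜] A.H →ₗ[𝕜] M.H)
    (by
      rintro ⟨_, hm'⟩ ⟨m, rfl⟩
      rw [LinearMap.mem_ker]
      refine Submodule.linearMap_qext _ (LinearMap.ext fun a => ?_)
      change M.cls (M.actZ _ a) = 0
      rw [Submodule.mkQ_apply, Submodule.Quotient.mk_eq_zero]
      have ha : A.mu [a.1] = 0 := a.2
      have h := M.rel_one a.1 (M.σ m)
      rw [ha, mu_zero_cons, M.diff_σ, map_neg] at h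
      refine ⟨M.mu [a.1] (M.σ m), ?_⟩
      change M.mu [] (M.mu [a.1] (M.σ m)) = M.mu [a.1] (M.σ (M.mu [] m))
      rw [LinearMap.zero_apply, add_zero] at h
      exact add_neg_eq_zero.1 h)

theorem act_cls (m : LinearMap.ker M.diff) (a : LinearMap.ker A.diff) :
    M.act (M.cls m) (A.cls a) = M.cls (M.actZ m a) := rfl

end AInfMod

theorem AInfAlg.mu_σ (A : AInfAlg 𝕜 N) [Fact (Even N)] (a : LinearMap.ker A.diff) :
    A.mu [A.σ a.1] = 0 := by
  have h := A.self.diff_σ a.1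
  have h2 : A.self.mu [] a.1 = 0 := a.2
  rw [h2, map_zero, neg_zero] at h
  exact h

/-- The product of cocycles. -/
noncomputable def AInfAlg.mulZ (A : AInfAlg 𝕜 N) [Fact (Even N)] :
    LinearMap.ker A.diff →ₗ[𝕜] LinearMap.ker A.diff →ₗ[𝕜] LinearMap.ker A.diff :=
  A.self.actZ

/-- The product on cohomology: `[a] [b] = (-1)^{|a|} [μ (a, b)]`. -/
noncomputable def AInfAlg.mulH (A : AInfAlg 𝕜 N) [Fact (Even N)] : A.H →ₗ[𝕜] A.H →ₗ[𝕜] A.H :=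
  A.self.act

/-- The class of the cohomological unit. -/
noncomputable def AInfAlg.oneH (A : AInfAlg 𝕜 N) : A.H := A.cls ⟨A.one, A.mu_one⟩

namespace AInfMod

variable {A : AInfAlg 𝕜 N} (M : AInfMod A) [Fact (Even N)]

theorem act_assoc (m : M.H) (a b : A.H) : M.act (M.act m a) b = M.act m (A.mulH a b) := by
  obtain ⟨m, rfl⟩ := Submodule.mkQ_surjective _ m
  obtain ⟨a, rfl⟩ := A.cls_surjective a
  obtain ⟨b, rfl⟩ := A.cls_surjective b
  have e : A.mulH (A.cls a) (A.cls b) = A.cls (A.mulZ a b) := rfl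
  rw [e, act_cls, act_cls, act_cls]
  have hm : M.mu [] m.1 = 0 := m.2
  have hb : A.mu [b.1] = 0 := b.2
  have h := M.rel_two (A.σ a.1) b.1 m.1
  rw [hm, A.mu_σ a, hb, mu_zero_cons, mu_zero_one] at h
  simp only [map_zero, LinearMap.zero_apply, add_zero] at h
  refine M.cls_eq (-M.mu [A.σ a.1, b.1] m.1) ?_
  change M.mu [b.1] (M.σ (M.mu [a.1] (M.σ m.1)))
    = M.mu [A.mu [A.σ a.1, b.1]] (M.σ m.1) + M.mu [] (-M.mu [A.σ a.1, b.1] m.1)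
  have h1 : M.σ (M.mu [a.1] (M.σ m.1)) = M.mu [A.σ a.1] m.1 := by
    rw [M.σ_mu]
    simp only [List.map_cons, List.map_nil, GVec.τ, LinearMap.neg_apply, mu_neg_cons, map_neg,
      neg_neg, GVec.σ_σ]
  have h2 : M.τ m.1 = -M.σ m.1 := rfl
  rw [h1, map_neg]
  rw [h2, map_neg] at h
  rw [← sub_eq_zero, ← h]
  abel

theorem act_mem {g h : ZMod N} {m : M.H} {a : A.H} (hm : m ∈ M.H.deg g) (ha : a ∈ A.degH h) :
    M.act m a ∈ M.H.deg (g + h) := by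
  obtain ⟨m, hm, rfl⟩ := hm
  obtain ⟨a, ha, rfl⟩ := ha
  refine ⟨M.actZ m a, ?_, rfl⟩
  change M.mu [a.1] (M.σ m.1) ∈ M.deg (g + h)
  have hm' : M.σ m.1 ∈ M.deg g := by
    rw [M.σ_of_mem (show m.1 ∈ M.deg g from hm)]
    exact Submodule.smul_mem _ _ hm
  have := M.mu_deg [a.1] _ (RDeg.singleton ha) g _ hm'
  rwa [show g + h = g + (h - 1) + 1 by ring]

theorem act_one (m : M.H) : M.act m A.oneH = m := by
  obtain ⟨m, rfl⟩ := Submodule.mkQ_surjective _ m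
  rw [AInfAlg.oneH, act_cls]
  obtain ⟨n, hn⟩ := M.mul_one m.1 m.2
  exact M.cls_eq n hn

theorem one_act (a : A.H) : A.mulH A.oneH a = a := by
  obtain ⟨a, rfl⟩ := A.cls_surjective a
  obtain ⟨b, hb⟩ := A.one_mul a.1 a.2
  refine A.self.cls_eq (x := A.self.actZ ⟨A.one, A.mu_one⟩ a) b ?_
  change A.mu [A.σ A.one, a.1] = (a.1 : A) + A.mu [b]
  rw [A.σ_of_mem A.one_deg, sgn_zero, one_smul, hb]

end AInfMod

variable [Fact (Even N)]

/-- The cohomology algebra, with product `[a] [b] = (-1)^{|a|} [μ (a, b)]`. -/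
noncomputable instance (A : AInfAlg 𝕜 N) : Ring A.H :=
  { (inferInstance : AddCommGroup A.H) with
    mul := fun a b => A.mulH a b
    one := A.oneH
    mul_assoc := fun a b c => A.self.act_assoc a b c
    one_mul := fun a => AInfMod.one_act a
    mul_one := fun a => A.self.act_one a
    left_distrib := fun a b c => (A.mulH a).map_add b c
    right_distrib := fun a b c => by
      change A.mulH (a + b) c = A.mulH a c + A.mulH b c
      rw [map_add, LinearMap.add_apply]
    zero_mul := fun a => by
      change A.mulH 0 a = 0
      rw [map_zero, LinearMap.zero_apply]
    mul_zero := fun a => (A.mulH a).map_zero }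

noncomputable instance (A : AInfAlg 𝕜 N) : Algebra 𝕜 A.H :=
  Algebra.ofModule (fun c a b => by
      change A.mulH (c • a) b = c • A.mulH a b
      rw [map_smul, LinearMap.smul_apply])
    (fun c a b => (A.mulH a).map_smul c b)

instance (A : AInfAlg 𝕜 N) : SetLike.GradedMonoid A.degH where
  one_mem := ⟨⟨A.one, A.mu_one⟩, A.one_deg, rfl⟩
  mul_mem {_ _ _ _} ha hb := A.self.act_mem ha hb

noncomputable instance (A : AInfAlg 𝕜 N) : GradedAlgebra A.degH :=
  { (inferInstance : SetLike.GradedMonoid A.degH),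
    DirectSum.IsInternal.chooseDecomposition A.degH
      (cohDeg_internal A.toGVec A.diff A.self.diff_mem) with }

/-- The cohomology of an `A∞`-module, as a graded right module over the cohomology algebra. -/
noncomputable def AInfMod.toGMod {A : AInfAlg 𝕜 N} (M : AInfMod A) : GMod A.degH :=
  letI : Module A.Hᵐᵒᵖ M.H :=
    { smul := fun a m => M.act m a.unop
      one_smul := fun m => M.act_one m
      mul_smul := fun a b m => (M.act_assoc m b.unop a.unop).symm
      smul_zero := fun a => by
        change M.act 0 a.unop = 0
        rw [map_zero, LinearMap.zero_apply]
      smul_add := fun a m n => by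
        change M.act (m + n) a.unop = M.act m a.unop + M.act n a.unop
        rw [map_add, LinearMap.add_apply]
      add_smul := fun a b m => (M.act m).map_add a.unop b.unop
      zero_smul := fun m => (M.act m).map_zero }
  { toGVec := M.H
    isScalarTower := ⟨fun c a m => (M.act m).map_smul c a.unop⟩
    smul_mem := fun _ _ _ _ ha hm => M.act_mem hm ha }

end AInfCohomology

theorem closed_diff {𝕜 : Type u} [Field 𝕜] {N : ℕ} [Fact (Even N)] {A : AInfAlg 𝕜 N}
    {M P : AInfMod A} {k : ZMod N} {t : PreHom M P} (ht : t ∈ homDeg M P k)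
    (h : preD M P k t = 0) (m : M) : P.diff (t [] m) = sgn 𝕜 k • t [] (M.diff m) := by
  have h := LinearMap.congr_fun (congrFun h []) m
  have h0 : t [0] = 0 := (IsLinearMap.mk' _ (ht.1.head [])).map_zero
  simp only [preD_apply, Pi.sub_apply, Pi.smul_apply, Pi.add_apply, preComp_apply, preIns_apply,
    splitSum_nil, insertSum_nil, A.mu_nil, h0, LinearMap.zero_comp, add_zero] at h
  exact sub_eq_zero.1 h

/-- The map induced on cohomology by a closed pre-module homomorphism, `[m] ↦ [t (m)]`. -/
noncomputable def cohMap {𝕜 : Type u} [Field 𝕜] {N : ℕ} [Fact (Even N)] {A : AInfAlg 𝕜 N}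
    {M P : AInfMod A} {k : ZMod N} (t : PreHom M P) (ht : t ∈ homDeg M P k)
    (h : preD M P k t = 0) : M.H →ₗ[𝕜] P.H :=
  Submodule.mapQ _ _ ((t []).restrict fun m hm => by
      rw [LinearMap.mem_ker, closed_diff ht h, LinearMap.mem_ker.1 hm, map_zero, smul_zero])
    (by
      rintro ⟨_, hm⟩ ⟨m, rfl⟩
      refine ⟨sgn 𝕜 k • t [] m, ?_⟩
      rw [map_smul, closed_diff ht h, smul_smul, sgn_mul_self, one_smul]
      rfl)

section Resolutions

variable {𝕜 : Type u} [Field 𝕜] {N : ℕ} {A : Type u} [Ring A] [Algebra 𝕜 A]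

/-- A resolution of the graded right module `M` by graded projective modules, with differentials
preserving the degree. -/
structure ProjRes {𝒜 : ZMod N → Submodule 𝕜 A} (M : GMod 𝒜) where
  X : ℕ → GMod 𝒜
  projective : ∀ p, Module.Projective Aᵐᵒᵖ (X p)
  d : ∀ p, X (p + 1) →ₗ[Aᵐᵒᵖ] X p
  d_mem : ∀ p g, ∀ x ∈ (X (p + 1)).deg g, d p x ∈ (X p).deg g
  ε : X 0 →ₗ[Aᵐᵒᵖ] M
  ε_mem : ∀ g, ∀ x ∈ (X 0).deg g, ε x ∈ M.deg g
  ε_surjective : Function.Surjective ε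
  exact_zero : Function.Exact (d 0) ε
  exact_succ : ∀ p, Function.Exact (d (p + 1)) (d p)

/-- The kernel of a degree-preserving homomorphism, as a graded module. -/
def GMod.ker {𝒜 : ZMod N → Submodule 𝕜 A} {M P : GMod 𝒜} (f : M →ₗ[Aᵐᵒᵖ] P)
    (hf : ∀ g, ∀ x ∈ M.deg g, f x ∈ P.deg g) : GMod 𝒜 where
  carrier := LinearMap.ker f
  deg g := (M.deg g).comap ((LinearMap.ker f).subtype.restrictScalars 𝕜)
  internal := by
    have hcomm : ∀ g x, f (M.proj g x) = P.proj g (f x) := fun g x => by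
      induction x using internal_induction M.internal with
      | hom h y hy =>
        by_cases hgh : g = h
        · subst hgh; rw [M.proj_of_mem hy, P.proj_of_mem (hf _ _ hy)]
        · rw [M.proj_of_mem_ne hgh hy, P.proj_of_mem_ne hgh (hf _ _ hy), map_zero]
      | zero => simp
      | add y z hy hz => simp only [map_add, hy, hz]
    have hker : ∀ g, ∀ x ∈ (LinearMap.ker f).restrictScalars 𝕜,
        M.proj g x ∈ (LinearMap.ker f).restrictScalars 𝕜 := fun g x hx => by
      change f (M.proj g x) = 0
      rw [hcomm, show f x = 0 from hx, map_zero]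
    refine internal_of_diag _ (fun g => (M.proj g).restrict (hker g)) ?_ ?_ ?_
    · exact fun g x hx => Subtype.ext (M.proj_of_mem hx)
    · exact fun g h hgh x hx => Subtype.ext (M.proj_of_mem_ne hgh hx)
    · intro x
      obtain ⟨y, hy, hyx⟩ := M.mem_of_proj_mem ((⨆ g, (M.deg g).comap
        ((LinearMap.ker f).subtype.restrictScalars 𝕜)).map
          ((LinearMap.ker f).subtype.restrictScalars 𝕜)) x.1 fun g =>
            ⟨⟨M.proj g x.1, hker g _ x.2⟩, Submodule.mem_iSup_of_mem g (M.proj_mem g x.1), rfl⟩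
      rwa [← Subtype.ext hyx]
  smul_mem g h a m ha hm := M.smul_mem g h a m.1 ha hm

variable (𝒜 : ZMod N → Submodule 𝕜 A) [GradedAlgebra 𝒜]

/-- The algebra, as a graded vector space. -/
def algGVec : GVec 𝕜 N where
  carrier := A
  deg := 𝒜
  internal := DirectSum.Decomposition.isInternal 𝒜

/-- The projection of the algebra to its part of degree `g`. -/
noncomputable def algProj (g : ZMod N) : A →ₗ[𝕜] A := (algGVec 𝒜).proj g

variable {𝒜}

/-- The elements of degree `h` of the free module on the homogeneous elements of `M`. -/
def freeDeg (M : GMod 𝒜) (h : ZMod N) : Submodule 𝕜 ((Σ g, M.deg g) →₀ Aᵐᵒᵖ) where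
  carrier := {f | ∀ i, (f i).unop ∈ 𝒜 (h - i.1)}
  add_mem' := fun hf hf' i => add_mem (hf i) (hf' i)
  zero_mem' := fun _ => zero_mem _
  smul_mem' := fun c _ hf i => Submodule.smul_mem _ c (hf i)

theorem freeDeg_internal (M : GMod 𝒜) : DirectSum.IsInternal (freeDeg M) := by
  classical
  let op : A ≃ₗ[𝕜] Aᵐᵒᵖ := MulOpposite.opLinearEquiv 𝕜
  let π : ZMod N → ((Σ g, M.deg g) →₀ Aᵐᵒᵖ) →ₗ[𝕜] ((Σ g, M.deg g) →₀ Aᵐᵒᵖ) := fun h =>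
    Finsupp.lsum 𝕜 fun i => Finsupp.lsingle i ∘ₗ op.toLinearMap ∘ₗ algProj 𝒜 (h - i.1) ∘ₗ
      op.symm.toLinearMap
  have hπ : ∀ h f i, π h f i = op (algProj 𝒜 (h - i.1) (op.symm (f i))) := by
    intro h f i
    induction f using Finsupp.induction_linear with
    | zero => simp
    | add f g hf hg => simp only [map_add, Finsupp.add_apply, hf, hg]
    | single j a =>
      have : π h (Finsupp.single j a)
          = Finsupp.single j (op (algProj 𝒜 (h - j.1) (op.symm a))) := by
        simp only [π, Finsupp.lsum_single]; rfl
      rw [this]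
      by_cases hij : j = i
      · subst hij; simp
      · rw [Finsupp.single_eq_of_ne (Ne.symm hij), Finsupp.single_eq_of_ne (Ne.symm hij)]
        simp
  refine internal_of_diag _ π ?_ ?_ ?_
  · intro h f hf
    ext i : 1
    rw [hπ, show algProj 𝒜 (h - i.1) (op.symm (f i)) = op.symm (f i) from
      (algGVec 𝒜).proj_of_mem (hf i), LinearEquiv.apply_symm_apply]
  · intro g h hgh f hf
    ext i : 1
    rw [hπ, show algProj 𝒜 (g - i.1) (op.symm (f i)) = 0 from
      (algGVec 𝒜).proj_of_mem_ne (fun e => hgh (sub_left_injective e)) (hf i), map_zero]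
    rfl
  · intro f
    induction f using Finsupp.induction_linear with
    | zero => exact zero_mem _
    | add f g hf hg => exact add_mem hf hg
    | single i a =>
      refine (algGVec 𝒜).mem_of_proj_mem
        (Submodule.comap (Finsupp.lsingle i ∘ₗ op.toLinearMap) (⨆ h, freeDeg M h)) a.unop
        fun g => ?_
      refine Submodule.mem_iSup_of_mem (g + i.1) fun j => ?_
      change ((Finsupp.single i (op (algProj 𝒜 g a.unop))) j).unop ∈ _
      by_cases hij : i = j
      · subst hij
        rw [Finsupp.single_eq_same, add_sub_cancel_right]
        exact (algGVec 𝒜).proj_mem g a.unop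
      · rw [Finsupp.single_eq_of_ne (Ne.symm hij)]
        exact zero_mem _

/-- The free graded right module with one generator for each homogeneous element of `M`. -/
noncomputable def freeCover (M : GMod 𝒜) : GMod 𝒜 where
  carrier := (Σ g, M.deg g) →₀ Aᵐᵒᵖ
  deg := freeDeg M
  internal := freeDeg_internal M
  smul_mem g h a f ha hf i := by
    have := SetLike.GradedMul.mul_mem (hf i) ha
    rw [show g + h - i.1 = g - i.1 + h by ring]
    exact this

/-- The augmentation `freeCover M → M`. -/
noncomputable def coverMap (M : GMod 𝒜) : freeCover M →ₗ[Aᵐᵒᵖ] M :=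
  Finsupp.linearCombination Aᵐᵒᵖ fun i : Σ g, M.deg g => (i.2 : M)

theorem coverMap_mem (M : GMod 𝒜) (g : ZMod N) (x : freeCover M) (hx : x ∈ (freeCover M).deg g) :
    coverMap M x ∈ M.deg g := by
  suffices ∀ x ∈ freeDeg M g,
      Finsupp.linearCombination Aᵐᵒᵖ (fun i : Σ g, M.deg g => (i.2 : M)) x ∈ M.deg g from
    this x hx
  intro x hx
  rw [Finsupp.linearCombination_apply, Finsupp.sum]
  refine Submodule.sum_mem _ fun i _ => ?_
  have := M.smul_mem i.1 (g - i.1) (x i).unop i.2 (hx i) i.2.2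
  rwa [add_sub_cancel] at this

theorem coverMap_surjective (M : GMod 𝒜) : Function.Surjective (coverMap M) := by
  intro m
  refine internal_induction M.internal (p := fun m => ∃ x, coverMap M x = m) m ?_ ?_ ?_
  · intro g m hm
    refine ⟨Finsupp.single ⟨g, m, hm⟩ 1, ?_⟩
    exact (Finsupp.linearCombination_single Aᵐᵒᵖ (1 : Aᵐᵒᵖ) _).trans (one_smul _ _)
  · exact ⟨0, map_zero _⟩
  · rintro _ _ ⟨x, rfl⟩ ⟨y, rfl⟩
    exact ⟨x + y, map_add _ _ _⟩

/-- The iterated syzygies of `M`. -/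
noncomputable def syzygy (M : GMod 𝒜) : ℕ → GMod 𝒜
  | 0 => M
  | p + 1 => GMod.ker (coverMap (syzygy M p)) (coverMap_mem (syzygy M p))

/-- The inclusion of a syzygy. -/
noncomputable def syzygyIncl (M : GMod 𝒜) (p : ℕ) :
    syzygy M (p + 1) →ₗ[Aᵐᵒᵖ] freeCover (syzygy M p) :=
  (LinearMap.ker (coverMap (syzygy M p))).subtype

theorem syzygy_exact (M : GMod 𝒜) (p : ℕ) :
    Function.Exact (syzygyIncl M p ∘ₗ coverMap (syzygy M (p + 1))) (coverMap (syzygy M p)) := by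
  intro x
  constructor
  · intro hx
    obtain ⟨y, hy⟩ := coverMap_surjective (syzygy M (p + 1)) ⟨x, hx⟩
    exact ⟨y, by rw [LinearMap.comp_apply, hy]; rfl⟩
  · rintro ⟨y, rfl⟩
    exact (coverMap (syzygy M (p + 1)) y).2

/-- The canonical free resolution of a graded module. -/
noncomputable def stdRes (M : GMod 𝒜) : ProjRes M where
  X p := freeCover (syzygy M p)
  projective p := inferInstanceAs (Module.Projective Aᵐᵒᵖ ((Σ g, (syzygy M p).deg g) →₀ Aᵐᵒᵖ))
  d p := syzygyIncl M p ∘ₗ coverMap (syzygy M (p + 1))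
  d_mem p g x hx := coverMap_mem (syzygy M (p + 1)) g x hx
  ε := coverMap M
  ε_mem := coverMap_mem M
  ε_surjective := coverMap_surjective M
  exact_zero := syzygy_exact M 0
  exact_succ p x := by
    rw [← syzygy_exact M (p + 1) x]
    refine ⟨fun h => Subtype.ext h, fun h => ?_⟩
    rw [LinearMap.comp_apply, h, map_zero]

end Resolutions

section Total

variable {𝕜 : Type u} [Field 𝕜] {N : ℕ} {A : Type u} [Ring A] [Algebra 𝕜 A]
  {𝒜 : ZMod N → Submodule 𝕜 A}

namespace ProjRes

variable {M P : GMod 𝒜}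

/-- The total module `⨁ p, X p` of a resolution. -/
abbrev Tot (R : ProjRes M) : Type u := Π₀ p, R.X p

/-- The cohomological total degree: an element of `X p` of internal degree `h` has total degree
`h - p`. -/
def totDeg (R : ProjRes M) (g : ZMod N) : Submodule 𝕜 R.Tot where
  carrier := {x | ∀ p : ℕ, x p ∈ (R.X p).deg (g + p)}
  add_mem' hx hy p := add_mem (hx p) (hy p)
  zero_mem' _ := zero_mem _
  smul_mem' c _ hx p := Submodule.smul_mem _ c (hx p)

/-- The differential of the total module, given by `X (p + 1) → X p`. -/
def totD (R : ProjRes M) : R.Tot →ₗ[Aᵐᵒᵖ] R.Tot :=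
  DFinsupp.lsum ℕ fun p => match p with
    | 0 => 0
    | p + 1 => DFinsupp.lsingle p ∘ₗ R.d p

theorem totD_apply (R : ProjRes M) (x : R.Tot) (p : ℕ) : R.totD x p = R.d p (x (p + 1)) := by
  have key : DFinsupp.lapply p ∘ₗ R.totD = R.d p ∘ₗ DFinsupp.lapply (p + 1) := by
    refine DFinsupp.lhom_ext' fun q => LinearMap.ext fun y => ?_
    simp only [LinearMap.comp_apply, totD, DFinsupp.lsingle_apply, DFinsupp.lsum_single,
      DFinsupp.lapply_apply]
    cases q with
    | zero => simp
    | succ q =>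
      simp only [LinearMap.comp_apply, DFinsupp.lsingle_apply]
      by_cases h : q = p
      · subst h; simp
      · rw [DFinsupp.single_eq_of_ne (Ne.symm h),
          DFinsupp.single_eq_of_ne (fun e => h (Nat.succ_injective e).symm), map_zero]
  exact LinearMap.congr_fun key x

theorem totD_mem (R : ProjRes M) {g : ZMod N} {x : R.Tot} (hx : x ∈ R.totDeg g) :
    R.totD x ∈ R.totDeg (g + 1) := fun p => by
  rw [totD_apply]
  have := R.d_mem p _ _ (hx (p + 1))
  rwa [show g + ((p + 1 : ℕ) : ZMod N) = g + 1 + p by push_cast; ring] at this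

theorem totD_totD (R : ProjRes M) (x : R.Tot) : R.totD (R.totD x) = 0 := by
  ext p
  rw [totD_apply, totD_apply]
  exact (R.exact_succ p _).2 ⟨_, rfl⟩

/-- The `A`-linear maps of degree `k` between total modules. -/
def totHom (R : ProjRes M) (S : ProjRes P) (k : ZMod N) : Submodule 𝕜 (R.Tot →ₗ[Aᵐᵒᵖ] S.Tot) where
  carrier := {f | ∀ g, ∀ x ∈ R.totDeg g, f x ∈ S.totDeg (g + k)}
  add_mem' hf hf' g x hx := add_mem (hf g x hx) (hf' g x hx)
  zero_mem' _ _ _ := zero_mem _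
  smul_mem' c _ hf g x hx := Submodule.smul_mem _ c (hf g x hx)

/-- Composition of linear maps. -/
def totComp {L : GMod 𝒜} (R : ProjRes L) (S : ProjRes M) (T : ProjRes P) :
    (S.Tot →ₗ[Aᵐᵒᵖ] T.Tot) →ₗ[𝕜] (R.Tot →ₗ[Aᵐᵒᵖ] S.Tot) →ₗ[𝕜] (R.Tot →ₗ[Aᵐᵒᵖ] T.Tot) :=
  LinearMap.mk₂ 𝕜 (fun g f => g ∘ₗ f) (fun _ _ _ => rfl) (fun _ _ _ => rfl)
    (fun g f f' => LinearMap.comp_add f f' g)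
    (fun c g f => LinearMap.ext fun x => LinearMap.map_smul_of_tower g c (f x))

theorem totComp_apply {L : GMod 𝒜} {R : ProjRes L} {S : ProjRes M} {T : ProjRes P}
    (g : S.Tot →ₗ[Aᵐᵒᵖ] T.Tot) (f : R.Tot →ₗ[Aᵐᵒᵖ] S.Tot) : totComp R S T g f = g ∘ₗ f := rfl

/-- The differential `f ↦ d ∘ f - (-1)^k f ∘ d` on maps of degree `k`. -/
def totHomD (R : ProjRes M) (S : ProjRes P) (k : ZMod N) :
    (R.Tot →ₗ[Aᵐᵒᵖ] S.Tot) →ₗ[𝕜] (R.Tot →ₗ[Aᵐᵒᵖ] S.Tot) :=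
  totComp R S S S.totD - sgn 𝕜 k • (totComp R R S).flip R.totD

theorem totHomD_apply {R : ProjRes M} {S : ProjRes P} (k : ZMod N) (f : R.Tot →ₗ[Aᵐᵒᵖ] S.Tot) :
    totHomD R S k f = totComp R S S S.totD f - sgn 𝕜 k • totComp R R S f R.totD := rfl

end ProjRes

end Total

section Ext

variable {𝕜 : Type u} [Field 𝕜] {N : ℕ} [Fact (Even N)] {A : Type u} [Ring A] [Algebra 𝕜 A]

open ProjRes in
/-- The dg category of graded right modules, with the complexes `Hom_A (P_M, P_N)` of
homomorphisms between (total modules of) the canonical projective resolutions as morphisms. -/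
noncomputable def resDG (𝒜 : ZMod N → Submodule 𝕜 A) [GradedAlgebra 𝒜] :
    DGCat.{u, u + 1, u} 𝕜 N where
  Obj := GMod 𝒜
  Hom M P := (stdRes M).Tot →ₗ[Aᵐᵒᵖ] (stdRes P).Tot
  hom M P := totHom (stdRes M) (stdRes P)
  id M := LinearMap.id
  id_mem M g x hx := by simpa using hx
  comp := totComp _ _ _
  comp_mem {_ _ _ j k _ _} hg hf h x hx := by
    rw [show h + (j + k) = h + k + j by ring]
    exact hg _ _ (hf _ _ hx)
  id_comp f := LinearMap.id_comp f
  comp_id f := LinearMap.comp_id f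
  assoc f g h := LinearMap.comp_assoc h g f
  d k := totHomD _ _ k
  d_mem {_ _ k f} hf := sub_mem (fun g x hx => by
      rw [show g + (k + 1) = g + k + 1 by ring]
      exact totD_mem _ (hf _ _ hx))
    (Submodule.smul_mem _ _ fun g x hx => by
      rw [show g + (k + 1) = g + 1 + k by ring]
      exact hf _ _ (totD_mem _ hx))
  d_d {_ _ k f} _ := by
    refine LinearMap.ext fun x => ?_
    simp only [totHomD_apply, map_sub, map_smul, LinearMap.sub_apply, LinearMap.smul_apply,
      totComp_apply, LinearMap.comp_apply, totD_totD, map_zero, sgn_add, sgn_one, smul_zero]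
    simp
  d_comp {_ _ _ j k g f} _ _ := by
    have h := sgn_mul_self 𝕜 j
    simp only [totHomD_apply, map_sub, map_smul, LinearMap.sub_apply, LinearMap.smul_apply,
      totComp_apply, LinearMap.comp_assoc, sgn_add, smul_sub, smul_smul]
    abel

/-- The graded category `mod(A)` of graded right `A`-modules, whose morphisms of degree `k` from
`M` to `P` are `Ext^k_A (M, P)`, with the Yoneda product as composition. Here
`Ext^k_A (M, P) = H^k (Hom_A (P_M, P_P))` is the total `Ext`, in which the classes in homological
degree `p` have internal degree `k - p`. -/
noncomputable def modExt (𝒜 : ZMod N → Submodule 𝕜 A) [GradedAlgebra 𝒜] :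
    GrCat.{u, u + 1, u} 𝕜 N := (resDG 𝒜).cohomology

/-- The `A`-linear map `g : M → P` is the image of the class `φ` under the projection of
`Ext^k_A (M, P)` onto its part `Hom^k_A (M, P)` of homological degree `0`: each closed map `f`
between the resolutions that represents `φ` induces `g` on the augmentations. -/
def Induces {𝒜 : ZMod N → Submodule 𝕜 A} [GradedAlgebra 𝒜] {M P : GMod 𝒜} {k : ZMod N}
    (φ : (modExt 𝒜).Hom M P k) (g : M → P) : Prop :=
  ∀ f : (resDG 𝒜).Z M P k, (resDG 𝒜).cls f = φ → ∀ x : (stdRes M).X 0,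
    g ((stdRes M).ε x) =
      (stdRes P).ε ((show (stdRes M).Tot →ₗ[Aᵐᵒᵖ] (stdRes P).Tot from f.1) (DFinsupp.single 0 x) 0)

end Ext

/-- `N = 0`: gradings by `ℤ`. -/
instance : Fact (Even 0) := ⟨⟨0, rfl⟩⟩

/-- `N = 2`: gradings by `ℤ/2`. -/
instance : Fact (Even 2) := ⟨⟨1, rfl⟩⟩

end AInf

namespace AInf

/-! ### Homotopies and representatives for graded complexes over a field -/

section LinearAlgebra

variable {𝕜 : Type u} [Field 𝕜] {N : ℕ}

/-! Both sides are compared with a third dg category, `twistDG`. Its objects are complexes of vector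
spaces with an operator `U` of degree `δ = 1 - n` that anticommutes with the differential; its
morphisms are pairs of a linear map and a homotopy for its compatibility with `U`. This is all that
a module over the polynomial ring carries up to homotopy, because the polynomial ring in one
variable has a bimodule resolution of length one.

There are two strict dg functors to `twistDG`. The first, `twistFun`, sends an `A∞`-module to its
underlying complex, with `U` the action of a cocycle `e 1` representing the generator, and sends `t`
to `(t [], t [e 1])`. The second, `resFun`, sends a graded module to the total complex of its
canonical resolution, with `U` the action of the generator up to sign, and sends a linear map `f` to
`(f, 0)`. Both are fully faithful on cohomology.

For `twistFun`, which is surjective on morphisms, the point is that its kernels are acyclic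
(`exists_primitive`). Filter families of multilinear maps by the number of algebra entries. The
leading part of the differential only involves the differentials of the two modules and of the
algebra; over a field its cohomology consists of functions on monomials with values in linear maps
between the cohomologies (`exists_fD_eq`, `exists_gE_eq`). The next part acts on these functions as
the bar differential (`p_fFull`, `represents_gD`), and the bar complex of the polynomial ring is
exact from length two on (`exists_barD_eq`). In length one, a cocycle that vanishes on the generator
is zero. So primitives are built one length at a time, and the values on each list stabilise.

For `resFun`, the canonical resolution is free over the polynomial ring, so an equation `U w ± w U =
y` can be solved recursively along the orbits of the generators
(`TwistObj.Free.exists_commutator_eq`). Hence every homotopy component can be removed.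

On objects, choose representatives of the cohomology of a module `M`. Composed with the
augmentation, they give a closed morphism from the resolution of the cohomology of `M` to `M` that
is bijective on cohomology, and a Whitehead theorem (`exists_isInverse_of_quasiIso`) makes it
invertible. The functor `H` is `twistFun` lifted through `resFun` along these isomorphisms
(`GrFunctor.lift`). It is essentially surjective because every graded module carries an
`A∞`-structure with zero differential and the given action of the generator; the exactness of the
bar complex removes the obstructions (`exists_curv_operatorMu_eq_zero`). -/

theorem exists_generalized_inverse {E : Type v} {F : Type w} [AddCommGroup E] [Module 𝕜 E]
    [AddCommGroup F] [Module 𝕜 F] (f : E →ₗ[𝕜] F) : ∃ h : F →ₗ[𝕜] E, ∀ x, f (h (f x)) = f x := by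
  obtain ⟨r, hr⟩ := f.rangeRestrict.exists_rightInverse_of_surjective f.range_rangeRestrict
  -- `r` is a section of `f` over its range; how it is extended to all of `F` is immaterial.
  obtain ⟨h, hh⟩ := LinearMap.exists_extend r
  refine ⟨h, fun x => ?_⟩
  have e1 : h (f x) = r (f.rangeRestrict x) := LinearMap.congr_fun hh (f.rangeRestrict x)
  rw [e1]
  exact congrArg Subtype.val (LinearMap.congr_fun hr (f.rangeRestrict x))

namespace GVec

/-- Linear maps may be prescribed on each homogeneous summand. -/
theorem exists_glue (V : GVec 𝕜 N) {Y : Type v} [AddCommGroup Y] [Module 𝕜 Y]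
    (φ : ∀ g, V.deg g →ₗ[𝕜] Y) :
    ∃ f : V →ₗ[𝕜] Y, ∀ g x (hx : x ∈ V.deg g), f x = φ g ⟨x, hx⟩ := by
  classical
  refine ⟨DirectSum.toModule 𝕜 _ Y φ ∘ₗ (LinearEquiv.ofBijective (DirectSum.coeLinearMap V.deg)
    (show Function.Bijective (DirectSum.coeLinearMap V.deg) from V.internal)).symm.toLinearMap,
    fun g x hx => ?_⟩
  have : (LinearEquiv.ofBijective (DirectSum.coeLinearMap V.deg)
      (show Function.Bijective (DirectSum.coeLinearMap V.deg) from V.internal)).symm x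
      = DirectSum.lof 𝕜 _ (fun i => V.deg i) g ⟨x, hx⟩ := by
    rw [LinearEquiv.symm_apply_eq]
    simp
  simp only [LinearMap.comp_apply, LinearEquiv.coe_coe, this, DirectSum.toModule_lof]

theorem hom_ext (V : GVec 𝕜 N) {Y : Type v} [AddCommGroup Y] [Module 𝕜 Y] {f f' : V →ₗ[𝕜] Y}
    (h : ∀ g, ∀ x ∈ V.deg g, f x = f' x) : f = f' := by
  ext x
  induction x using internal_induction V.internal with
  | hom g y hy => exact h g y hy
  | zero => simp
  | add y z hy hz => rw [map_add, map_add, hy, hz]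

theorem eq_zero_of_mem_ne (V : GVec 𝕜 N) {g h : ZMod N} (hgh : g ≠ h) {x : V} (hx : x ∈ V.deg g)
    (hx' : x ∈ V.deg h) : x = 0 := by
  rw [← V.proj_of_mem hx, V.proj_of_mem_ne hgh hx']

/-- Generalized inverses of `d` in the separate degrees glue to a homogeneous operator. The relation
`d h d = d` alone is enough for `1 - d h`, `1 - h d` and `1 - d h - h d` to serve as projections
towards the cohomology. -/
theorem exists_partial_homotopy (V : GVec 𝕜 N) (d : V →ₗ[𝕜] V)
    (hd : ∀ g, ∀ x ∈ V.deg g, d x ∈ V.deg (g + 1)) :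
    ∃ h : V →ₗ[𝕜] V, (∀ g, ∀ x ∈ V.deg g, h x ∈ V.deg (g - 1)) ∧ ∀ x, d (h (d x)) = d x := by
  choose k hk using fun g : ZMod N => exists_generalized_inverse (d ∘ₗ (V.deg (g - 1)).subtype)
  obtain ⟨h, hh⟩ := V.exists_glue fun g => (V.deg (g - 1)).subtype ∘ₗ k g ∘ₗ (V.deg g).subtype
  refine ⟨h, fun g x hx => ?_, fun x => ?_⟩
  · rw [hh g x hx]
    exact (k g x).2
  · induction x using internal_induction V.internal with
    | hom g x hx =>
      rw [hh _ _ (hd g x hx)]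
      exact hk (g + 1) ⟨x, by rwa [add_sub_cancel_right]⟩
    | zero => simp
    | add y z hy hz => simp only [map_add, hy, hz]

/-- A chain map out of a graded complex over a field is null-homotopic if it maps cocycles to
coboundaries. The target is given by subspaces `Yd j` and differentials `D j`. -/
theorem exists_nullhomotopy (V : GVec 𝕜 N) (d : V →ₗ[𝕜] V)
    (hd : ∀ g, ∀ x ∈ V.deg g, d x ∈ V.deg (g + 1)) (hdd : ∀ x, d (d x) = 0) {Y : Type v}
    [AddCommGroup Y] [Module 𝕜 Y] (Yd : ZMod N → Submodule 𝕜 Y) (D : ZMod N → Y →ₗ[𝕜] Y)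
    (k : ZMod N) (ε : 𝕜) (hε : ε * ε = 1) (f : V →ₗ[𝕜] Y)
    (hf : ∀ g, ∀ x ∈ V.deg g, f x ∈ Yd (g + k))
    (hD : ∀ g, ∀ x ∈ V.deg g, D (g + k) (f x) = ε • f (d x))
    (hex : ∀ g, ∀ x ∈ V.deg g, d x = 0 → ∃ y ∈ Yd (g + (k - 1)), D (g + (k - 1)) y = f x) :
    ∃ s : V →ₗ[𝕜] Y, (∀ g, ∀ x ∈ V.deg g, s x ∈ Yd (g + (k - 1))) ∧
      ∀ g, ∀ x ∈ V.deg g, f x = D (g + (k - 1)) (s x) + ε • s (d x) := by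
  obtain ⟨h, hh, hdh⟩ := V.exists_partial_homotopy d hd
  -- `π` kills coboundaries and has values in cocycles. In `f = f π + f d h + f h d` the last two
  -- terms come from the homotopy `ε • f h`, and the first is exact value by value.
  let π : V →ₗ[𝕜] V := LinearMap.id - d ∘ₗ h - h ∘ₗ d
  have hπ : ∀ x, π x = x - d (h x) - h (d x) := fun x => rfl
  have hπd : ∀ x, π (d x) = 0 := fun x => by simp [hπ, hdh, hdd]
  have hdπ : ∀ x, d (π x) = 0 := fun x => by simp [hπ, hdh, hdd]
  have hπm : ∀ g, ∀ x ∈ V.deg g, π x ∈ V.deg g := fun g x hx => by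
    have e1 := hd _ _ (hh g x hx)
    have e2 := hh _ _ (hd g x hx)
    rw [sub_add_cancel] at e1
    rw [add_sub_cancel_right] at e2
    exact sub_mem (sub_mem hx e1) e2
  -- `r g` selects primitives linearly: on an element that has a primitive of the right degree it
  -- returns one.
  choose r hr using fun g : ZMod N =>
    exists_generalized_inverse (D (g + (k - 1)) ∘ₗ (Yd (g + (k - 1))).subtype)
  obtain ⟨s', hs'⟩ := V.exists_glue fun g =>
    (Yd (g + (k - 1))).subtype ∘ₗ r g ∘ₗ f ∘ₗ π ∘ₗ (V.deg g).subtype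
  refine ⟨ε • (f ∘ₗ h) + s', fun g x hx => ?_, fun g x hx => ?_⟩
  · refine add_mem (Submodule.smul_mem _ _ ?_) ?_
    · have := hf _ _ (hh g x hx)
      rwa [show g - 1 + k = g + (k - 1) by ring] at this
    · rw [hs' g x hx]
      exact (r g _).2
  · have e1 : D (g + (k - 1)) (f (h x)) = ε • f (d (h x)) := by
      have := hD _ _ (hh g x hx)
      rwa [show g - 1 + k = g + (k - 1) by ring] at this
    have e2 : s' (d x) = 0 := by
      rw [hs' _ _ (hd g x hx)]
      simp [hπd]
    have e3 : D (g + (k - 1)) (s' x) = f (π x) := by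
      rw [hs' g x hx]
      obtain ⟨y, hy, hyx⟩ := hex g (π x) (hπm g x hx) (hdπ x)
      have := hr g ⟨y, hy⟩
      simp only [LinearMap.comp_apply, Submodule.subtype_apply] at this ⊢
      rw [← hyx]
      exact this
    simp only [LinearMap.add_apply, LinearMap.smul_apply, LinearMap.comp_apply, map_add, map_smul,
      e1, e2, e3, smul_add, smul_smul, hε, one_smul, smul_zero, hπ, map_sub]
    abel

end GVec

/-- Representatives of the cohomology of a graded complex over a field. -/
theorem exists_cohomology_section (V : GVec 𝕜 N) (d : V →ₗ[𝕜] V)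
    (hd : ∀ g, ∀ x ∈ V.deg g, d x ∈ V.deg (g + 1)) (hdd : ∀ x, d (d x) = 0) :
    ∃ (i : CohOf d →ₗ[𝕜] V) (p : V →ₗ[𝕜] CohOf d),
      (∀ v, ∃ h : i v ∈ LinearMap.ker d, Submodule.Quotient.mk ⟨i v, h⟩ = v) ∧
      (∀ g, ∀ v ∈ cohDeg V d g, i v ∈ V.deg g) ∧
      (∀ g, ∀ x ∈ V.deg g, p x ∈ cohDeg V d g) ∧
      (∀ x : LinearMap.ker d, p x = Submodule.Quotient.mk x) ∧
      ∀ x, p (d x) = 0 := by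
  obtain ⟨h, hh, hdh⟩ := V.exists_partial_homotopy d hd
  have hdhm : ∀ g, ∀ x ∈ V.deg g, d (h x) ∈ V.deg g := fun g x hx => by
    have e1 := hd _ _ (hh g x hx)
    rwa [sub_add_cancel] at e1
  have hhdm : ∀ g, ∀ x ∈ V.deg g, h (d x) ∈ V.deg g := fun g x hx => by
    have e2 := hh _ _ (hd g x hx)
    rwa [add_sub_cancel_right] at e2
  -- On cocycles, `1 - d h` preserves the class and kills coboundaries, so it descends to a section.
  -- On all of `V`, `1 - h d` is a retraction onto the cocycles and gives the projection.
  let i : CohOf d →ₗ[𝕜] V := Submodule.liftQ _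
    ((LinearMap.id - d ∘ₗ h) ∘ₗ (LinearMap.ker d).subtype) (by
      rintro ⟨_, h'⟩ ⟨y, rfl⟩
      simp [hdh])
  let q : V →ₗ[𝕜] LinearMap.ker d := LinearMap.codRestrict (LinearMap.ker d)
    (LinearMap.id - h ∘ₗ d) (fun x => by simp [hdh])
  have hi : ∀ x : LinearMap.ker d, i (Submodule.Quotient.mk x) = x.1 - d (h x.1) := fun x => rfl
  refine ⟨i, Submodule.mkQ _ ∘ₗ q, fun v => ?_, ?_, ?_, fun x => ?_, fun x => ?_⟩
  · obtain ⟨x, rfl⟩ := Submodule.mkQ_surjective _ v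
    rw [Submodule.mkQ_apply, hi]
    refine ⟨by simp [hdd, LinearMap.mem_ker.1 x.2], ?_⟩
    rw [← sub_eq_zero, ← Submodule.Quotient.mk_sub, Submodule.Quotient.mk_eq_zero]
    exact ⟨-h x.1, by simp⟩
  · rintro g _ ⟨x, hx, rfl⟩
    rw [Submodule.mkQ_apply, hi]
    exact sub_mem hx (hdhm g _ hx)
  · intro g x hx
    exact ⟨q x, sub_mem hx (hhdm g _ hx), rfl⟩
  · rw [LinearMap.comp_apply, Submodule.mkQ_apply]
    congr 1
    refine Subtype.ext ?_
    change x.1 - h (d x.1) = x.1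
    rw [LinearMap.mem_ker.1 x.2, map_zero, sub_zero]
  · rw [LinearMap.comp_apply, Submodule.mkQ_apply]
    have : q (d x) = ⟨d x, hdd x⟩ := by
      refine Subtype.ext ?_
      change d x - h (d (d x)) = d x
      rw [hdd, map_zero, sub_zero]
    rw [this, Submodule.Quotient.mk_eq_zero]
    exact ⟨x, rfl⟩

end LinearAlgebra

end AInf

namespace AInf

/-! ### Families of operations that need not satisfy the `A∞`-relations -/

section GradedOperations

variable {𝕜 : Type u} [Field 𝕜] {N : ℕ} (A : AInfAlg 𝕜 N)

/-- The homogeneous families of multilinear maps `M × A × ⋯ × A → P` of degree `k`. -/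
def gDeg (M P : GVec 𝕜 N) (k : ZMod N) : Submodule 𝕜 (List A → M →ₗ[𝕜] P) where
  carrier := {t | IsMultilin 𝕜 t ∧
    ∀ l r, RDeg A.toGVec l r → ∀ g, ∀ m ∈ M.deg g, t l m ∈ P.deg (g + r + k)}
  add_mem' := fun {_ _} hs ht => ⟨hs.1.add ht.1, fun l r hl g m hm =>
    add_mem (hs.2 l r hl g m hm) (ht.2 l r hl g m hm)⟩
  zero_mem' := ⟨isMultilin_zero, fun _ _ _ _ _ _ => zero_mem _⟩
  smul_mem' := fun c _ ht => ⟨ht.1.smul c, fun l r hl g m hm =>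
    Submodule.smul_mem _ c (ht.2 l r hl g m hm)⟩

/-- Composition of families of multilinear maps. -/
def gComp (M P Q : GVec 𝕜 N) : (List A → P →ₗ[𝕜] Q) →ₗ[𝕜] (List A → M →ₗ[𝕜] P) →ₗ[𝕜]
    (List A → M →ₗ[𝕜] Q) :=
  LinearMap.mk₂ 𝕜 (fun t s l => splitSum (fun x y => t y ∘ₗ s x) l)
    (fun t t' s => by funext l; simp only [Pi.add_apply, LinearMap.add_comp, splitSum_add])
    (fun c t s => by funext l; simp only [Pi.smul_apply, LinearMap.smul_comp, splitSum_smul])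
    (fun t s s' => by funext l; simp only [Pi.add_apply, LinearMap.comp_add, splitSum_add])
    (fun c t s => by funext l; simp only [Pi.smul_apply, LinearMap.comp_smul, splitSum_smul])

/-- Insertion of the operations of `A`. -/
noncomputable def gIns (M P : GVec 𝕜 N) : (List A → M →ₗ[𝕜] P) →ₗ[𝕜] (List A → M →ₗ[𝕜] P) where
  toFun t l := insertSum A.τ A.mu t l ∘ₗ M.τ
  map_add' s t := by
    funext l
    simp only [Pi.add_apply, ← LinearMap.add_comp]
    congr 1
    exact insertSum_add _ _ s t l
  map_smul' c t := by
    funext l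
    simp only [Pi.smul_apply, RingHom.id_apply, ← LinearMap.smul_comp]
    congr 1
    exact insertSum_map A.τ A.mu
      (c • (LinearMap.id : (M →ₗ[𝕜] P) →ₗ[𝕜] (M →ₗ[𝕜] P))).toAddMonoidHom t l

variable {A}

/-- The differential `t ↦ μ ∘ t - (-1)^k (t ∘ μ + D t)` defined by two families of operations,
which need not satisfy the `A∞`-relations. -/
noncomputable def gD {M P : GVec 𝕜 N} (μ : List A → M →ₗ[𝕜] M) (ν : List A → P →ₗ[𝕜] P)
    (k : ZMod N) : (List A → M →ₗ[𝕜] P) →ₗ[𝕜] (List A → M →ₗ[𝕜] P) :=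
  gComp A M P P ν - sgn 𝕜 k • ((gComp A M M P).flip μ + gIns A M P)

/-- The defect of the `A∞`-module relations. -/
noncomputable def curv {M : GVec 𝕜 N} (μ : List A → M →ₗ[𝕜] M) : List A → M →ₗ[𝕜] M :=
  gComp A M M M μ μ + gIns A M M μ

variable {M P Q R : GVec 𝕜 N}

theorem gComp_apply (t : List A → P →ₗ[𝕜] Q) (s : List A → M →ₗ[𝕜] P) (l : List A) :
    gComp A M P Q t s l = splitSum (fun x y => t y ∘ₗ s x) l := rfl

theorem gIns_apply (t : List A → M →ₗ[𝕜] P) (l : List A) :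
    gIns A M P t l = insertSum A.τ A.mu t l ∘ₗ M.τ := rfl

theorem gD_apply (μ : List A → M →ₗ[𝕜] M) (ν : List A → P →ₗ[𝕜] P) (k : ZMod N)
    (t : List A → M →ₗ[𝕜] P) :
    gD μ ν k t = gComp A M P P ν t - sgn 𝕜 k • (gComp A M M P t μ + gIns A M P t) := rfl

theorem splitSum_linearMap_apply {M P : Type u} [AddCommGroup M] [Module 𝕜 M] [AddCommGroup P]
    [Module 𝕜 P] {B : Type u} (f : List B → List B → M →ₗ[𝕜] P) (l : List B) (m : M) :
    splitSum f l m = splitSum (fun x y => f x y m) l := by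
  simp [splitSum]

theorem insertSum_linearMap_apply (t : List A → M →ₗ[𝕜] P) (l : List A) (m : M) :
    insertSum A.τ A.mu t l m = insertSum A.τ A.mu (fun l => t l m) l :=
  (insertSum_map A.τ A.mu (LinearMap.applyₗ (R := 𝕜) m).toAddMonoidHom t l).symm

theorem gComp_assoc (r : List A → Q →ₗ[𝕜] R) (t : List A → P →ₗ[𝕜] Q) (s : List A → M →ₗ[𝕜] P) :
    gComp A M P R (gComp A P Q R r t) s = gComp A M Q R r (gComp A M P Q t s) := by
  funext l
  simp only [gComp_apply]
  have e1 : ∀ x y : List A, splitSum (fun x y => r y ∘ₗ t x) y ∘ₗ s x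
      = splitSum (fun u v => (r v ∘ₗ t u) ∘ₗ s x) y := fun x y =>
    (splitSum_map (LinearMap.lcomp 𝕜 R (s x)).toAddMonoidHom _ _).symm
  have e2 : ∀ x y : List A, r y ∘ₗ splitSum (fun x y => t y ∘ₗ s x) x
      = splitSum (fun u v => r y ∘ₗ (t v ∘ₗ s u)) x := fun x y =>
    (splitSum_map (LinearMap.llcomp 𝕜 M Q R (r y)).toAddMonoidHom _ _).symm
  simp only [e1, e2, LinearMap.comp_assoc]
  exact (splitSum_assoc (fun x y z => r z ∘ₗ t y ∘ₗ s x) l).symm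

theorem gDeg_comp {j k : ZMod N} {t : List A → P →ₗ[𝕜] Q} {s : List A → M →ₗ[𝕜] P}
    (ht : t ∈ gDeg A P Q j) (hs : s ∈ gDeg A M P k) : gComp A M P Q t s ∈ gDeg A M Q (j + k) := by
  refine ⟨isMultilin_splitSum _ (fun y => hs.1.comp_left (LinearMap.llcomp 𝕜 M P Q (t y)))
    (fun x => ht.1.comp_left (LinearMap.lcomp 𝕜 Q (s x))), fun l r hl g m hm => ?_⟩
  rw [gComp_apply, splitSum_linearMap_apply]
  refine splitSum_mem _ _ l hl fun x y a b hab hx hy => ?_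
  have := ht.2 y b hy _ _ (hs.2 x a hx g m hm)
  rw [LinearMap.comp_apply, show g + r + (j + k) = g + a + k + b + j by rw [← hab]; ring]
  exact this

variable [Fact (Even N)]

theorem gDeg_ins {k : ZMod N} {t : List A → M →ₗ[𝕜] P} (ht : t ∈ gDeg A M P k) :
    gIns A M P t ∈ gDeg A M P (k + 1) := by
  refine ⟨(isMultilin_insertSum A.τ A.mu ht.1 A.mu_multilin).comp_left (LinearMap.lcomp 𝕜 P M.τ),
    fun l r hl g m hm => ?_⟩
  have hm' := M.τ_mem hm
  rw [gIns_apply, LinearMap.comp_apply]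
  generalize M.τ m = m' at hm'
  rw [insertSum, splitSum_linearMap_apply]
  refine splitSum_mem _ _ l hl fun x w a b hab hx hw => ?_
  rw [splitSum_linearMap_apply]
  refine splitSum_mem _ _ w hw fun y z c d hcd hy hz => ?_
  have := ht.2 _ _ (hx.map_τ.append (RDeg.cons (A.mu_deg y c hy) hz)) g m' hm'
  rw [show g + r + (k + 1) = g + (a + (c + 2 - 1 + d)) + k by rw [← hab, ← hcd]; ring]
  exact this

theorem gDeg_gD {k : ZMod N} {μ : List A → M →ₗ[𝕜] M} {ν : List A → P →ₗ[𝕜] P}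
    {t : List A → M →ₗ[𝕜] P} (hμ : μ ∈ gDeg A M M 1) (hν : ν ∈ gDeg A P P 1)
    (ht : t ∈ gDeg A M P k) : gD μ ν k t ∈ gDeg A M P (k + 1) := by
  rw [gD_apply]
  refine sub_mem ?_ (Submodule.smul_mem _ _ (add_mem (gDeg_comp ht hμ) (gDeg_ins ht)))
  rw [add_comm k 1]
  exact gDeg_comp hν ht

theorem gDeg_curv {μ : List A → M →ₗ[𝕜] M} (hμ : μ ∈ gDeg A M M 1) :
    curv μ ∈ gDeg A M M (1 + 1) := add_mem (gDeg_comp hμ hμ) (gDeg_ins hμ)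

theorem gDeg_τ {k : ZMod N} {t : List A → M →ₗ[𝕜] P} (ht : t ∈ gDeg A M P k)
    (l : List A) : t (l.map A.τ) ∘ₗ M.τ = sgn 𝕜 k • (P.τ ∘ₗ t l) := by
  refine IsMultilin.ext_homogeneous
    (f := fun l => t (l.map A.τ) ∘ₗ M.τ) (g := fun l => sgn 𝕜 k • (P.τ ∘ₗ t l))
    ((ht.1.comp_map A.τ).comp_left (LinearMap.lcomp 𝕜 P M.τ))
    ((ht.1.comp_left (LinearMap.llcomp 𝕜 M P P P.τ)).smul _) (fun l r hl => ?_) l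
  refine M.hom_ext fun g m hm => ?_
  simp only [LinearMap.comp_apply, LinearMap.smul_apply]
  rw [M.τ_of_mem hm, map_smul, map_τ_of_RDeg ht.1 hl, P.τ_of_mem (ht.2 l r hl g m hm),
    LinearMap.smul_apply, smul_smul, smul_smul]
  congr 1
  rw [← sgn_add, show g + r + k - 1 = (g - 1 + r) + k by ring, sgn_add 𝕜 (g - 1 + r) k,
    mul_comm (sgn 𝕜 k), mul_assoc, sgn_mul_self, mul_one]

theorem gIns_comp {k : ZMod N} (t : List A → P →ₗ[𝕜] Q) {s : List A → M →ₗ[𝕜] P}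
    (hs : s ∈ gDeg A M P k) :
    gIns A M Q (gComp A M P Q t s)
      = gComp A M P Q t (gIns A M P s) + sgn 𝕜 k • gComp A M P Q (gIns A P Q t) s := by
  funext l
  have h0 : gComp A M P Q t s = splitSum fun x y => t y ∘ₗ s x := rfl
  rw [gIns_apply, h0, insertSum_splitSum, LinearMap.add_comp, Pi.add_apply, Pi.smul_apply,
    gComp_apply, gComp_apply, ← splitSum_smul]
  congr 1
  · refine (splitSum_map (LinearMap.lcomp 𝕜 Q M.τ).toAddMonoidHom _ _).symm.trans ?_
    congr 1
    funext x y
    have := insertSum_map A.τ A.mu (LinearMap.llcomp 𝕜 M P Q (t y)).toAddMonoidHom s x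
    simp only [LinearMap.toAddMonoidHom_coe, LinearMap.llcomp_apply', LinearMap.lcomp_apply'] at *
    rw [this, gIns_apply, LinearMap.comp_assoc]
  · refine (splitSum_map (LinearMap.lcomp 𝕜 Q M.τ).toAddMonoidHom _ _).symm.trans ?_
    congr 1
    funext x y
    have := insertSum_map A.τ A.mu (LinearMap.lcomp 𝕜 Q (s (x.map A.τ))).toAddMonoidHom t y
    simp only [LinearMap.toAddMonoidHom_coe, LinearMap.lcomp_apply'] at *
    rw [this, gIns_apply, LinearMap.comp_assoc, gDeg_τ hs, LinearMap.comp_smul,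
      LinearMap.comp_assoc]

theorem gIns_gIns {k : ZMod N} {t : List A → M →ₗ[𝕜] P} (ht : t ∈ gDeg A M P k) :
    gIns A M P (gIns A M P t) = 0 := by
  funext l
  have h1 : insertSum A.τ A.mu (gIns A M P t) l
      = insertSum A.τ A.mu (insertSum A.τ A.mu t) l ∘ₗ M.τ :=
    insertSum_map A.τ A.mu (LinearMap.lcomp 𝕜 P M.τ).toAddMonoidHom (insertSum A.τ A.mu t) l
  rw [gIns_apply, h1, insertSum_insertSum A.τ A.mu A.τ_τ A.mu_multilin A.mu_nil A.mu_map_τ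
    A.rel ht.1]
  simp

/-- Insertion squares to zero and is a twisted derivation of composition, so only the defects of the
two structures survive in the square. The formula keeps the obstruction argument available while the
relations are known in short lengths only. -/
theorem gD_gD {k : ZMod N} {μ : List A → M →ₗ[𝕜] M} {ν : List A → P →ₗ[𝕜] P}
    {t : List A → M →ₗ[𝕜] P} (hμ : μ ∈ gDeg A M M 1) (ht : t ∈ gDeg A M P k) :
    gD μ ν (k + 1) (gD μ ν k t)
      = gComp A M P P (curv ν) t - gComp A M M P t (curv μ) := by
  have h := sgn_mul_self 𝕜 k
  simp only [gD_apply, curv, map_sub, map_add, map_smul, LinearMap.add_apply, gComp_assoc,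
    gIns_comp _ ht, gIns_comp _ hμ, gIns_gIns ht, sgn_add, sgn_one]
  simp only [smul_add, smul_sub, smul_smul, smul_neg, mul_neg, mul_one, neg_smul, one_smul,
    neg_mul, h]
  abel

/-- The Bianchi identity. It makes the lowest nonzero part of the curvature a cocycle, which is the
obstruction to the next relation. -/
theorem gD_curv {μ : List A → M →ₗ[𝕜] M} (hμ : μ ∈ gDeg A M M 1) :
    gD μ μ (1 + 1) (curv μ) = 0 := by
  simp only [gD_apply, curv, map_add, gComp_assoc, gIns_comp _ hμ, gIns_gIns hμ, sgn_add, sgn_one]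
  simp only [smul_add, smul_neg, mul_neg, mul_one, neg_smul, one_smul, neg_neg]
  abel

/-- The Maurer–Cartan expansion in the correction `s`. The quadratic term begins at twice the length
at which `s` begins, so it does not disturb the step in which `s` is chosen. -/
theorem curv_sub {μ s : List A → M →ₗ[𝕜] M} :
    curv (μ - s) = curv μ - gD μ μ 1 s + gComp A M M M s s := by
  simp only [gD_apply, curv, map_sub, LinearMap.sub_apply, sgn_one, neg_smul, one_smul]
  abel

end GradedOperations

section SplitSum

variable {α : Type u} {Z : Type v} [AddCommGroup Z]

theorem splitSum_congr {f g : List α → List α → Z} {l : List α}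
    (h : ∀ x y, x ++ y = l → f x y = g x y) : splitSum f l = splitSum g l :=
  Finset.sum_congr rfl fun _ _ => h _ _ (List.take_append_drop _ _)

theorem splitSum_eq_zero_of_append {f : List α → List α → Z} {l : List α}
    (h : ∀ x y, x ++ y = l → f x y = 0) : splitSum f l = 0 :=
  (splitSum_congr h).trans (splitSum_zero l)

end SplitSum

end AInf

namespace AInf

/-! ### Basic cocycles of the algebra, and insertion of its differential -/

section Leading

variable {𝕜 : Type u} [Field 𝕜] {N : ℕ}

/-- A family of cocycles `e k`, of degree `k δ`, whose classes form a basis of the cohomology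
algebra and multiply like the powers of a generator, with a compatible projection `P`. -/
structure PolyBasis (A : AInfAlg 𝕜 N) (δ : ZMod N) where
  e : ℕ → A
  e_deg : ∀ k : ℕ, e k ∈ A.deg (k * δ)
  e_closed : ∀ k, A.mu [e k] = 0
  P : A →ₗ[𝕜] ℕ →₀ 𝕜
  P_e : ∀ k, P (e k) = Finsupp.single k 1
  P_diff : ∀ a, P (A.mu [a]) = 0
  P_deg : ∀ g, ∀ a ∈ A.deg g, ∀ k, P a k ≠ 0 → (k : ZMod N) * δ = g
  span : ∀ g, ∀ a ∈ A.deg g, A.mu [a] = 0 →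
    ∃ b ∈ A.deg (g - 1), a = ((P a).sum fun k r => r • e k) + A.mu [b]
  e_mul : ∀ i j : ℕ, ∃ b, A.mu [e i, e j] = sgn 𝕜 ((i : ZMod N) * δ) • e (i + j) + A.mu [b]

theorem AInfAlg.mu_mem_of_mem (A : AInfAlg 𝕜 N) (g : ZMod N) (a : A) (ha : a ∈ A.deg g) :
    A.mu [a] ∈ A.deg (g + 1) := A.self.diff_mem g a ha

theorem AInfAlg.mu_mu (A : AInfAlg 𝕜 N) (a : A) : A.mu [A.mu [a]] = 0 := by
  have h := A.rel [a]
  have h0 : A.mu [0, a] = 0 := (IsLinearMap.mk' _ (A.mu_multilin.head [a])).map_zero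
  have h1 : A.mu [A.τ a, 0] = 0 := (IsLinearMap.mk' _ (A.mu_multilin [A.τ a] [])).map_zero
  simpa [insertSum_cons, insertSum_nil, splitSum_cons, splitSum_nil, A.mu_nil, h0, h1] using h

/-- `y` is concentrated on the lists of length `d`. -/
def SuppLen {α : Type u} {W : Type v} [Zero W] (d : ℕ) (y : List α → W) : Prop :=
  ∀ l, l.length ≠ d → y l = 0

/-- `y` vanishes on the lists of length less than `d`. -/
def VanishBelow {α : Type u} {W : Type v} [Zero W] (d : ℕ) (y : List α → W) : Prop :=
  ∀ l, l.length < d → y l = 0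

theorem SuppLen.vanishBelow {α : Type u} {W : Type v} [Zero W] {d : ℕ} {y : List α → W}
    (h : SuppLen d y) : VanishBelow d y := fun l hl => h l hl.ne

variable (A : AInfAlg 𝕜 N)

/-- The part of the insertion operator that inserts the differential of `A`. -/
noncomputable def insDiff {W : Type u} [AddCommGroup W] : (List A → W) → List A → W
  | _, [] => 0
  | y, a :: l => y (A.mu [a] :: l) + insDiff (fun l => y (A.τ a :: l)) l

variable {A} {W : Type u} [AddCommGroup W]

theorem insDiff_nil (y : List A → W) : insDiff A y [] = 0 := rfl

theorem insDiff_cons (y : List A → W) (a : A) (l : List A) :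
    insDiff A y (a :: l) = y (A.mu [a] :: l) + insDiff A (fun l => y (A.τ a :: l)) l := rfl

theorem insDiff_add (y z : List A → W) (l : List A) :
    insDiff A (fun l => y l + z l) l = insDiff A y l + insDiff A z l := by
  induction l generalizing y z with
  | nil => simp [insDiff_nil]
  | cons a l ih =>
    simp only [insDiff_cons, ih]
    abel

theorem insDiff_map {W' : Type u} [AddCommGroup W'] (φ : W →+ W') (y : List A → W) (l : List A) :
    insDiff A (fun l => φ (y l)) l = φ (insDiff A y l) := by
  induction l generalizing y with
  | nil => simp [insDiff_nil]
  | cons a l ih => simp only [insDiff_cons, ih, map_add]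

theorem insDiff_zero (l : List A) : insDiff A (fun _ => (0 : W)) l = 0 := by
  simpa using insDiff_map (0 : W →+ W) (fun _ => (0 : W)) l

theorem insDiff_congr {y z : List A → W} (l : List A) (h : ∀ l', l'.length = l.length → y l' = z l') :
    insDiff A y l = insDiff A z l := by
  induction l generalizing y z with
  | nil => rfl
  | cons a l ih =>
    rw [insDiff_cons, insDiff_cons, h _ (by simp), ih fun l' hl' => h _ (by simp [hl'])]

variable [Module 𝕜 W]

theorem insDiff_smul (c : 𝕜) (y : List A → W) (l : List A) :
    insDiff A (fun l => c • y l) l = c • insDiff A y l :=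
  insDiff_map (c • (LinearMap.id : W →ₗ[𝕜] W)).toAddMonoidHom y l

theorem IsMultilin.map_zero {y : List A → W} (hy : IsMultilin 𝕜 y) (x z : List A) :
    y (x ++ 0 :: z) = 0 := (IsLinearMap.mk' _ (hy x z)).map_zero

theorem IsMultilin.head_zero {y : List A → W} (hy : IsMultilin 𝕜 y) (z : List A) :
    y (0 :: z) = 0 := hy.map_zero [] z

/-- Inserting an operation with two or more entries shortens the list, and `y` vanishes on shorter
lists. The operation without entries is zero, so only the differential remains. -/
theorem insertSum_eq_insDiff {y : List A → W} (hy : IsMultilin 𝕜 y) {l : List A}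
    (h : VanishBelow l.length y) : insertSum A.τ A.mu y l = insDiff A y l := by
  induction l generalizing y with
  | nil => rw [insertSum_nil, A.mu_nil, hy.head_zero, insDiff_nil]
  | cons a l ih =>
    rw [insertSum_cons, insDiff_cons, ih (hy.tail _) fun l' hl' => h _ (by simpa using hl'),
      splitSum_cons, A.mu_nil, hy.head_zero, zero_add]
    congr 1
    cases l with
    | nil => rw [splitSum_nil]
    | cons b l =>
      rw [splitSum_cons, splitSum_eq_zero_of_append, add_zero]
      intro x z hxz
      refine h _ ?_
      simp [← hxz]

end Leading

/-! ### A Künneth argument for multilinear functions -/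

section Kunneth

variable {𝕜 : Type u} [Field 𝕜] {N : ℕ} (A : AInfAlg 𝕜 N)

/-- The multilinear functions of degree `j` on lists of length `d`. -/
def fDeg (P : GVec 𝕜 N) (d : ℕ) (j : ZMod N) : Submodule 𝕜 (List A → P) where
  carrier := {y | IsMultilin 𝕜 y ∧ (∀ l r, RDeg A.toGVec l r → y l ∈ P.deg (r + j)) ∧ SuppLen d y}
  add_mem' := fun {_ _} hs ht => ⟨hs.1.add ht.1, fun l r hl =>
    add_mem (hs.2.1 l r hl) (ht.2.1 l r hl), fun l hl => by
      simp [hs.2.2 l hl, ht.2.2 l hl]⟩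
  zero_mem' := ⟨isMultilin_zero, fun _ _ _ => zero_mem _, fun _ _ => rfl⟩
  smul_mem' := fun c _ ht => ⟨ht.1.smul c, fun l r hl =>
    Submodule.smul_mem _ c (ht.2.1 l r hl), fun l hl => by simp [ht.2.2 l hl]⟩

variable {A} {P : GVec 𝕜 N} (dP : P →ₗ[𝕜] P)

/-- The leading part of the differential on functions of degree `j`. -/
noncomputable def fD (j : ZMod N) : (List A → P) →ₗ[𝕜] (List A → P) where
  toFun y l := dP (y l) + sgn 𝕜 j • insDiff A y l
  map_add' y z := by
    funext l
    simp only [Pi.add_apply, map_add]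
    rw [show insDiff A (y + z) l = _ from insDiff_add y z l, smul_add]
    abel
  map_smul' c y := by
    funext l
    simp only [Pi.smul_apply, map_smul, RingHom.id_apply]
    rw [show insDiff A (c • y) l = _ from insDiff_smul c y l, smul_add, smul_comm c]

theorem fD_apply (j : ZMod N) (y : List A → P) (l : List A) :
    fD dP j y l = dP (y l) + sgn 𝕜 j • insDiff A y l := rfl

variable [Fact (Even N)]

theorem sgn_add_sub_one (g j : ZMod N) : sgn 𝕜 (g + (j - 1)) = -(sgn 𝕜 g * sgn 𝕜 j) := by
  have := sgn_add 𝕜 (g + (j - 1)) 1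
  rw [sgn_one, show g + (j - 1) + 1 = g + j by ring, sgn_add] at this
  rw [this]
  ring

theorem sgn_sub_one (j : ZMod N) : sgn 𝕜 (j - 1) = -sgn 𝕜 j := by
  have := sgn_add_sub_one (𝕜 := 𝕜) 0 j
  rwa [zero_add, sgn_zero, one_mul] at this

/-- Fixing a first entry of degree `g` turns a function of degree `j` into one of degree `g + (j -
1)` with one entry less. Thus a closed function is, after currying, a chain map out of `A` up to the
sign `-sgn 𝕜 j`, which makes induction on the number of entries possible. -/
theorem fD_cons {j : ZMod N} {y : List A → P} (hy : IsMultilin 𝕜 y) {g : ZMod N} {a : A}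
    (ha : a ∈ A.deg g) (l : List A) :
    fD dP j y (a :: l) = fD dP (g + (j - 1)) (fun l => y (a :: l)) l
      + sgn 𝕜 j • y (A.mu [a] :: l) := by
  have h1 : (fun l => y (A.τ a :: l)) = fun l => sgn 𝕜 (g - 1) • y (a :: l) := by
    funext l
    rw [A.τ_of_mem ha, (hy.head l).map_smul]
  rw [fD_apply, fD_apply, insDiff_cons, h1, insDiff_smul, smul_add, smul_smul, sgn_sub_one,
    sgn_add_sub_one, mul_neg, mul_comm]
  abel

/-- A multilinear function which is closed for the leading differential and takes coboundaries as
values on the basic cocycles is exact. -/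
theorem exists_fD_eq {δ : ZMod N} (D : PolyBasis A δ)
    (hdP : ∀ g, ∀ x ∈ P.deg g, dP x ∈ P.deg (g + 1)) (d : ℕ) (j : ZMod N) (y : List A → P)
    (hy : y ∈ fDeg A P d j) (hc : fD dP j y = 0)
    (hr : ∀ K : List ℕ, K.length = d → y (K.map D.e) ∈ LinearMap.range dP) :
    ∃ s ∈ fDeg A P d (j - 1), fD dP (j - 1) s = y := by
  induction d generalizing j y with
  | zero =>
    obtain ⟨p, hp⟩ := hr [] rfl
    -- The given primitive may be inhomogeneous; since `y []` has degree `j`, the component of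
    -- degree `j - 1` is again a primitive.
    have hp' : dP (P.proj (j - 1) p) = y [] := by
      rw [P.d_proj hdP, hp, sub_add_cancel]
      refine P.proj_of_mem ?_
      simpa using hy.2.1 [] 0 RDeg.nil
    refine ⟨fun l => if l.length = 0 then P.proj (j - 1) p else 0, ⟨fun x z => ?_,
      fun l r hl => ?_, fun l hl => if_neg hl⟩, ?_⟩
    · simp only [List.length_append, List.length_cons, Nat.add_eq_zero_iff, one_ne_zero, and_false,
        if_false]
      exact ⟨by simp, by simp⟩
    · cases hl with
      | nil => simpa using P.proj_mem _ _
      | cons _ _ => exact zero_mem _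
    · funext l
      cases l with
      | nil => simp [fD_apply, insDiff_nil, hp']
      | cons a l =>
        rw [hy.2.2 (a :: l) (by simp), fD_apply, insDiff_congr (z := fun _ => 0), insDiff_zero]
        · simp
        · intro l' hl'
          rw [if_neg]
          simp [hl']
  | succ d ih =>
    -- Curry in the first entry. By `exists_nullhomotopy` it is enough that cocycles of `A` are sent
    -- to exact functions of the remaining `d` entries.
    let f : A →ₗ[𝕜] (List A → P) :=
      { toFun := fun a l => y (a :: l)
        map_add' := fun a b => funext fun l => (hy.1.head l).map_add a b
        map_smul' := fun c a => funext fun l => (hy.1.head l).map_smul c a }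
    have hf : ∀ g, ∀ a ∈ A.deg g, f a ∈ fDeg A P d (g + (j - 1)) := fun g a ha =>
      ⟨hy.1.tail a, fun l r hl => by
        have := hy.2.1 _ _ (RDeg.cons ha hl)
        rwa [show g - 1 + r + j = r + (g + (j - 1)) by ring] at this,
        fun l hl => hy.2.2 _ (by simpa using hl)⟩
    have hD : ∀ g, ∀ a ∈ A.deg g, fD dP (g + (j - 1)) (f a) = (-sgn 𝕜 j) • f (A.diff a) := by
      intro g a ha
      funext l
      have := congrFun hc (a :: l)
      rw [fD_cons dP hy.1 ha] at this
      rw [Pi.smul_apply, neg_smul]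
      exact eq_neg_of_add_eq_zero_left this
    have hex : ∀ g, ∀ a ∈ A.deg g, A.diff a = 0 → ∃ s ∈ fDeg A P d (g + (j - 1 - 1)),
        fD dP (g + (j - 1 - 1)) s = f a := by
      intro g a ha hda
      have e0 : g + (j - 1 - 1) = g + (j - 1) - 1 := by ring
      -- A cocycle is a combination of basic cocycles plus a coboundary. The induction hypothesis
      -- treats the former; for the coboundary of `b`, the function `f b` is a primitive up to sign.
      obtain ⟨b, hb, hab⟩ := D.span g a ha hda
      change f a ∈ (fDeg A P d (g + (j - 1 - 1))).map (fD dP (g + (j - 1 - 1)))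
      rw [hab, map_add, Finsupp.sum, map_sum]
      refine add_mem (Submodule.sum_mem _ fun k hk => ?_) ?_
      · rw [map_smul]
        refine Submodule.smul_mem _ _ ?_
        have hk' := D.P_deg g a ha k (Finsupp.mem_support_iff.1 hk)
        have hek : D.e k ∈ A.deg g := hk' ▸ D.e_deg k
        rw [e0]
        refine ih _ _ (hf g _ hek) ?_ fun K hK => hr (k :: K) (by simp [hK])
        rw [hD g _ hek, show A.diff (D.e k) = 0 from D.e_closed k, map_zero, smul_zero]
      · refine ⟨(-sgn 𝕜 j) • f b, Submodule.smul_mem _ _ ?_, ?_⟩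
        · have := hf _ b hb
          rwa [show g - 1 + (j - 1) = g + (j - 1 - 1) by ring] at this
        · have := hD _ b hb
          rw [show g - 1 + (j - 1) = g + (j - 1 - 1) by ring] at this
          rw [map_smul, this, smul_smul, neg_mul_neg, sgn_mul_self, one_smul]
          rfl
    obtain ⟨s, hs, hs'⟩ := A.exists_nullhomotopy A.diff A.mu_mem_of_mem A.mu_mu
      (fDeg A P d) (fD dP) (j - 1) (-sgn 𝕜 j) (by rw [neg_mul_neg, sgn_mul_self]) f hf hD hex
    have hs1 : ∀ a, IsMultilin 𝕜 (s a) ∧ SuppLen d (s a) := by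
      intro a
      induction a using internal_induction A.internal with
      | hom g a ha => exact ⟨(hs g a ha).1, (hs g a ha).2.2⟩
      | zero => rw [map_zero]; exact ⟨isMultilin_zero, fun _ _ => rfl⟩
      | add a b ha hb =>
        rw [map_add]
        exact ⟨ha.1.add hb.1, fun l hl => by simp [ha.2 l hl, hb.2 l hl]⟩
    -- Uncurry the null-homotopy, with value zero on the empty list: everything is concentrated in
    -- length `d + 1`.
    let s' : List A → P := fun l => l.casesOn 0 fun a l => s a l
    have hs'm : IsMultilin 𝕜 s' := by
      intro x z
      cases x with
      | nil =>
        exact ⟨fun a b => congrFun (s.map_add a b) z, fun c a => congrFun (s.map_smul c a) z⟩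
      | cons b x => exact (hs1 b).1 x z
    refine ⟨s', ⟨hs'm, fun l r hl => ?_, fun l hl => ?_⟩, ?_⟩
    · cases hl with
      | nil => exact zero_mem _
      | @cons a l g r ha hl =>
        have := (hs g a ha).2.1 l r hl
        rwa [show r + (g + (j - 1 - 1)) = g - 1 + r + (j - 1) by ring] at this
    · cases l with
      | nil => rfl
      | cons a l => exact (hs1 a).2 l (by simpa using hl)
    · funext l
      cases l with
      | nil =>
        rw [hy.2.2 [] (by simp), fD_apply, insDiff_nil, smul_zero, add_zero]
        exact map_zero dP
      | cons a l =>
        induction a using internal_induction A.internal with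
        | hom g a ha =>
          rw [fD_cons dP hs'm ha, sgn_sub_one]
          exact (congrFun (hs' g a ha) l).symm
        | zero =>
          rw [hy.1.head_zero, fD_apply, hs'm.head_zero, insDiff_cons, A.mu_multilin.head_zero,
            hs'm.head_zero, map_zero, map_zero]
          have : (fun l => s' (0 :: l)) = fun _ => 0 := funext fun l => hs'm.head_zero l
          rw [this, insDiff_zero]
          simp
        | add a b ha hb =>
          rw [(hy.1.head l).map_add, ← ha, ← hb]
          simp only [fD_apply, insDiff_cons]
          have : (fun l => s' (A.τ (a + b) :: l))
              = fun l => s' (A.τ a :: l) + s' (A.τ b :: l) := by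
            funext l
            rw [map_add, (hs'm.head l).map_add]
          rw [this, insDiff_add, (hs'm.head l).map_add, (A.mu_multilin.head []).map_add,
            (hs'm.head l).map_add, map_add]
          simp only [smul_add]
          abel

variable {M : GVec 𝕜 N} (dM : M →ₗ[𝕜] M)

/-- The leading part of the differential of a family of multilinear maps of degree `k`. -/
noncomputable def gE (k : ZMod N) (t : List A → M →ₗ[𝕜] P) (l : List A) : M →ₗ[𝕜] P :=
  dP ∘ₗ t l - sgn 𝕜 k • (t l ∘ₗ dM + insDiff A t l ∘ₗ M.τ)

omit [Fact (Even N)] in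
theorem insDiff_linearMap_apply (t : List A → M →ₗ[𝕜] P) (l : List A) (m : M) :
    insDiff A t l m = insDiff A (fun l => t l m) l :=
  (insDiff_map (LinearMap.applyₗ (R := 𝕜) m).toAddMonoidHom t l).symm

/-- At an argument of degree `g`, the sign from `M.τ` is absorbed by the change of degree from `k`
to `g + k`. Evaluation at elements of `M` therefore reduces `gE` to `fD`. -/
theorem gE_apply {k g : ZMod N} (t : List A → M →ₗ[𝕜] P) (l : List A) {m : M}
    (hm : m ∈ M.deg g) :
    gE dP dM k t l m = fD dP (g + k) (fun l => t l m) l - sgn 𝕜 k • t l (dM m) := by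
  have h : insDiff A t l (M.τ m) = sgn 𝕜 (g - 1) • insDiff A (fun l => t l m) l := by
    rw [M.τ_of_mem hm, map_smul, insDiff_linearMap_apply]
  simp only [gE, LinearMap.sub_apply, LinearMap.comp_apply, LinearMap.smul_apply,
    LinearMap.add_apply, fD_apply, h, sgn_sub_one, sgn_add]
  module

/-- Curried in the module argument, `t` is a chain map from `M` to multilinear functions. At a
cocycle its value is a closed function with exact values on the basic cocycles, hence exact by
`exists_fD_eq`, and `exists_nullhomotopy` applies once more. -/
theorem exists_gE_eq {δ : ZMod N} (D : PolyBasis A δ)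
    (hdP : ∀ g, ∀ x ∈ P.deg g, dP x ∈ P.deg (g + 1))
    (hdM : ∀ g, ∀ x ∈ M.deg g, dM x ∈ M.deg (g + 1)) (hddM : ∀ x, dM (dM x) = 0)
    (d : ℕ) (k : ZMod N) (t : List A → M →ₗ[𝕜] P)
    (ht : t ∈ gDeg A M P k) (ht' : SuppLen d t) (hc : ∀ l, gE dP dM k t l = 0)
    (hr : ∀ K : List ℕ, K.length = d → ∀ m, dM m = 0 → t (K.map D.e) m ∈ LinearMap.range dP) :
    ∃ s ∈ gDeg A M P (k - 1), SuppLen d s ∧ ∀ l, gE dP dM (k - 1) s l = t l := by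
  let f : M →ₗ[𝕜] (List A → P) := LinearMap.pi t
  have hf : ∀ g, ∀ m ∈ M.deg g, f m ∈ fDeg A P d (g + k) := fun g m hm =>
    ⟨fun x z => ⟨fun a b => LinearMap.congr_fun ((ht.1 x z).map_add a b) m,
      fun c a => LinearMap.congr_fun ((ht.1 x z).map_smul c a) m⟩, fun l r hl => by
        have := ht.2 l r hl g m hm
        rwa [show g + r + k = r + (g + k) by ring] at this,
      fun l hl => LinearMap.congr_fun (ht' l hl) m⟩
  have hD : ∀ g, ∀ m ∈ M.deg g, fD dP (g + k) (f m) = sgn 𝕜 k • f (dM m) := by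
    intro g m hm
    funext l
    have := LinearMap.congr_fun (hc l) m
    rw [gE_apply _ _ _ _ hm] at this
    exact sub_eq_zero.1 this
  obtain ⟨s, hs, hs'⟩ := M.exists_nullhomotopy dM hdM hddM (fDeg A P d) (fD dP) k (sgn 𝕜 k)
    (sgn_mul_self 𝕜 k) f hf hD (fun g m hm hdm => by
      rw [show g + (k - 1) = g + k - 1 by ring]
      refine exists_fD_eq dP D hdP d _ _ (hf g m hm) ?_ fun K hK => hr K hK m hdm
      rw [hD g m hm, hdm, map_zero, smul_zero])
  have hs1 : ∀ m, IsMultilin 𝕜 (s m) ∧ SuppLen d (s m) := by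
    intro m
    induction m using internal_induction M.internal with
    | hom g a ha => exact ⟨(hs g a ha).1, (hs g a ha).2.2⟩
    | zero => rw [map_zero]; exact ⟨isMultilin_zero, fun _ _ => rfl⟩
    | add a b ha hb =>
      rw [map_add]
      exact ⟨ha.1.add hb.1, fun l hl => by simp [ha.2 l hl, hb.2 l hl]⟩
  refine ⟨fun l => LinearMap.proj l ∘ₗ s, ⟨fun x z => ?_, fun l r hl g m hm => ?_⟩, fun l hl => ?_,
    fun l => ?_⟩
  · exact ⟨fun a b => LinearMap.ext fun m => ((hs1 m).1 x z).map_add a b,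
      fun c a => LinearMap.ext fun m => ((hs1 m).1 x z).map_smul c a⟩
  · have := (hs g m hm).2.1 l r hl
    rwa [show r + (g + (k - 1)) = g + r + (k - 1) by ring] at this
  · exact LinearMap.ext fun m => (hs1 m).2 l hl
  · refine M.hom_ext fun g m hm => ?_
    rw [gE_apply _ _ _ _ hm, sgn_sub_one, neg_smul, sub_neg_eq_add]
    exact (congrFun (hs' g m hm) l).symm

end Kunneth

end AInf

namespace AInf

/-! ### The bar complex of the polynomial ring in one variable -/

section Bar

variable {𝕜 : Type u} [Field 𝕜] {V : Type u} [AddCommGroup V] [Module 𝕜 V] {W : Type u}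
  [AddCommGroup W] [Module 𝕜 W]

/-- The part `y ↦ ∑ (-1)^i y (…, kᵢ + kᵢ₊₁, …) ± u^{k_d} y (k₁, …)` of the bar differential of
the polynomial ring, for functions on monomials with values in a module. -/
def barR (w : W →ₗ[𝕜] W) : (List ℕ → W) → List ℕ → W
  | _, [] => 0
  | y, [a] => (w ^ a) (y [])
  | y, a :: b :: l => y ((a + b) :: l) - barR w (fun l => y (a :: l)) (b :: l)

variable (w : W →ₗ[𝕜] W)

theorem barR_singleton (y : List ℕ → W) (a : ℕ) : barR w y [a] = (w ^ a) (y []) := by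
  rw [barR]

theorem barR_cons_cons (y : List ℕ → W) (a b : ℕ) (l : List ℕ) :
    barR w y (a :: b :: l) = y ((a + b) :: l) - barR w (fun l => y (a :: l)) (b :: l) := by
  rw [barR]

theorem barR_congr {y z : List ℕ → W} {K : List ℕ}
    (h : ∀ K', K'.length + 1 = K.length → y K' = z K') : barR w y K = barR w z K := by
  induction K generalizing y z with
  | nil => rfl
  | cons a K ih =>
    cases K with
    | nil => rw [barR_singleton, barR_singleton, h [] rfl]
    | cons b l =>
      rw [barR_cons_cons, barR_cons_cons, h _ (by simp),
        ih fun K' hK' => h _ (by simpa using hK')]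

theorem barR_add (y z : List ℕ → W) (K : List ℕ) :
    barR w (fun K => y K + z K) K = barR w y K + barR w z K := by
  induction K generalizing y z with
  | nil => simp [barR]
  | cons a K ih =>
    cases K with
    | nil => simp only [barR_singleton, map_add]
    | cons b l =>
      simp only [barR_cons_cons, ih]
      abel

theorem barR_smul (c : 𝕜) (y : List ℕ → W) (K : List ℕ) :
    barR w (fun K => c • y K) K = c • barR w y K := by
  induction K generalizing y with
  | nil => simp [barR]
  | cons a K ih =>
    cases K with
    | nil => simp only [barR_singleton, map_smul]
    | cons b l => simp only [barR_cons_cons, ih, smul_sub]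

theorem barR_sub (y z : List ℕ → W) (K : List ℕ) :
    barR w (fun K => y K - z K) K = barR w y K - barR w z K := by
  have : (fun K => y K - z K) = fun K => y K + (-1 : 𝕜) • z K := by
    funext K
    rw [neg_one_smul, sub_eq_add_neg]
  rw [this, barR_add, barR_smul, neg_one_smul, sub_eq_add_neg]

theorem barR_sum (s : Finset ℕ) (y : ℕ → List ℕ → W) (K : List ℕ) :
    barR w (fun K => ∑ j ∈ s, y j K) K = ∑ j ∈ s, barR w (y j) K := by
  induction s using Finset.cons_induction with
  | empty => simpa using barR_smul (𝕜 := 𝕜) w 0 (fun _ => 0) K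
  | cons j s hj ih => simp only [Finset.sum_cons, barR_add, ih]

variable (q : V →ₗ[𝕜] V)

/-- The bar differential on functions of monomials with values in linear maps. -/
def barD (X : List ℕ → V →ₗ[𝕜] W) : List ℕ → V → W
  | [], _ => 0
  | a :: l, v => barR w (fun K => X K v) (a :: l) - X l ((q ^ a) v)

theorem barD_cons (X : List ℕ → V →ₗ[𝕜] W) (a : ℕ) (l : List ℕ) (v : V) :
    barD w q X (a :: l) v = barR w (fun K => X K v) (a :: l) - X l ((q ^ a) v) := rfl

theorem barD_congr {X Y : List ℕ → V →ₗ[𝕜] W} {K : List ℕ}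
    (h : ∀ K', K'.length + 1 = K.length → X K' = Y K') : barD w q X K = barD w q Y K := by
  funext v
  cases K with
  | nil => rfl
  | cons a l =>
    rw [barD_cons, barD_cons, h l rfl, barR_congr w fun K' hK' => by rw [h K' hK']]

theorem barD_sub (X Y : List ℕ → V →ₗ[𝕜] W) (K : List ℕ) (v : V) :
    barD w q (fun K => X K - Y K) K v = barD w q X K v - barD w q Y K v := by
  cases K with
  | nil => exact (sub_zero 0).symm
  | cons a l =>
    simp only [barD_cons, LinearMap.sub_apply, barR_sub]
    abel

theorem barD_smul (c : 𝕜) (X : List ℕ → V →ₗ[𝕜] W) (K : List ℕ) (v : V) :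
    barD w q (fun K => c • X K) K v = c • barD w q X K v := by
  cases K with
  | nil => exact (smul_zero c).symm
  | cons a l => simp only [barD_cons, LinearMap.smul_apply, barR_smul, smul_sub]

/-- The contraction of the bar complex in degrees at least two. -/
noncomputable def barS (X : List ℕ → V →ₗ[𝕜] W) : List ℕ → V →ₗ[𝕜] W
  | [] => 0
  | k :: l => ∑ j ∈ Finset.range k, X (1 :: (k - 1 - j) :: l) ∘ₗ q ^ j - X (0 :: 0 :: l) ∘ₗ q ^ k

theorem barS_cons_apply (X : List ℕ → V →ₗ[𝕜] W) (k : ℕ) (l : List ℕ) (v : V) :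
    barS q X (k :: l) v = ∑ j ∈ Finset.range k, X (1 :: (k - 1 - j) :: l) ((q ^ j) v)
      - X (0 :: 0 :: l) ((q ^ k) v) := by
  simp [barS]

/-- The contraction reflects the bimodule resolution of length one: a monomial `u ^ k` is taken
apart one factor `u` at a time, leaving `u ^ (k - 1 - j)` as next entry and letting `u ^ j` act on
the argument. Only the cocycle conditions with first entries `1, i` and `0, 0` are used. The term
with `0 :: 0` is there because the cochains are not normalized. -/
theorem barD_barS {X : List ℕ → V →ₗ[𝕜] W} (a b : ℕ) (l : List ℕ)
    (hX : ∀ i j v, barD w q X (i :: j :: b :: l) v = 0) (v : V) :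
    barD w q (barS q X) (a :: b :: l) v = X (a :: b :: l) v := by
  have h1 : ∀ i z, barR w (fun l => X (1 :: i :: l) z) (b :: l)
      = X (i :: b :: l) (q z) - X ((i + 1) :: b :: l) z + X (1 :: (i + b) :: l) z := by
    intro i z
    have := hX 1 i z
    rw [barD_cons, barR_cons_cons, barR_cons_cons, pow_one, add_comm 1 i] at this
    rw [← sub_eq_zero, ← this]
    abel
  have h0 : ∀ z, barR w (fun l => X (0 :: 0 :: l) z) (b :: l) = X (0 :: b :: l) z := by
    intro z
    have := hX 0 0 z
    rw [barD_cons, barR_cons_cons, barR_cons_cons, pow_zero, zero_add, zero_add] at this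
    rw [← sub_eq_zero, ← this, Module.End.one_apply]
    abel
  -- The telescoping sum that produces `X (a :: b :: l)`; its other end is cancelled by `h0`.
  have h2 : ∑ j ∈ Finset.range a, (X ((a - 1 - j) :: b :: l) (q ((q ^ j) v))
      - X ((a - 1 - j + 1) :: b :: l) ((q ^ j) v))
      = X (0 :: b :: l) ((q ^ a) v) - X (a :: b :: l) v := by
    have := Finset.sum_range_sub (fun j => X ((a - j) :: b :: l) ((q ^ j) v)) a
    rw [Nat.sub_self, Nat.sub_zero, pow_zero, Module.End.one_apply] at this
    rw [← this]
    refine Finset.sum_congr rfl fun j hj => ?_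
    have hj := Finset.mem_range.1 hj
    rw [pow_succ', Module.End.mul_apply, show a - 1 - j + 1 = a - j by omega,
      show a - 1 - j = a - (j + 1) by omega]
  have h3 : ∑ j ∈ Finset.range a, X (1 :: (a - 1 - j + b) :: l) ((q ^ j) v)
      = ∑ j ∈ Finset.range a, X (1 :: (a + b - 1 - j) :: l) ((q ^ j) v) := by
    refine Finset.sum_congr rfl fun j hj => ?_
    have hj := Finset.mem_range.1 hj
    rw [show a - 1 - j + b = a + b - 1 - j by omega]
  have h4 : ∑ i ∈ Finset.range b, X (1 :: (b - 1 - i) :: l) ((q ^ i) ((q ^ a) v))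
      = ∑ i ∈ Finset.range b, X (1 :: (a + b - 1 - (a + i)) :: l) ((q ^ (a + i)) v) := by
    refine Finset.sum_congr rfl fun i _ => ?_
    rw [show a + b - 1 - (a + i) = b - 1 - i by omega, add_comm a i, pow_add,
      Module.End.mul_apply]
  rw [barD_cons, barR_cons_cons]
  simp only [barS_cons_apply, barR_sub, barR_sum, h1, h0, Finset.sum_add_distrib, h2, h3, h4,
    Finset.sum_range_add]
  rw [add_comm a b, pow_add, Module.End.mul_apply]
  abel

/-- The derivation with a prescribed value on the generator. -/
noncomputable def barL (x : V →ₗ[𝕜] W) : List ℕ → V →ₗ[𝕜] W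
  | [k] => ∑ j ∈ Finset.range k, (w ^ (k - 1 - j)) ∘ₗ x ∘ₗ q ^ j
  | _ => 0

theorem barL_apply (x : V →ₗ[𝕜] W) (k : ℕ) (v : V) :
    barL w q x [k] v = ∑ j ∈ Finset.range k, (w ^ (k - 1 - j)) (x ((q ^ j) v)) := by
  simp [barL]

/-- The Leibniz rule: the sum for `a + b` splits after its first `a` terms into the value at `u ^ a`
followed by `u ^ b` and the value at `u ^ b` preceded by `u ^ a`. A ring free on one generator
imposes no condition on `x`. -/
theorem barD_barL (x : V →ₗ[𝕜] W) (a b : ℕ) (v : V) : barD w q (barL w q x) [a, b] v = 0 := by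
  rw [barD_cons, barR_cons_cons, barR_singleton]
  simp only [barL_apply, Finset.sum_range_add, map_sum]
  have h1 : ∑ j ∈ Finset.range a, (w ^ (a + b - 1 - j)) (x ((q ^ j) v))
      = ∑ j ∈ Finset.range a, (w ^ b) ((w ^ (a - 1 - j)) (x ((q ^ j) v))) := by
    refine Finset.sum_congr rfl fun j hj => ?_
    have hj := Finset.mem_range.1 hj
    rw [show a + b - 1 - j = b + (a - 1 - j) by omega, pow_add, Module.End.mul_apply]
  have h2 : ∑ i ∈ Finset.range b, (w ^ (a + b - 1 - (a + i))) (x ((q ^ (a + i)) v))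
      = ∑ i ∈ Finset.range b, (w ^ (b - 1 - i)) (x ((q ^ i) ((q ^ a) v))) := by
    refine Finset.sum_congr rfl fun i _ => ?_
    rw [show a + b - 1 - (a + i) = b - 1 - i by omega, add_comm a i, pow_add,
      Module.End.mul_apply]
  rw [h1, h2]
  abel

theorem barL_one (x : V →ₗ[𝕜] W) : barL w q x [1] = x := by
  ext v
  simp [barL_apply]

/-- A derivation is determined by its value on the generator: the condition on `[0, 0]` gives the
value zero at the unit, and the condition on `[k, 1]` carries the induction. -/
theorem eq_zero_of_barD_eq_zero {X : List ℕ → V →ₗ[𝕜] W} (h1 : X [1] = 0)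
    (hX : ∀ i j v, barD w q X [i, j] v = 0) (k : ℕ) : X [k] = 0 := by
  induction k with
  | zero =>
    ext v
    have := hX 0 0 v
    simpa [barD_cons, barR_cons_cons, barR_singleton] using this
  | succ k ih =>
    ext v
    have := hX k 1 v
    rw [barD_cons, barR_cons_cons, barR_singleton, h1, ih] at this
    simpa using this

variable {N : ℕ} (δ : ZMod N) (Vd : ZMod N → Submodule 𝕜 V) (Wd : ZMod N → Submodule 𝕜 W)

/-- Functions on monomials of degree `k`, the generator having degree `δ`. -/
def BarDeg (k : ZMod N) (X : List ℕ → V →ₗ[𝕜] W) : Prop :=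
  ∀ K g, ∀ v ∈ Vd g, X K v ∈ Wd (g + ((K.sum : ZMod N) * δ - K.length) + k)

variable {δ Vd Wd}

theorem pow_apply_mem {Vd : ZMod N → Submodule 𝕜 V} (hq : ∀ g, ∀ v ∈ Vd g, q v ∈ Vd (g + δ))
    (j : ℕ) (g : ZMod N) (v : V) (hv : v ∈ Vd g) : (q ^ j) v ∈ Vd (g + j * δ) := by
  induction j with
  | zero => simpa using hv
  | succ j ih =>
    rw [pow_succ', Module.End.mul_apply, show g + ((j + 1 : ℕ) : ZMod N) * δ = g + j * δ + δ by
      push_cast; ring]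
    exact hq _ _ ih

/-- The bar complex of the polynomial ring in one variable is exact in degrees at least two. -/
theorem exists_barD_eq (hq : ∀ g, ∀ v ∈ Vd g, q v ∈ Vd (g + δ))
    (hw : ∀ g, ∀ v ∈ Wd g, w v ∈ Wd (g + δ)) {k : ZMod N} {d : ℕ} {X : List ℕ → V →ₗ[𝕜] W}
    (hXd : BarDeg δ Vd Wd k X)
    (hX : ∀ K, K.length = d + 3 → ∀ v, barD w q X K v = 0) :
    ∃ S, BarDeg δ Vd Wd (k - 1) S ∧ SuppLen (d + 1) S ∧ S [1] = 0 ∧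
      ∀ K, K.length = d + 2 → ∀ v, barD w q S K v = X K v := by
  have hS : BarDeg δ Vd Wd (k - 1) (barS q X) := by
    intro K g v hv
    cases K with
    | nil => exact zero_mem _
    | cons a l =>
      rw [barS_cons_apply]
      refine sub_mem (Submodule.sum_mem _ fun j hj => ?_) ?_
      · obtain ⟨i, rfl⟩ := Nat.exists_eq_add_of_lt (Finset.mem_range.1 hj)
        have := hXd (1 :: (j + i + 1 - 1 - j) :: l) _ _ (pow_apply_mem q hq j g v hv)
        rw [show j + i + 1 - 1 - j = i by omega] at this ⊢
        convert this using 2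
        simp only [List.sum_cons, List.length_cons]
        push_cast
        ring
      · have := hXd (0 :: 0 :: l) _ _ (pow_apply_mem q hq a g v hv)
        convert this using 2
        simp only [List.sum_cons, List.length_cons]
        push_cast
        ring
  have hSX : ∀ K, K.length = d + 2 → ∀ v, barD w q (barS q X) K v = X K v := by
    rintro (_ | ⟨a, _ | ⟨b, l⟩⟩) hK v
    · simp at hK
    · simp at hK
    · exact barD_barS w q a b l (fun i j v => hX _ (by simpa using hK) v) v
  have hL : BarDeg δ Vd Wd (k - 1) (barL w q (barS q X [1])) := by
    rintro (_ | ⟨a, _ | ⟨b, l⟩⟩) g v hv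
    · exact zero_mem _
    · rw [barL_apply]
      refine Submodule.sum_mem _ fun j hj => ?_
      obtain ⟨i, rfl⟩ := Nat.exists_eq_add_of_lt (Finset.mem_range.1 hj)
      have := pow_apply_mem w hw i _ _ (hS [1] _ _ (pow_apply_mem q hq j g v hv))
      rw [show j + i + 1 - 1 - j = i by omega]
      convert this using 2
      simp only [List.sum_cons, List.length_cons, List.sum_nil, List.length_nil]
      push_cast
      ring
    · exact zero_mem _
  -- The contraction need not vanish on the generator. Subtracting the derivation with the same
  -- value there leaves the coboundary in length two unchanged, and in higher lengths the derivation
  -- is zero. Truncation concentrates `S` in length `d + 1`.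
  let S : List ℕ → V →ₗ[𝕜] W := fun K =>
    if K.length = d + 1 then barS q X K - barL w q (barS q X [1]) K else 0
  refine ⟨S, fun K g v hv => ?_, fun K hK => if_neg hK, ?_, fun K hK v => ?_⟩
  · by_cases hK : K.length = d + 1
    · simp only [S, if_pos hK, LinearMap.sub_apply]
      exact sub_mem (hS K g v hv) (hL K g v hv)
    · simp only [S, if_neg hK]
      exact zero_mem _
  · simp only [S, barL_one, sub_self, ite_self]
  · have e : barD w q S K = barD w q (fun K => barS q X K - barL w q (barS q X [1]) K) K :=
      barD_congr w q fun K' hK' => if_pos (by omega)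
    rw [e, barD_sub, hSX K hK]
    match K, hK with
    | [a, b], _ => rw [barD_barL, sub_zero]
    | a :: b :: c :: l, _ =>
      have e' : barD w q (barL w q (barS q X [1])) (a :: b :: c :: l)
          = barD w q (fun _ => 0) (a :: b :: c :: l) := by
        refine barD_congr w q ?_
        rintro (_ | ⟨a, _ | ⟨b, l⟩⟩) hK'
        · rfl
        · simp at hK'
        · rfl
      have e2 := barD_smul w q (0 : 𝕜) (fun _ => (0 : V →ₗ[𝕜] W)) (a :: b :: c :: l) v
      simp only [smul_zero, zero_smul] at e2
      rw [e', e2, sub_zero]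

end Bar

end AInf

namespace AInf

set_option linter.unusedSectionVars false

section SplitSum

variable {α : Type u} {Z : Type v} [AddCommGroup Z]

theorem splitSum_eq_last {f : List α → List α → Z} {l : List α}
    (h : ∀ x y, x ++ y = l → y ≠ [] → f x y = 0) : splitSum f l = f l [] := by
  induction l generalizing f with
  | nil => rw [splitSum_nil]
  | cons a l ih =>
    rw [splitSum_cons, h [] (a :: l) rfl (by simp), zero_add]
    exact ih fun x y hxy hy => h (a :: x) y (by simp [hxy]) hy

theorem splitSum_eq_first {f : List α → List α → Z} {l : List α}
    (h : ∀ x y, x ++ y = l → x ≠ [] → f x y = 0) : splitSum f l = f [] l := by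
  cases l with
  | nil => rw [splitSum_nil]
  | cons a l =>
    rw [splitSum_cons, splitSum_eq_zero_of_append, add_zero]
    exact fun x y hxy => h (a :: x) y (by simp [hxy]) (by simp)

end SplitSum

/-! ### The full differential evaluated on basic cocycles -/

section Classes

variable {𝕜 : Type u} [Field 𝕜] {N : ℕ}

/-- The sign relating evaluations on basic cocycles to functions in the bar complex. -/
def chi (ω : 𝕜) : List ℕ → 𝕜
  | [] => 1
  | k :: l => ω ^ (l.length * k) * chi ω l

theorem chi_cons (ω : 𝕜) (k : ℕ) (l : List ℕ) : chi ω (k :: l) = ω ^ (l.length * k) * chi ω l :=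
  rfl

theorem chi_mul_self {ω : 𝕜} (hω : ω * ω = 1) (K : List ℕ) : chi ω K * chi ω K = 1 := by
  induction K with
  | nil => exact one_mul 1
  | cons k l ih =>
    rw [chi_cons, mul_mul_mul_comm, ih, mul_one, ← mul_pow, hω, one_pow]

theorem insDiff_closed {A : AInfAlg 𝕜 N} {W : Type u} [AddCommGroup W] [Module 𝕜 W]
    {y : List A → W} (hy : IsMultilin 𝕜 y) {l : List A} (hl : ∀ a ∈ l, A.mu [a] = 0) :
    insDiff A y l = 0 := by
  induction l generalizing y with
  | nil => rfl
  | cons a l ih =>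
    rw [insDiff_cons, hl a (by simp), hy.head_zero, zero_add]
    exact ih (hy.tail _) fun b hb => hl b (by simp [hb])

variable [Fact (Even N)]

theorem sgn_natCast_mul (k : ℕ) (δ : ZMod N) : sgn 𝕜 ((k : ZMod N) * δ) = sgn 𝕜 δ ^ k := by
  induction k with
  | zero => simp [sgn_zero]
  | succ k ih => rw [Nat.cast_succ, add_mul, one_mul, sgn_add, ih, pow_succ]

variable {A : AInfAlg 𝕜 N} {δ : ZMod N}

/-- Operations on a graded vector space satisfying the first two `A∞`-module relations, for which
the basic cocycles act on the cohomology by the powers of an operator `q`. -/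
structure PolyMod (D : PolyBasis A δ) extends GVec 𝕜 N where
  mu : List A → carrier →ₗ[𝕜] carrier
  mu_mem : mu ∈ gDeg A toGVec toGVec 1
  mu_mu : ∀ m, mu [] (mu [] m) = 0
  mu_one : ∀ a m, mu [] (mu [a] m) + mu [a] (mu [] m) + mu [A.mu [a]] (toGVec.τ m) = 0
  i : CohOf (mu []) →ₗ[𝕜] carrier
  p : carrier →ₗ[𝕜] CohOf (mu [])
  mu_i : ∀ v, mu [] (i v) = 0
  p_i : ∀ v, p (i v) = v
  i_mem : ∀ g, ∀ v ∈ cohDeg toGVec (mu []) g, i v ∈ deg g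
  p_mem : ∀ g, ∀ x ∈ deg g, p x ∈ cohDeg toGVec (mu []) g
  p_mu : ∀ x, p (mu [] x) = 0
  exact : ∀ x, mu [] x = 0 → p x = 0 → ∃ y, x = mu [] y
  q : CohOf (mu []) →ₗ[𝕜] CohOf (mu [])
  q_mem : ∀ g, ∀ v ∈ cohDeg toGVec (mu []) g, q v ∈ cohDeg toGVec (mu []) (g + δ)
  q_spec : ∀ k x, mu [] x = 0 → p (mu [D.e k] (toGVec.σ x)) = (q ^ k) (p x)

variable {D : PolyBasis A δ}

namespace PolyMod

variable (P : PolyMod D)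

theorem mu_nil_mem (g : ZMod N) (x : P.carrier) (hx : x ∈ P.deg g) : P.mu [] x ∈ P.deg (g + 1) := by
  simpa using P.mu_mem.2 [] 0 RDeg.nil g x hx

theorem p_mu_e {g : ZMod N} {x : P.carrier} (hx : x ∈ P.deg g) (h : P.mu [] x = 0) (k : ℕ) :
    P.p (P.mu [D.e k] x) = sgn 𝕜 g • (P.q ^ k) (P.p x) := by
  have := P.q_spec k x h
  rw [P.σ_of_mem hx, map_smul, map_smul] at this
  rw [← this, smul_smul, sgn_mul_self, one_smul]

theorem mu_mu_e {x : P.carrier} (h : P.mu [] x = 0) (k : ℕ) : P.mu [] (P.mu [D.e k] x) = 0 := by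
  have := P.mu_one (D.e k) x
  have h0 : P.mu [0] = 0 := P.mu_mem.1.head_zero []
  rw [h, D.e_closed, h0] at this
  simpa using this

end PolyMod

/-- The full differential on functions of degree `j`. -/
noncomputable def fFull {P : GVec 𝕜 N} (μ : List A → P →ₗ[𝕜] P) (j : ZMod N) (y : List A → P)
    (l : List A) : P :=
  splitSum (fun x z => μ z (y x)) l + sgn 𝕜 j • insertSum A.τ A.mu y l

/-- Peeling off the first entry separates the operations that involve it from the full differential
of the curried function. This drives the induction in `p_fFull`. -/
theorem fFull_cons {P : GVec 𝕜 N} (μ : List A → P →ₗ[𝕜] P) (j : ZMod N) {y : List A → P}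
    (hy : IsMultilin 𝕜 y) {g : ZMod N} {a : A} (ha : a ∈ A.deg g) (l : List A) :
    fFull μ j y (a :: l) = μ (a :: l) (y []) + sgn 𝕜 j • splitSum (fun x z => y (A.mu (a :: x) :: z)) l
      + fFull μ (g + (j - 1)) (fun l => y (a :: l)) l := by
  have h1 : insertSum A.τ A.mu (fun l => y (A.τ a :: l)) l
      = sgn 𝕜 (g - 1) • insertSum A.τ A.mu (fun l => y (a :: l)) l := by
    rw [A.τ_of_mem ha]
    simp only [(hy.head _).map_smul]
    exact insertSum_map A.τ A.mu (sgn 𝕜 (g - 1) • (LinearMap.id : P →ₗ[𝕜] P)).toAddMonoidHom _ l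
  rw [fFull, fFull, splitSum_cons, insertSum_cons, splitSum_cons, A.mu_nil, hy.head_zero, h1,
    sgn_add_sub_one, sgn_sub_one]
  module

theorem mem_map_e {K : List ℕ} {a : A} (ha : a ∈ K.map D.e) : A.mu [a] = 0 := by
  obtain ⟨k, _, rfl⟩ := List.mem_map.1 ha
  exact D.e_closed k

theorem RDeg_map_e (D : PolyBasis A δ) (K : List ℕ) :
    RDeg A.toGVec (K.map D.e) ((K.sum : ZMod N) * δ - K.length) := by
  induction K with
  | nil => simpa using RDeg.nil
  | cons k K ih =>
    have := RDeg.cons (D.e_deg k) ih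
    rw [List.map_cons]
    convert this using 1
    simp only [List.sum_cons, List.length_cons]
    push_cast
    ring

/-- The full differential on the basic cocycles is given by the bar differential. -/
theorem p_fFull (P : PolyMod D) (d : ℕ) (j : ZMod N) (y : List A → P.carrier) (hy : IsMultilin 𝕜 y)
    (hyd : ∀ l r, RDeg A.toGVec l r → y l ∈ P.deg (r + j)) (hv : VanishBelow d y)
    (hc : ∀ l, l.length = d → fD (P.mu []) j y l = 0) (X : List ℕ → CohOf (P.mu []))
    (hX : ∀ K : List ℕ, K.length = d → chi (sgn 𝕜 δ) K • P.p (y (K.map D.e)) = X K)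
    (K : List ℕ) (hK : K.length = d + 1) :
    chi (sgn 𝕜 δ) K • P.p (fFull P.mu j y (K.map D.e)) = sgn 𝕜 j • barR P.q X K := by
  have hω : sgn 𝕜 δ * sgn 𝕜 δ = 1 := sgn_mul_self 𝕜 δ
  have hωk : ∀ k : ℕ, sgn 𝕜 δ ^ k * sgn 𝕜 δ ^ k = 1 := fun k => by
    rw [← mul_pow, hω, one_pow]
  induction d generalizing j y X K with
  | zero =>
    match K, hK with
    | [a], _ =>
      have h1 : fFull P.mu (a * δ + (j - 1)) (fun l => y (D.e a :: l)) [] = P.mu [] (y [D.e a]) := by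
        have : y [D.e a, 0] = 0 := hy.map_zero [D.e a] []
        rw [fFull, splitSum_nil, insertSum_nil, A.mu_nil, this, smul_zero, add_zero]
      have h2 : P.mu [] (y []) = 0 := by
        have := hc [] rfl
        rwa [fD_apply, insDiff_nil, smul_zero, add_zero] at this
      have h3 : y [] ∈ P.deg j := by simpa using hyd [] 0 RDeg.nil
      rw [List.map_cons, List.map_nil, fFull_cons P.mu j hy (D.e_deg a), h1, splitSum_nil,
        D.e_closed, hy.head_zero, smul_zero, add_zero, map_add, P.p_mu, add_zero,
        P.p_mu_e h3 h2, barR_singleton, ← hX [] rfl]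
      simp [chi]
  | succ d ih =>
    match K, hK with
    | a :: b :: l, hK =>
      have hl : l.length = d := by simpa using hK
      -- The entry `e a` is closed, and products of three or more entries leave a list of length at
      -- most `d`, where `y` vanishes. Only the binary product survives.
      have h1 : splitSum (fun x z => y (A.mu (D.e a :: x) :: z)) ((b :: l).map D.e)
          = y (A.mu [D.e a, D.e b] :: l.map D.e) := by
        rw [List.map_cons, splitSum_cons, D.e_closed, hy.head_zero, zero_add]
        refine splitSum_eq_first fun x z hxz hx => hv _ ?_
        have := congrArg List.length hxz
        rw [List.length_append, List.length_map, hl] at this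
        have := List.length_pos_of_ne_nil hx
        simp only [List.length_cons]
        omega
      obtain ⟨c, hc'⟩ := D.e_mul a b
      -- The product of two basic cocycles is a basic cocycle only up to a coboundary. The
      -- coboundary does not contribute to the class, since `y` is closed for the leading
      -- differential and the other entries are closed.
      have h2 : P.p (y (A.mu [c] :: l.map D.e)) = 0 := by
        have := hc (c :: l.map D.e) (by simp [hl])
        rw [fD_apply, insDiff_cons, insDiff_closed (hy.tail _) fun a ha => mem_map_e ha,
          add_zero] at this
        have := congrArg (sgn 𝕜 j • P.p) this
        simp only [LinearMap.smul_apply, map_add, P.p_mu, map_smul, smul_smul, sgn_mul_self,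
          smul_zero, zero_add, one_smul, map_zero] at this
        exact this
      -- The induction hypothesis for the curried function; the power of `sgn 𝕜 δ` is the factor of
      -- `chi` contributed by the entry `a`.
      have h3 := ih (a * δ + (j - 1)) (fun l => y (D.e a :: l)) (hy.tail _) (fun l r hl => by
          have := hyd _ _ (RDeg.cons (D.e_deg a) hl)
          rwa [show a * δ - 1 + r + j = r + (a * δ + (j - 1)) by ring] at this)
        (fun l hl => hv _ (by simpa using hl))
        (fun l hl => by
          have := hc (D.e a :: l) (by simp [hl])
          rwa [fD_cons _ hy (D.e_deg a), D.e_closed, hy.head_zero, smul_zero, add_zero] at this)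
        (fun K => sgn 𝕜 δ ^ (d * a) • X (a :: K)) (fun K hK => by
          rw [← hX (a :: K) (by simp [hK]), chi_cons, hK, smul_smul, ← mul_assoc, hωk, one_mul]
          rfl) (b :: l) (by simp [hl])
      have h4 := hX ((a + b) :: l) (by simp [hl])
      rw [chi_cons, hl] at h4
      rw [List.map_cons, fFull_cons P.mu j hy (D.e_deg a), h1, hv [] (by simp), map_zero, zero_add,
        hc', (hy.head _).map_add, (hy.head _).map_smul, map_add, map_smul, map_add, h2, add_zero,
        map_smul, barR_cons_cons, ← h4, chi_cons]
      rw [barR_smul, sgn_add_sub_one, sgn_natCast_mul] at h3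
      rw [smul_add, mul_smul (sgn 𝕜 δ ^ _) (chi _ _) (P.p (fFull _ _ _ _)), h3, smul_smul, smul_smul,
        smul_smul, smul_sub, sub_eq_add_neg, chi_cons, sgn_natCast_mul, List.length_cons, hl]
      congr 1
      · rw [List.map_cons, smul_smul]
        refine congrArg (fun c : 𝕜 => c • P.p (y (D.e (a + b) :: l.map D.e))) ?_
        have e : sgn 𝕜 δ ^ ((d + 1) * a) * sgn 𝕜 δ ^ (d * b) * sgn 𝕜 δ ^ a
            = sgn 𝕜 δ ^ (d * (a + b)) * (sgn 𝕜 δ ^ a * sgn 𝕜 δ ^ a) := by ring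
        rw [hωk, mul_one] at e
        linear_combination sgn 𝕜 j * chi (sgn 𝕜 δ) l * e
      · rw [smul_smul, ← neg_smul]
        refine congrArg (fun c : 𝕜 => c • barR P.q (fun l => X (a :: l)) (b :: l)) ?_
        have e : sgn 𝕜 δ ^ ((d + 1) * a) * sgn 𝕜 δ ^ a * sgn 𝕜 δ ^ (d * a)
            = sgn 𝕜 δ ^ ((d + 1) * a) * sgn 𝕜 δ ^ ((d + 1) * a) := by ring
        rw [hωk] at e
        linear_combination -sgn 𝕜 j * e

end Classes

end AInf

namespace AInf

set_option linter.unusedSectionVars false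

/-! ### Leading terms of families, and their classes in the bar complex -/

section Step

variable {𝕜 : Type u} [Field 𝕜] {N : ℕ} {A : AInfAlg 𝕜 N} {δ : ZMod N}

section Families

variable {M P : GVec 𝕜 N}

/-- In the lowest length where `t` may be nonzero, every term other than the differentials of `M`,
`P` and `A` evaluates `t` on a shorter list. -/
theorem gD_eq_gE {μ : List A → M →ₗ[𝕜] M} {ν : List A → P →ₗ[𝕜] P} (k : ZMod N)
    {t : List A → M →ₗ[𝕜] P} (ht : IsMultilin 𝕜 t) {l : List A} (hv : VanishBelow l.length t) :
    gD μ ν k t l = gE (ν []) (μ []) k t l := by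
  have h1 : gComp A M P P ν t l = ν [] ∘ₗ t l := by
    rw [gComp_apply]
    refine splitSum_eq_last fun x y hxy hy => ?_
    have := List.length_pos_of_ne_nil hy
    rw [hv x (by rw [← hxy, List.length_append]; omega), LinearMap.comp_zero]
  have h2 : gComp A M M P t μ l = t l ∘ₗ μ [] := by
    rw [gComp_apply]
    refine splitSum_eq_first fun x y hxy hx => ?_
    have := List.length_pos_of_ne_nil hx
    rw [hv y (by rw [← hxy, List.length_append]; omega), LinearMap.zero_comp]
  rw [gD_apply, Pi.sub_apply, Pi.smul_apply, Pi.add_apply, h1, h2, gIns_apply,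
    insertSum_eq_insDiff ht hv]
  rfl

theorem gComp_congr {Q : GVec 𝕜 N} {t t' : List A → P →ₗ[𝕜] Q} {s s' : List A → M →ₗ[𝕜] P}
    {l : List A} (ht : ∀ x, x.length ≤ l.length → t x = t' x)
    (hs : ∀ x, x.length ≤ l.length → s x = s' x) : gComp A M P Q t s l = gComp A M P Q t' s' l := by
  rw [gComp_apply, gComp_apply]
  refine splitSum_congr fun x y hxy => ?_
  rw [ht y (by simp [← hxy]), hs x (by simp [← hxy])]

theorem insertSum_congr {y z : List A → M →ₗ[𝕜] P} (hy : IsMultilin 𝕜 y) (hz : IsMultilin 𝕜 z)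
    {l : List A} (h : ∀ x, x.length ≤ l.length → y x = z x) :
    insertSum A.τ A.mu y l = insertSum A.τ A.mu z l := by
  rw [insertSum, insertSum]
  refine splitSum_congr fun x w hxw => splitSum_congr fun v u hvu => ?_
  cases v with
  | nil => rw [A.mu_nil, hy.map_zero, hz.map_zero]
  | cons a v =>
    refine h _ ?_
    simp only [← hxw, ← hvu, List.length_append, List.length_map, List.length_cons]
    omega

theorem gD_congr {μ : List A → M →ₗ[𝕜] M} {ν : List A → P →ₗ[𝕜] P} {k : ZMod N}
    {s t : List A → M →ₗ[𝕜] P} (hs : IsMultilin 𝕜 s) (ht : IsMultilin 𝕜 t) {l : List A}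
    (h : ∀ x, x.length ≤ l.length → s x = t x) : gD μ ν k s l = gD μ ν k t l := by
  simp only [gD_apply, Pi.sub_apply, Pi.smul_apply, Pi.add_apply, gIns_apply]
  rw [gComp_congr (fun _ _ => rfl) h, gComp_congr h fun _ _ => rfl, insertSum_congr hs ht h]

theorem gD_vanishBelow {μ : List A → M →ₗ[𝕜] M} {ν : List A → P →ₗ[𝕜] P} {k : ZMod N}
    {d : ℕ} {t : List A → M →ₗ[𝕜] P} (ht : IsMultilin 𝕜 t) (hv : VanishBelow d t) :
    VanishBelow d (gD μ ν k t) := by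
  intro l hl
  have : gD μ ν k t l = gD μ ν k 0 l :=
    gD_congr ht isMultilin_zero fun x hx => hv x (hx.trans_lt hl)
  rw [this, map_zero]
  rfl

theorem gComp_vanishBelow {Q : GVec 𝕜 N} {a b : ℕ} {t : List A → P →ₗ[𝕜] Q}
    {s : List A → M →ₗ[𝕜] P} (ht : VanishBelow a t) (hs : VanishBelow b s) :
    VanishBelow (a + b) (gComp A M P Q t s) := by
  intro l hl
  rw [gComp_apply]
  refine splitSum_eq_zero_of_append fun x y hxy => ?_
  have := congrArg List.length hxy
  rw [List.length_append] at this
  by_cases h : x.length < b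
  · rw [hs x h, LinearMap.comp_zero]
  · rw [ht y (by omega), LinearMap.zero_comp]

end Families

section Representation

variable {M P : Type u} [AddCommGroup M] [Module 𝕜 M] [AddCommGroup P] [Module 𝕜 P]
  {W : Type u} [AddCommGroup W] [Module 𝕜 W]

/-- The multilinear function with prescribed values on the basic cocycles. -/
noncomputable def repr (D : PolyBasis A δ) : (List ℕ → W) → List A → W
  | Z, [] => Z []
  | Z, a :: l => Finsupp.linearCombination 𝕜 (fun k => repr D (fun K => Z (k :: K)) l) (D.P a)

variable (D : PolyBasis A δ)

theorem repr_cons (Z : List ℕ → W) (a : A) (l : List A) :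
    repr D Z (a :: l)
      = Finsupp.linearCombination 𝕜 (fun k => repr D (fun K => Z (k :: K)) l) (D.P a) := rfl

theorem repr_map_e (Z : List ℕ → W) (K : List ℕ) : repr D Z (K.map D.e) = Z K := by
  induction K generalizing Z with
  | nil => rfl
  | cons k K ih => rw [List.map_cons, repr_cons, D.P_e, Finsupp.linearCombination_single, ih, one_smul]

theorem isMultilin_repr (Z : List ℕ → W) : IsMultilin 𝕜 (repr D Z) := by
  intro x z
  induction x generalizing Z with
  | nil =>
    exact ⟨fun a b => by simp only [List.nil_append, repr_cons, map_add],
      fun c a => by simp only [List.nil_append, repr_cons, map_smul]⟩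
  | cons b x ih =>
    refine ⟨fun a a' => ?_, fun c a => ?_⟩
    · simp only [List.cons_append, repr_cons, (ih _).map_add, Finsupp.linearCombination_apply,
        smul_add, Finsupp.sum_add]
    · simp only [List.cons_append, repr_cons, (ih _).map_smul, Finsupp.linearCombination_apply,
        smul_comm _ c, Finsupp.smul_sum]

theorem repr_eq_zero {W' : Type u} [AddCommGroup W'] [Module 𝕜 W'] (φ : W →ₗ[𝕜] W')
    (Z : List ℕ → W) (hZ : ∀ K, φ (Z K) = 0) (l : List A) : φ (repr D Z l) = 0 := by
  induction l generalizing Z with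
  | nil => exact hZ []
  | cons a l ih =>
    rw [repr_cons, Finsupp.linearCombination_apply, map_finsuppSum]
    refine Finset.sum_eq_zero fun k _ => ?_
    simp only [map_smul, ih _ fun K => hZ (k :: K), smul_zero]

theorem suppLen_repr {d : ℕ} {Z : List ℕ → W} (hZ : SuppLen d Z) : SuppLen d (repr D Z) := by
  intro l hl
  induction l generalizing Z d with
  | nil => exact hZ [] hl
  | cons a l ih =>
    rw [repr_cons, Finsupp.linearCombination_apply]
    refine Finset.sum_eq_zero fun k _ => ?_
    cases d with
    | zero =>
      have : (fun K => Z (k :: K)) = fun _ => 0 := funext fun K => hZ _ (by simp)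
      have h0 := repr_eq_zero D (LinearMap.id : W →ₗ[𝕜] W) (fun _ => 0) (fun _ => rfl) l
      simp only [this]
      rw [show repr D (fun _ => (0 : W)) l = 0 from h0]
      exact smul_zero _
    | succ d =>
      simp only
      rw [ih (d := d) (fun K hK => hZ _ (by simpa using hK)) (by simpa using hl), smul_zero]

/-- `D.P` kills coboundaries, so inserting the differential at any place gives zero. -/
theorem insDiff_repr (Z : List ℕ → W) (l : List A) : insDiff A (repr D Z) l = 0 := by
  induction l generalizing Z with
  | nil => rfl
  | cons a l ih =>
    rw [insDiff_cons, repr_cons, D.P_diff, map_zero, zero_add]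
    have : ∀ (s : Finset ℕ) (c : ℕ → 𝕜) (y : ℕ → List A → W), (∀ k, insDiff A (y k) l = 0) →
        insDiff A (fun l => ∑ k ∈ s, c k • y k l) l = 0 := by
      intro s c y hy
      induction s using Finset.cons_induction with
      | empty => exact insDiff_zero l
      | cons j s hj ih =>
        simp only [Finset.sum_cons, insDiff_add, ih, insDiff_smul, hy, smul_zero, add_zero]
    exact this _ _ _ fun k => ih _

end Representation

variable {D : PolyBasis A δ}

/-- Only indices `k` with `k δ = |a|` occur in `D.P a`, so the degree counted on entries agrees with
the degree counted on monomials. -/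
theorem repr_mem {M P : GVec 𝕜 N} {Z : List ℕ → M →ₗ[𝕜] P} {k : ZMod N}
    (hZ : BarDeg δ M.deg P.deg k Z) : repr D Z ∈ gDeg A M P k := by
  refine ⟨isMultilin_repr D Z, fun l r hl g m hm => ?_⟩
  induction hl generalizing Z k with
  | nil => simpa [repr] using hZ [] g m hm
  | @cons a l g' r ha hl ih =>
    rw [repr_cons, Finsupp.linearCombination_apply, Finsupp.sum, LinearMap.sum_apply]
    refine Submodule.sum_mem _ fun j hj => ?_
    have hj' := D.P_deg g' a ha j (Finsupp.mem_support_iff.1 hj)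
    rw [LinearMap.smul_apply]
    refine Submodule.smul_mem _ _ ?_
    have := ih (Z := fun K => Z (j :: K)) (k := k + (j * δ - 1)) fun K g v hv => by
      have := hZ (j :: K) g v hv
      convert this using 2
      simp only [List.sum_cons, List.length_cons]
      push_cast
      ring
    convert this using 2
    rw [← hj']
    ring

variable [Fact (Even N)]

theorem σ_pow_of_mem {V : GVec 𝕜 N} {g : ZMod N} {x : V} (hx : x ∈ V.deg g) (d : ℕ) :
    (V.σ ^ d) x = sgn 𝕜 g ^ d • x := by
  induction d with
  | zero => simp
  | succ d ih => rw [pow_succ', Module.End.mul_apply, ih, map_smul, V.σ_of_mem hx, smul_smul, pow_succ]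

variable {M P : PolyMod D}

/-- `X` describes the values in cohomology of `t` on the lists of length `d`. -/
def Represents (M P : PolyMod D) (d : ℕ) (t : List A → M.carrier →ₗ[𝕜] P.carrier)
    (X : List ℕ → CohOf (M.mu []) →ₗ[𝕜] CohOf (P.mu [])) : Prop :=
  ∀ K : List ℕ, K.length = d → ∀ g, ∀ m ∈ M.deg g, M.mu [] m = 0 →
    chi (sgn 𝕜 δ) K • P.p (t (K.map D.e) m) = sgn 𝕜 g ^ d • X K (M.p m)

theorem gE_map_e {k : ZMod N} {t : List A → M.carrier →ₗ[𝕜] P.carrier} (ht : IsMultilin 𝕜 t)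
    {K : List ℕ} (hc : gE (P.mu []) (M.mu []) k t (K.map D.e) = 0) (m : M.carrier) :
    P.mu [] (t (K.map D.e) m) = sgn 𝕜 k • t (K.map D.e) (M.mu [] m) := by
  have h := LinearMap.congr_fun hc m
  rw [gE, insDiff_closed ht fun a ha => mem_map_e ha] at h
  simpa [sub_eq_zero] using h

/-- The operations of the target and of the algebra contribute through `p_fFull`. Of the operations
of the source only the action of the first entry is left, because `m` is a cocycle and `t` vanishes
on shorter lists. Together these are the bar differential on classes, up to sign. -/
theorem represents_gD {d : ℕ} {k : ZMod N} {t : List A → M.carrier →ₗ[𝕜] P.carrier}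
    (ht : t ∈ gDeg A M.toGVec P.toGVec k) (hv : VanishBelow d t)
    (hc : ∀ l, l.length = d → gE (P.mu []) (M.mu []) k t l = 0)
    {X : List ℕ → CohOf (M.mu []) →ₗ[𝕜] CohOf (P.mu [])} (hX : Represents M P d t X)
    (K : List ℕ) (hK : K.length = d + 1) (g : ZMod N) (m : M.carrier) (hm : m ∈ M.deg g)
    (hdm : M.mu [] m = 0) :
    chi (sgn 𝕜 δ) K • P.p (gD M.mu P.mu k t (K.map D.e) m)
      = (sgn 𝕜 g ^ (d + 1) * sgn 𝕜 k) • barD P.q M.q X K (M.p m) := by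
  match K, hK with
  | a :: l, hK =>
    have hl : l.length = d := by simpa using hK
    have hgd : ∀ g : ZMod N, sgn 𝕜 g ^ d * sgn 𝕜 g ^ d = 1 := fun g => by
      rw [← mul_pow, sgn_mul_self, one_pow]
    have hω : sgn 𝕜 δ ^ (d * a) * sgn 𝕜 δ ^ (d * a) = 1 := by
      rw [← mul_pow, sgn_mul_self, one_pow]
    -- the contribution of the operations of the target and of the algebra
    have h1 := p_fFull P d (g + k) (fun l => t l m)
      (fun x z => ⟨fun a b => LinearMap.congr_fun ((ht.1 x z).map_add a b) m,
        fun c a => LinearMap.congr_fun ((ht.1 x z).map_smul c a) m⟩)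
      (fun l r hl => by
        have := ht.2 l r hl g m hm
        rwa [show g + r + k = r + (g + k) by ring] at this)
      (fun l hl => LinearMap.congr_fun (hv l hl) m)
      (fun l hl => by
        have := LinearMap.congr_fun (hc l hl) m
        rw [gE_apply _ _ _ _ hm, hdm, map_zero, smul_zero, sub_zero] at this
        exact this)
      (fun K => sgn 𝕜 g ^ d • X K (M.p m)) (fun K hK => hX K hK g m hm hdm) (a :: l) hK
    rw [barR_smul] at h1
    -- the contribution of the operations of the source
    have hm' : M.mu [D.e a] m ∈ M.deg (g + a * δ) := by
      have := M.mu_mem.2 _ _ (RDeg.singleton (D.e_deg a)) g m hm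
      rwa [show g + (a * δ - 1) + 1 = g + a * δ by ring] at this
    have h2 := hX l hl _ _ hm' (M.mu_mu_e hdm a)
    rw [M.p_mu_e hm hdm, map_smul] at h2
    have h3 : gComp A M.toGVec M.toGVec P.toGVec t M.mu ((a :: l).map D.e) m
        = t (l.map D.e) (M.mu [D.e a] m) := by
      rw [gComp_apply, splitSum_linearMap_apply, List.map_cons, splitSum_cons,
        LinearMap.comp_apply, hdm, map_zero, zero_add]
      refine splitSum_eq_first fun x y hxy hx => ?_
      have := congrArg List.length hxy
      rw [List.length_append, List.length_map, hl] at this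
      have := List.length_pos_of_ne_nil hx
      rw [hv y (by omega)]
      rfl
    have h4 : gD M.mu P.mu k t ((a :: l).map D.e) m
        = fFull P.mu (g + k) (fun l => t l m) ((a :: l).map D.e)
          - sgn 𝕜 k • t (l.map D.e) (M.mu [D.e a] m) := by
      rw [gD_apply, Pi.sub_apply, Pi.smul_apply, Pi.add_apply, LinearMap.sub_apply,
        LinearMap.smul_apply, LinearMap.add_apply, h3, gComp_apply, splitSum_linearMap_apply,
        gIns_apply, LinearMap.comp_apply, insertSum_linearMap_apply, M.τ_of_mem hm, fFull,
        sgn_sub_one, sgn_add]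
      simp only [map_smul]
      have h5 : insertSum A.τ A.mu (fun l => -sgn 𝕜 g • t l m) ((a :: l).map D.e)
          = -sgn 𝕜 g • insertSum A.τ A.mu (fun l => t l m) ((a :: l).map D.e) :=
        insertSum_map A.τ A.mu (-sgn 𝕜 g • (LinearMap.id : P.carrier →ₗ[𝕜] P.carrier)).toAddMonoidHom
          _ _
      rw [h5]
      simp only [LinearMap.comp_apply]
      module
    rw [h4, map_sub, smul_sub, h1, map_smul, barD_cons, smul_sub, smul_smul, chi_cons, hl,
      smul_comm _ (sgn 𝕜 k), mul_smul (sgn 𝕜 δ ^ (d * a)), h2, sgn_add, sgn_add, smul_smul, smul_smul, smul_smul,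
      sgn_natCast_mul]
    refine congrArg₂ (· - ·) (congrArg (fun c : 𝕜 => c • barR P.q (fun K => X K (M.p m)) (a :: l)) ?_)
      (congrArg (fun c : 𝕜 => c • X l ((M.q ^ a) (M.p m))) ?_)
    · ring
    · have e : (sgn 𝕜 δ ^ a) ^ d = sgn 𝕜 δ ^ (d * a) := by rw [← pow_mul, mul_comm]
      rw [mul_pow, e]
      linear_combination sgn 𝕜 g ^ (d + 1) * sgn 𝕜 k * hω

/-- On basic cocycles the leading differential reduces to the differentials of `M` and `P`, so `t`
commutes with these up to sign and descends to cohomology. The factors `chi` and `M.σ ^ d` are the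
Koszul signs that turn the result into a bar cochain. -/
theorem exists_represents {d : ℕ} {k : ZMod N} {t : List A → M.carrier →ₗ[𝕜] P.carrier}
    (ht : t ∈ gDeg A M.toGVec P.toGVec k)
    (hc : ∀ l, l.length = d → gE (P.mu []) (M.mu []) k t l = 0) :
    ∃ X, Represents M P d t X ∧
      BarDeg δ (cohDeg M.toGVec (M.mu [])) (cohDeg P.toGVec (P.mu [])) k X ∧
      ∀ K : List ℕ, t (K.map D.e) = 0 → X K = 0 := by
  refine ⟨fun K => chi (sgn 𝕜 δ) K • (P.p ∘ₗ t (K.map D.e) ∘ₗ (M.σ ^ d) ∘ₗ M.i), ?_, ?_, ?_⟩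
  · intro K hK g m hm hdm
    have hi : M.i (M.p m) ∈ M.deg g := M.i_mem g _ (M.p_mem g m hm)
    obtain ⟨b, hb⟩ := M.exact (m - M.i (M.p m)) (by rw [map_sub, hdm, M.mu_i, sub_zero])
      (by rw [map_sub, M.p_i, sub_self])
    -- Independence of the representative: coboundaries of `M` go to coboundaries of `P`.
    have h1 : P.p (t (K.map D.e) (M.mu [] b)) = 0 := by
      have := gE_map_e ht.1 (hc (K.map D.e) (by simpa using hK)) b
      have := congrArg (sgn 𝕜 k • P.p) this
      simp only [LinearMap.smul_apply, P.p_mu, map_smul, smul_smul, sgn_mul_self, smul_zero,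
        one_smul] at this
      exact this.symm
    have h2 : P.p (t (K.map D.e) m) = P.p (t (K.map D.e) (M.i (M.p m))) := by
      rw [← sub_eq_zero, ← map_sub, ← map_sub, hb, h1]
    simp only [LinearMap.smul_apply, LinearMap.comp_apply, σ_pow_of_mem hi, map_smul, h2]
    rw [smul_comm (sgn 𝕜 g ^ d), smul_smul (sgn 𝕜 g ^ d), ← mul_pow, sgn_mul_self, one_pow, one_smul]
  · intro K g v hv
    have hi : M.i v ∈ M.deg g := M.i_mem g _ hv
    refine Submodule.smul_mem _ _ (P.p_mem _ _ ?_)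
    rw [LinearMap.comp_apply, LinearMap.comp_apply, σ_pow_of_mem hi, map_smul]
    exact Submodule.smul_mem _ _ (ht.2 _ _ (RDeg_map_e D K) g _ hi)
  · intro K hK
    simp [hK]

/-- Compose `X` with representatives in the target and the projection in the source, and extend by
`repr`. The terms of the leading differential vanish separately: representatives are closed, and
both the projection of the source and `D.P` kill coboundaries. -/
theorem exists_of_represents {d : ℕ} {k : ZMod N}
    {X : List ℕ → CohOf (M.mu []) →ₗ[𝕜] CohOf (P.mu [])} (hX : SuppLen d X)
    (hXd : BarDeg δ (cohDeg M.toGVec (M.mu [])) (cohDeg P.toGVec (P.mu [])) k X) :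
    ∃ t ∈ gDeg A M.toGVec P.toGVec k, SuppLen d t ∧ (∀ l, gE (P.mu []) (M.mu []) k t l = 0) ∧
      Represents M P d t X ∧ ∀ K : List ℕ, X K = 0 → t (K.map D.e) = 0 := by
  let Z : List ℕ → M.carrier →ₗ[𝕜] P.carrier := fun K =>
    chi (sgn 𝕜 δ) K • (P.i ∘ₗ X K ∘ₗ M.p ∘ₗ (M.σ ^ d))
  have hZ0 : ∀ K, X K = 0 → Z K = 0 := fun K hK => by simp [Z, hK]
  have h1 : ∀ l, P.mu [] ∘ₗ repr D Z l = 0 :=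
    repr_eq_zero D (LinearMap.llcomp 𝕜 _ _ _ (P.mu [])) Z fun K => by
      ext x
      simp [Z, P.mu_i]
  have h2 : ∀ l, repr D Z l ∘ₗ M.mu [] = 0 :=
    repr_eq_zero D (LinearMap.lcomp 𝕜 _ (M.mu [])) Z fun K => by
      refine M.hom_ext fun g x hx => ?_
      simp [Z, σ_pow_of_mem (M.mu_nil_mem g x hx), M.p_mu]
  refine ⟨repr D Z, repr_mem fun K g m hm => ?_, suppLen_repr D fun K hK => hZ0 K (hX K hK),
    fun l => ?_, fun K hK g m hm hdm => ?_, fun K hK => ?_⟩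
  · refine Submodule.smul_mem _ _ (P.i_mem _ _ (hXd K g _ (M.p_mem g _ ?_)))
    rw [σ_pow_of_mem hm]
    exact Submodule.smul_mem _ _ hm
  · rw [gE, h1, h2, insDiff_repr, LinearMap.zero_comp, add_zero, smul_zero, sub_zero]
  · rw [repr_map_e]
    simp only [Z, LinearMap.smul_apply, LinearMap.comp_apply, σ_pow_of_mem hm, map_smul, P.p_i]
    rw [smul_smul, chi_mul_self (sgn_mul_self 𝕜 δ), one_smul]
  · rw [repr_map_e, hZ0 K hK]

end Step

end AInf

namespace AInf

set_option linter.unusedSectionVars false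

/-! ### Successive approximation along the number of entries -/

section Step

variable {𝕜 : Type u} [Field 𝕜] {N : ℕ} {A : AInfAlg 𝕜 N} {δ : ZMod N}

/-- Linearity in one entry compares only lists of equal length, so the function may be chosen
according to the length. This serves for truncations and for limits. -/
theorem IsMultilin.of_length {V : Type u} [AddCommGroup V] [Module 𝕜 V] {F : ℕ → List A → V}
    (h : ∀ n, IsMultilin 𝕜 (F n)) : IsMultilin 𝕜 fun l => F l.length l := fun x y =>
  ⟨fun a b => by simpa using (h (x.length + (y.length + 1)) x y).map_add a b,
    fun c a => by simpa using (h (x.length + (y.length + 1)) x y).map_smul c a⟩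

theorem gDeg_of_length {M P : GVec 𝕜 N} {k : ZMod N} {F : ℕ → List A → M →ₗ[𝕜] P}
    (h : ∀ n, F n ∈ gDeg A M P k) : (fun l => F l.length l) ∈ gDeg A M P k :=
  ⟨IsMultilin.of_length fun n => (h n).1, fun l => (h l.length).2 l⟩

theorem VanishBelow.mono {α : Type u} {W : Type v} [Zero W] {d e : ℕ} {y : List α → W}
    (h : VanishBelow d y) (hed : e ≤ d) : VanishBelow e y := fun l hl => h l (hl.trans_le hed)

theorem VanishBelow.add {α : Type u} {W : Type v} [AddCommGroup W] {d : ℕ} {y z : List α → W}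
    (hy : VanishBelow d y) (hz : VanishBelow d z) : VanishBelow d (y + z) := fun l hl => by
  rw [Pi.add_apply, hy l hl, hz l hl, add_zero]

theorem VanishBelow.sub {α : Type u} {W : Type v} [AddCommGroup W] {d : ℕ} {y z : List α → W}
    (hy : VanishBelow d y) (hz : VanishBelow d z) : VanishBelow d (y - z) := fun l hl => by
  rw [Pi.sub_apply, hy l hl, hz l hl, sub_zero]

theorem VanishBelow.succ {α : Type u} {W : Type v} [Zero W] {d : ℕ} {y : List α → W}
    (hy : VanishBelow d y) (h : ∀ l, l.length = d → y l = 0) : VanishBelow (d + 1) y := fun l hl =>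
  (Nat.lt_succ_iff_lt_or_eq.1 hl).elim (hy l) (h l)

/-- Dependent choice with corrections in ever longer lists. The value on a fixed list becomes
constant, which makes a limit possible without any convergence argument. -/
theorem exists_stable_seq {α : Type u} {W : Type v} [AddCommGroup W]
    (G : ℕ → (List α → W) → Prop) {s₀ : List α → W} (h₀ : G 0 s₀)
    (h : ∀ n s, G n s → ∃ s', G (n + 1) s' ∧ VanishBelow n (s' - s)) :
    ∃ s : ℕ → List α → W, (∀ n, G n (s n)) ∧ ∀ n m l, l.length < n → n ≤ m → s m l = s n l := by
  have h' : ∀ n (s : {s // G n s}), ∃ s' : {s // G (n + 1) s}, VanishBelow n (s'.1 - s.1) :=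
    fun n s => by
      obtain ⟨s', h1, h2⟩ := h n s.1 s.2
      exact ⟨⟨s', h1⟩, h2⟩
  choose next hnext using h'
  let s : ∀ n, {s // G n s} := fun n => Nat.rec ⟨s₀, h₀⟩ next n
  refine ⟨fun n => (s n).1, fun n => (s n).2, fun n m l hl hnm => ?_⟩
  induction m, hnm using Nat.le_induction with
  | base => rfl
  | succ m hnm ih => exact (sub_eq_zero.1 (hnext m (s m) l (hl.trans_le hnm))).trans ih

variable {D : PolyBasis A δ} [Fact (Even N)]

theorem gDeg_gD_pred {M P : GVec 𝕜 N} {k : ZMod N} {μ : List A → M →ₗ[𝕜] M}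
    {ν : List A → P →ₗ[𝕜] P} (hμ : μ ∈ gDeg A M M 1) (hν : ν ∈ gDeg A P P 1)
    {s : List A → M →ₗ[𝕜] P} (hs : s ∈ gDeg A M P (k - 1)) :
    gD μ ν (k - 1) s ∈ gDeg A M P k := by
  have := gDeg_gD hμ hν hs
  rwa [sub_add_cancel] at this

variable {M P : PolyMod D}

theorem PolyMod.curv_vanishBelow (M : PolyMod D) : VanishBelow 2 (curv M.mu) := by
  intro l hl
  have h0 : ∀ x y, M.mu (x ++ 0 :: y) = 0 := fun x y => M.mu_mem.1.map_zero x y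
  match l, hl with
  | [], _ =>
    refine LinearMap.ext fun m => ?_
    have e := h0 [] []
    rw [List.nil_append] at e
    simp [curv, gComp_apply, gIns_apply, splitSum_nil, insertSum_nil, A.mu_nil, e, M.mu_mu]
  | [a], _ =>
    refine LinearMap.ext fun m => ?_
    have e1 := h0 [] [a]
    have e2 := h0 [A.τ a] []
    rw [List.nil_append] at e1
    simp only [List.cons_append, List.nil_append] at e2
    simp only [curv, gComp_apply, gIns_apply, insertSum_cons, insertSum_nil, splitSum_cons,
      splitSum_nil, A.mu_nil, e1, e2, Pi.add_apply, LinearMap.add_apply, LinearMap.comp_apply,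
      LinearMap.zero_apply]
    refine Eq.trans ?_ (M.mu_one a m)
    abel

theorem gE_congr {k : ZMod N} {M P : GVec 𝕜 N} (dP : P →ₗ[𝕜] P) (dM : M →ₗ[𝕜] M)
    {s t : List A → M →ₗ[𝕜] P} {l : List A} (h : ∀ x, x.length = l.length → s x = t x) :
    gE dP dM k s l = gE dP dM k t l := by
  rw [gE, gE, h l rfl, insDiff_congr l h]

theorem gE_zero {k : ZMod N} {M P : GVec 𝕜 N} (dP : P →ₗ[𝕜] P) (dM : M →ₗ[𝕜] M) (l : List A) :
    gE dP dM k (0 : List A → M →ₗ[𝕜] P) l = 0 := by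
  have : insDiff A (0 : List A → M →ₗ[𝕜] P) l = 0 := insDiff_zero l
  rw [gE, this]
  simp

theorem gE_eq_zero_of_gD {d : ℕ} {k : ZMod N} {t : List A → M.carrier →ₗ[𝕜] P.carrier}
    (ht : IsMultilin 𝕜 t) (hv : VanishBelow d t) (hd : VanishBelow (d + 1) (gD M.mu P.mu k t))
    (l : List A) (hl : l.length = d) : gE (P.mu []) (M.mu []) k t l = 0 := by
  subst hl
  rw [← gD_eq_gE k ht hv]
  exact hd l (Nat.lt_succ_self _)

/-- When the classes on basic cocycles vanish, the values there on cocycles are coboundaries, and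
`exists_gE_eq` applies to the part of `t` in length `d`. Subtracting the differential of the result
moves `t` up by one length. -/
theorem exists_step_of_class_eq_zero {d : ℕ} {k : ZMod N}
    {t : List A → M.carrier →ₗ[𝕜] P.carrier} (ht : t ∈ gDeg A M.toGVec P.toGVec k)
    (hv : VanishBelow d t) (hd : VanishBelow (d + 1) (gD M.mu P.mu k t))
    (hp : ∀ K : List ℕ, K.length = d → ∀ g, ∀ m ∈ M.deg g, M.mu [] m = 0 →
      P.p (t (K.map D.e) m) = 0) :
    ∃ s ∈ gDeg A M.toGVec P.toGVec (k - 1), SuppLen d s ∧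
      (∀ l, l.length = d → gE (P.mu []) (M.mu []) (k - 1) s l = t l) ∧
      VanishBelow (d + 1) (t - gD M.mu P.mu (k - 1) s) := by
  have hc := gE_eq_zero_of_gD ht.1 hv hd
  let F : ℕ → List A → M.carrier →ₗ[𝕜] P.carrier := fun n => if n = d then t else 0
  let t' : List A → M.carrier →ₗ[𝕜] P.carrier := fun l => F l.length l
  have ht1 : ∀ l, l.length = d → t' l = t l := fun l hl => by simp [t', F, hl]
  have ht2 : ∀ l, l.length ≠ d → t' l = 0 := fun l hl => by simp [t', F, hl]
  have ht' : t' ∈ gDeg A M.toGVec P.toGVec k := gDeg_of_length fun n => by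
    by_cases h : n = d
    · simpa [F, h] using ht
    · simp [F, h]
  obtain ⟨s, hs, hs', hst⟩ := exists_gE_eq (P.mu []) (M.mu []) D P.mu_nil_mem M.mu_nil_mem M.mu_mu d k t' ht' ht2
    (fun l => by
      by_cases hl : l.length = d
      · rw [gE_congr _ _ fun x hx => ht1 x (hx.trans hl), hc l hl]
      · rw [gE_congr (t := 0) _ _ fun x hx => ht2 x (hx.trans_ne hl), gE_zero])
    (fun K hK m hm => by
      have hK' : (K.map D.e).length = d := by simpa using hK
      rw [ht1 _ hK']
      have h1 : P.mu [] (t (K.map D.e) m) = 0 := by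
        rw [gE_map_e ht.1 (hc _ hK'), hm, map_zero, smul_zero]
      have h2 : P.p (t (K.map D.e) m) = 0 := by
        have : m ∈ LinearMap.ker (P.p ∘ₗ t (K.map D.e)) :=
          M.mem_of_proj_mem _ m fun g => hp K hK g _ (M.proj_mem g m) (by
            rw [GVec.d_proj M.mu_nil_mem, hm, map_zero])
        exact this
      obtain ⟨y, hy⟩ := P.exact _ h1 h2
      exact ⟨y, hy.symm⟩)
  have hst' : ∀ l, l.length = d → gE (P.mu []) (M.mu []) (k - 1) s l = t l := fun l hl => by
    rw [hst, ht1 l hl]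
  refine ⟨s, hs, hs', hst', (hv.sub (gD_vanishBelow hs.1 hs'.vanishBelow)).succ fun l hl => ?_⟩
  subst hl
  rw [Pi.sub_apply, gD_eq_gE _ hs.1 hs'.vanishBelow, hst' l rfl, sub_self]

section BarApply

variable {V W : Type u} [AddCommGroup V] [Module 𝕜 V] [AddCommGroup W] [Module 𝕜 W]

theorem barD_apply_add (w : W →ₗ[𝕜] W) (q : V →ₗ[𝕜] V) (X : List ℕ → V →ₗ[𝕜] W) (K : List ℕ)
    (v v' : V) : barD w q X K (v + v') = barD w q X K v + barD w q X K v' := by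
  cases K with
  | nil => simp [barD]
  | cons a l =>
    simp only [barD_cons, map_add, barR_add]
    abel

theorem barD_apply_zero (w : W →ₗ[𝕜] W) (q : V →ₗ[𝕜] V) (X : List ℕ → V →ₗ[𝕜] W) (K : List ℕ) :
    barD w q X K 0 = 0 := by
  have := barD_apply_add w q X K 0 0
  rwa [add_zero, left_eq_add] at this

end BarApply

/-- The differential of `t` vanishes also in length `d + 1`, where `represents_gD` identifies its
classes with the bar differential up to an invertible sign. Every class is tested on its
representative `M.i v`. -/
theorem barD_eq_zero_of_represents {d : ℕ} {k : ZMod N}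
    {t : List A → M.carrier →ₗ[𝕜] P.carrier} (ht : t ∈ gDeg A M.toGVec P.toGVec k)
    (hv : VanishBelow d t) (hd : VanishBelow (d + 2) (gD M.mu P.mu k t))
    {X : List ℕ → CohOf (M.mu []) →ₗ[𝕜] CohOf (P.mu [])} (hX : Represents M P d t X)
    (K : List ℕ) (hK : K.length = d + 1) (v : CohOf (M.mu [])) : barD P.q M.q X K v = 0 := by
  have hc := gE_eq_zero_of_gD ht.1 hv (hd.mono (Nat.le_succ _))
  induction v using internal_induction (cohDeg_internal M.toGVec (M.mu []) M.mu_nil_mem) with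
  | hom g v hv' =>
    have := represents_gD ht hv hc hX K hK g (M.i v) (M.i_mem g v hv') (M.mu_i v)
    rw [hd _ (by simp [hK]), LinearMap.zero_apply, map_zero, smul_zero, M.p_i] at this
    have h2 := congrArg ((sgn 𝕜 g ^ (d + 1) * sgn 𝕜 k) • ·) this
    simp only [smul_zero, smul_smul] at h2
    rw [show sgn 𝕜 g ^ (d + 1) * sgn 𝕜 k * (sgn 𝕜 g ^ (d + 1) * sgn 𝕜 k)
      = (sgn 𝕜 g * sgn 𝕜 g) ^ (d + 1) * (sgn 𝕜 k * sgn 𝕜 k) by ring, sgn_mul_self, sgn_mul_self,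
      one_pow, one_mul, one_smul] at h2
    exact h2.symm
  | zero => exact barD_apply_zero _ _ _ _
  | add a b ha hb => rw [barD_apply_add, ha, hb, add_zero]

/-- In lengths at least two, a family whose differential vanishes to second order is exact to
first order. -/
theorem exists_step {d : ℕ} {k : ZMod N} {t : List A → M.carrier →ₗ[𝕜] P.carrier}
    (ht : t ∈ gDeg A M.toGVec P.toGVec k) (hv : VanishBelow (d + 2) t)
    (hd : VanishBelow (d + 4) (gD M.mu P.mu k t)) :
    ∃ s ∈ gDeg A M.toGVec P.toGVec (k - 1), VanishBelow (d + 1) s ∧ s [D.e 1] = 0 ∧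
      VanishBelow (d + 3) (t - gD M.mu P.mu (k - 1) s) := by
  have hc := gE_eq_zero_of_gD ht.1 hv (hd.mono (by omega))
  -- The classes of the lowest part form a bar cocycle in length `d + 2`, and its bar primitive
  -- lives one length lower. The factor `sgn 𝕜 (k - 1)` cancels the sign in `represents_gD`.
  obtain ⟨X, hX, hXd, -⟩ := exists_represents ht hc
  have hX0 := barD_eq_zero_of_represents ht hv hd hX
  obtain ⟨S, hSd, hS, hS1, hSX⟩ := exists_barD_eq P.q M.q (X := fun K => sgn 𝕜 (k - 1) • X K)
    M.q_mem P.q_mem (fun K g v hv => Submodule.smul_mem _ _ (hXd K g v hv))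
    (fun K hK v => by rw [barD_smul, hX0 K hK, smul_zero])
  obtain ⟨s, hs, hsl, hsE, hsS, hs1⟩ := exists_of_represents hS hSd
  have hs0 : VanishBelow (d + 2) (gD M.mu P.mu (k - 1) s) :=
    (gD_vanishBelow hs.1 hsl.vanishBelow).succ fun l hl => by
      rw [gD_eq_gE _ hs.1 (hl ▸ hsl.vanishBelow), hsE]
  have hds := gDeg_gD_pred M.mu_mem P.mu_mem hs
  have ht1 := sub_mem ht hds
  -- The square of the differential is a commutator with curvatures, and these vanish below length
  -- two; no further relations are needed here.
  have hdd : VanishBelow (d + 3) (gD M.mu P.mu k (gD M.mu P.mu (k - 1) s)) := by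
    have := gD_gD (ν := P.mu) M.mu_mem hs
    rw [sub_add_cancel] at this
    rw [this]
    refine ((gComp_vanishBelow P.curv_vanishBelow hsl.vanishBelow).mono (by omega)).sub
      ((gComp_vanishBelow hsl.vanishBelow M.curv_vanishBelow).mono (by omega))
  -- After the correction by `s`, the classes in length `d + 2` are zero, and a second correction in
  -- that length removes the values themselves.
  obtain ⟨s', hs', hsl', -, hst'⟩ := exists_step_of_class_eq_zero ht1 (hv.sub hs0)
    (by rw [map_sub]; exact (hd.mono (by omega)).sub hdd) fun K hK g m hm hdm => by
      have h1 := hX K hK g m hm hdm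
      have h2 := represents_gD hs hsl.vanishBelow (fun l _ => hsE l) hsS K hK g m hm hdm
      rw [hSX K hK, LinearMap.smul_apply, smul_smul, mul_assoc, sgn_mul_self, mul_one] at h2
      have h3 : chi (sgn 𝕜 δ) K •
          P.p ((t - gD M.mu P.mu (k - 1) s) (K.map D.e) m) = 0 := by
        rw [Pi.sub_apply, LinearMap.sub_apply, map_sub, smul_sub, h1, h2, sub_self]
      have h4 := congrArg (chi (sgn 𝕜 δ) K • ·) h3
      simpa only [smul_smul, chi_mul_self (sgn_mul_self 𝕜 δ), one_smul, smul_zero] using h4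
  refine ⟨s + s', add_mem hs hs', hsl.vanishBelow.add (hsl'.vanishBelow.mono (by omega)), ?_, ?_⟩
  · rw [Pi.add_apply, show s [D.e 1] = 0 from hs1 [1] hS1, hsl' _ (by simp), add_zero]
  · rwa [map_add, ← sub_sub]

/-- In length one no bar primitive is needed: the classes of `t` form a derivation that vanishes on
the generator, hence they are zero. -/
theorem exists_step_one {k : ZMod N} {t : List A → M.carrier →ₗ[𝕜] P.carrier}
    (ht : t ∈ gDeg A M.toGVec P.toGVec k) (hv : VanishBelow 1 t) (h1 : t [D.e 1] = 0)
    (hd : VanishBelow 3 (gD M.mu P.mu k t)) :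
    ∃ s ∈ gDeg A M.toGVec P.toGVec (k - 1), VanishBelow 1 s ∧ s [D.e 1] = 0 ∧
      VanishBelow 2 (t - gD M.mu P.mu (k - 1) s) := by
  have hc := gE_eq_zero_of_gD ht.1 hv (hd.mono (by omega))
  obtain ⟨X, hX, -, hX1⟩ := exists_represents ht hc
  have hX0 := barD_eq_zero_of_represents ht hv hd hX
  have hX2 := eq_zero_of_barD_eq_zero P.q M.q (hX1 [1] h1) fun i j v => hX0 [i, j] rfl v
  obtain ⟨s, hs, hsl, hst, -⟩ := exists_step_of_class_eq_zero ht hv (hd.mono (by omega))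
    fun K hK g m hm hdm => by
      obtain ⟨a, rfl⟩ := List.length_eq_one_iff.1 hK
      have h1 := hX [a] hK g m hm hdm
      rw [hX2, LinearMap.zero_apply, smul_zero] at h1
      have h4 := congrArg (chi (sgn 𝕜 δ) [a] • ·) h1
      simpa only [smul_smul, chi_mul_self (sgn_mul_self 𝕜 δ), one_smul, smul_zero] using h4
  -- The primitive `s` may be nonzero on the generator. The family `c` has the same value there and
  -- is closed for the leading differential, because `t [D.e 1] = 0` says that `y` commutes with the
  -- differentials up to sign. So `s - c` is as good a primitive.
  let y := s [D.e 1]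
  let c : List A → M.carrier →ₗ[𝕜] P.carrier := fun l => match l with
    | [a] => D.P a 1 • y
    | _ => 0
  have hcl : SuppLen 1 c := by
    rintro (_ | ⟨a, _ | ⟨b, l⟩⟩) hl
    · rfl
    · simp at hl
    · rfl
  have hcm : IsMultilin 𝕜 c := by
    rintro (_ | ⟨b, x⟩) (_ | ⟨b', x'⟩)
    · exact ⟨fun a b => by simp [c, add_smul], fun r a => by simp [c, mul_smul]⟩
    · exact ⟨fun a b => by simp [c], fun r a => by simp [c]⟩
    · have : ∀ a, c (b :: x ++ [a]) = 0 := fun a => hcl _ (by simp)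
      simp only [this]
      exact ⟨fun a b => by simp, fun r a => by simp⟩
    · have : ∀ a, c (b :: x ++ a :: b' :: x') = 0 := fun a => hcl _ (by simp)
      simp only [this]
      exact ⟨fun a b => by simp, fun r a => by simp⟩
  have hcd : c ∈ gDeg A M.toGVec P.toGVec (k - 1) := by
    refine ⟨hcm, fun l r hl g m hm => ?_⟩
    by_cases hl1 : l.length = 1
    · cases hl with
      | nil => simp at hl1
      | @cons a l g' r ha hl =>
        cases hl with
        | cons _ _ => simp at hl1
        | nil =>
          change D.P a 1 • y m ∈ _
          by_cases h0 : D.P a 1 = 0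
          · rw [h0, zero_smul]; exact zero_mem _
          · refine Submodule.smul_mem _ _ ?_
            have := hs.2 _ _ (RDeg.singleton (D.e_deg 1)) g m hm
            rwa [D.P_deg g' a ha 1 h0, ← add_zero (g' - 1)] at this
    · rw [hcl l hl1]; exact zero_mem _
  have hcE : ∀ l, l.length = 1 → gE (P.mu []) (M.mu []) (k - 1) c l = 0 := by
    intro l hl
    obtain ⟨a, rfl⟩ := List.length_eq_one_iff.1 hl
    have h2 : insDiff A c [a] = 0 := by
      rw [insDiff_cons, insDiff_nil]
      simp [c, D.P_diff]
    have h3 := hst [D.e 1] rfl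
    rw [h1, gE, insDiff_cons, insDiff_nil, D.e_closed, hs.1.head_zero, add_zero,
      LinearMap.zero_comp, add_zero] at h3
    rw [gE, h2, LinearMap.zero_comp, add_zero]
    change P.mu [] ∘ₗ (D.P a 1 • y) - sgn 𝕜 (k - 1) • ((D.P a 1 • y) ∘ₗ M.mu []) = 0
    rw [LinearMap.comp_smul, LinearMap.smul_comp, smul_comm (sgn 𝕜 (k - 1)), ← smul_sub, h3,
      smul_zero]
  refine ⟨s - c, sub_mem hs hcd, hsl.vanishBelow.sub hcl.vanishBelow, ?_, ?_⟩
  · simp [c, y, D.P_e]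
  · rw [map_sub, sub_sub_eq_add_sub]
    refine VanishBelow.succ (d := 1) ?_ fun l hl => ?_
    · exact (hv.add (gD_vanishBelow hcm hcl.vanishBelow)).sub (gD_vanishBelow hs.1 hsl.vanishBelow)
    · rw [Pi.sub_apply, Pi.add_apply, gD_eq_gE _ hs.1 (hl ▸ hsl.vanishBelow),
        gD_eq_gE _ hcm (hl ▸ hcl.vanishBelow), hst l hl, hcE l hl, add_zero, sub_self]

/-- The closed families that vanish on `[]` and on the generator are exact, with primitives of the
same kind. -/
theorem exists_primitive {k : ZMod N} {t : List A → M.carrier →ₗ[𝕜] P.carrier}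
    (hM : curv M.mu = 0) (hP : curv P.mu = 0) (ht : t ∈ gDeg A M.toGVec P.toGVec k)
    (h0 : t [] = 0) (h1 : t [D.e 1] = 0) (hd : gD M.mu P.mu k t = 0) :
    ∃ s ∈ gDeg A M.toGVec P.toGVec (k - 1), s [] = 0 ∧ s [D.e 1] = 0 ∧
      gD M.mu P.mu (k - 1) s = t := by
  let G : ℕ → (List A → M.carrier →ₗ[𝕜] P.carrier) → Prop := fun n s =>
    s ∈ gDeg A M.toGVec P.toGVec (k - 1) ∧ s [] = 0 ∧ s [D.e 1] = 0 ∧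
      VanishBelow (n + 1) (t - gD M.mu P.mu (k - 1) s)
  have hstep : ∀ n s, G n s → ∃ s', G (n + 1) s' ∧ VanishBelow n (s' - s) := by
    rintro n s ⟨hs, hs0, hs1, hst⟩
    have hds := gDeg_gD_pred M.mu_mem P.mu_mem hs
    have hdt : gD M.mu P.mu k (t - gD M.mu P.mu (k - 1) s) = 0 := by
      have := gD_gD (ν := P.mu) M.mu_mem hs
      rw [sub_add_cancel, hM, hP] at this
      rw [map_sub, hd, this]
      simp
    have key : ∃ s' ∈ gDeg A M.toGVec P.toGVec (k - 1), VanishBelow n s' ∧ s' [] = 0 ∧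
        s' [D.e 1] = 0 ∧ VanishBelow (n + 2)
          (t - gD M.mu P.mu (k - 1) s - gD M.mu P.mu (k - 1) s') := by
      cases n with
      | zero =>
        -- Because `s` vanishes on `[]` and on the generator, so does its differential on the
        -- generator, and the hypothesis of `exists_step_one` is preserved.
        have e1 : (t - gD M.mu P.mu (k - 1) s) [D.e 1] = 0 := by
          have e0 : s [0] = 0 := hs.1.head_zero []
          have e2 : s [A.τ (D.e 1), 0] = 0 := hs.1.map_zero [A.τ (D.e 1)] []
          have e3 : s [0, D.e 1] = 0 := hs.1.head_zero [D.e 1]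
          simp [h1, gD_apply, gComp_apply, gIns_apply, insertSum_cons, insertSum_nil,
            splitSum_cons, splitSum_nil, hs0, hs1, A.mu_nil, D.e_closed, e0, e2, e3]
        obtain ⟨s', hs', hv', hs1', hst'⟩ := exists_step_one (sub_mem ht hds) hst e1
          (by rw [hdt]; exact fun _ _ => rfl)
        exact ⟨s', hs', hv'.mono (by omega), hv' [] (by simp), hs1', hst'⟩
      | succ n =>
        obtain ⟨s', hs', hv', hs1', hst'⟩ := exists_step (d := n) (sub_mem ht hds) hst
          (by rw [hdt]; exact fun _ _ => rfl)
        exact ⟨s', hs', hv', hv' [] (by simp), hs1', hst'⟩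
    obtain ⟨s', hs', hv', hs0', hs1', hst'⟩ := key
    refine ⟨s + s', ⟨add_mem hs hs', by simp [hs0, hs0'], by simp [hs1, hs1'], ?_⟩, ?_⟩
    · rwa [map_add, ← sub_sub]
    · rwa [add_sub_cancel_left]
  -- Since `t [] = 0`, the zero family is already a primitive in length zero.
  have hbase : G 0 0 := by
    refine ⟨zero_mem _, rfl, rfl, ?_⟩
    intro l hl
    rw [List.length_eq_zero_iff.1 (Nat.lt_one_iff.1 hl), map_zero, sub_zero, h0]
  obtain ⟨s, hs, hstab⟩ := exists_stable_seq G hbase hstep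
  have hlim := gDeg_of_length (F := fun n => s (n + 1)) fun n => (hs (n + 1)).1
  have e0 : s ([] : List A).length.succ [] = 0 := (hs 1).2.1
  have e1 : s [D.e 1].length.succ [D.e 1] = 0 := (hs 2).2.2.1
  -- At the index `l.length + 1` the values on `l` and on all shorter lists are stable, and the
  -- error on `l` is zero.
  refine ⟨fun l => s (l.length + 1) l, hlim, e0, e1, funext fun l => ?_⟩
  have h2 : gD M.mu P.mu (k - 1) (fun l => s (l.length + 1) l) l
      = gD M.mu P.mu (k - 1) (s (l.length + 1)) l :=
    gD_congr hlim.1 (hs _).1.1 fun x hx => (hstab _ _ x (Nat.lt_succ_self _) (by omega)).symm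
  rw [h2]
  exact (sub_eq_zero.1 ((hs (l.length + 1)).2.2.2 l (by omega))).symm

end Step

end AInf

namespace AInf

set_option linter.unusedSectionVars false

/-! ### Basic cocycles and representatives extracted from the cohomology -/

section Basis

variable {𝕜 : Type u} [Field 𝕜] {N : ℕ}

theorem GVec.repr_proj (V : GVec 𝕜 N) {ι : Type v} (b : Module.Basis ι 𝕜 V) {w : ι → ZMod N}
    (hb : ∀ i, b i ∈ V.deg (w i)) (g : ZMod N) (x : V) (i : ι) :
    b.repr (V.proj g x) i = if w i = g then b.repr x i else 0 := by
  classical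
  let f : V →ₗ[𝕜] 𝕜 := Finsupp.lapply i ∘ₗ b.repr.toLinearMap
  have : f ∘ₗ V.proj g = (if w i = g then (1 : 𝕜) else 0) • f := b.ext fun j => by
    change b.repr (V.proj g (b j)) i = (if w i = g then (1 : 𝕜) else 0) • b.repr (b j) i
    by_cases hj : g = w j
    · subst hj
      rw [V.proj_of_mem (hb j), b.repr_self]
      by_cases hij : i = j
      · subst hij; simp
      · rw [Finsupp.single_eq_of_ne hij, smul_zero]
    · rw [V.proj_of_mem_ne hj (hb j), b.repr_self, map_zero, Finsupp.zero_apply]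
      by_cases hij : i = j
      · subst hij; rw [if_neg (Ne.symm hj), zero_smul]
      · rw [Finsupp.single_eq_of_ne hij, smul_zero]
  have h := LinearMap.congr_fun this x
  rw [LinearMap.smul_apply, ite_smul, one_smul, zero_smul] at h
  exact h

theorem GVec.eq_of_repr_ne_zero (V : GVec 𝕜 N) {ι : Type v} (b : Module.Basis ι 𝕜 V)
    {w : ι → ZMod N} (hb : ∀ i, b i ∈ V.deg (w i)) {g : ZMod N} {x : V} (hx : x ∈ V.deg g) {i : ι}
    (h : b.repr x i ≠ 0) : w i = g := by
  by_contra hg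
  have := V.repr_proj b hb g x i
  rw [V.proj_of_mem hx, if_neg hg] at this
  exact h this

variable [Fact (Even N)]

theorem AInfAlg.exists_of_cls_eq (A : AInfAlg 𝕜 N) {x y : LinearMap.ker A.diff}
    (h : A.cls x = A.cls y) : ∃ b, x.1 = y.1 + A.mu [b] := by
  rw [← sub_eq_zero, ← map_sub] at h
  obtain ⟨b, hb⟩ := (Submodule.Quotient.mk_eq_zero _).1 h
  exact ⟨b, by rw [show A.mu [b] = (x - y : A) from hb]; abel⟩

/-- The cohomology algebra as a graded vector space. -/
def AInfAlg.cohGVec (A : AInfAlg 𝕜 N) : GVec 𝕜 N :=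
  ⟨A.H, A.degH, cohDeg_internal A.toGVec A.diff A.self.diff_mem⟩

/-- The basic cocycles are homogeneous representatives of the powers of the generator, and `P` takes
coordinates in the basis of powers after a projection to cohomology. The sign in `e_mul` is the one
in the definition of the product on cohomology. -/
theorem exists_polyBasis (A : AInfAlg 𝕜 N) (φ : A.H ≃ₐ[𝕜] Polynomial 𝕜) {δ : ZMod N}
    (hφ : φ.symm Polynomial.X ∈ A.degH δ) :
    ∃ D : PolyBasis A δ, ∀ k, A.cls ⟨D.e k, D.e_closed k⟩ = φ.symm Polynomial.X ^ k := by
  let r : ℕ → A.H := fun k => φ.symm Polynomial.X ^ k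
  obtain ⟨b, hb⟩ : ∃ b : Module.Basis ℕ 𝕜 A.cohGVec, ∀ k, b k = r k := by
    refine ⟨(Polynomial.basisMonomials 𝕜).map φ.symm.toLinearEquiv, fun k => ?_⟩
    have h : φ.symm (Polynomial.basisMonomials 𝕜 k) = φ.symm Polynomial.X ^ k := by
      rw [Polynomial.coe_basisMonomials, ← map_pow, Polynomial.X_pow_eq_monomial]
    exact h
  have hrd : ∀ k : ℕ, r k ∈ A.degH (k * δ) := fun k => by
    rw [← nsmul_eq_mul]
    exact SetLike.pow_mem_graded k hφ
  choose x hx hxr using hrd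
  have hxb : ∀ k, A.cls (x k) = b k := fun k => (hxr k).trans (hb k).symm
  obtain ⟨i, p, -, -, hpd, hp, hp0⟩ := exists_cohomology_section A.toGVec A.diff A.self.diff_mem
    A.mu_mu
  have hp' : ∀ y : LinearMap.ker A.diff, p y = A.cls y := hp
  let p' : A →ₗ[𝕜] A.cohGVec := p
  let P : A →ₗ[𝕜] ℕ →₀ 𝕜 := b.repr.toLinearMap ∘ₗ p'
  have hPd : ∀ g, ∀ a ∈ A.deg g, ∀ k, P a k ≠ 0 → (k : ZMod N) * δ = g := fun g a ha k hk =>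
    A.cohGVec.eq_of_repr_ne_zero b (w := fun k => (k : ZMod N) * δ)
      (fun k => hxb k ▸ (⟨x k, hx k, rfl⟩ : A.cls (x k) ∈ cohDeg _ _ _)) (hpd g a ha) hk
  refine ⟨⟨fun k => x k, hx, fun k => (x k).2, P, fun k => ?_, fun a => ?_, hPd,
    fun g a ha hda => ?_, fun i j => ?_⟩, fun k => (hxb k).trans (hb k)⟩
  · change b.repr (p (x k)) = _
    rw [hp', hxb, b.repr_self]
  · change b.repr (p (A.diff a)) = _
    rw [hp0]
    exact map_zero b.repr
  · let y : LinearMap.ker A.diff := (P a).sum fun k r => r • x k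
    have hy : A.cls ⟨a, hda⟩ = A.cls y := by
      rw [map_finsuppSum, ← hp']
      refine (b.linearCombination_repr (p a)).symm.trans ?_
      rw [Finsupp.linearCombination_apply]
      refine Finsupp.sum_congr fun k _ => ?_
      rw [map_smul, hxb]
      rfl
    obtain ⟨c, hc⟩ := A.exists_of_cls_eq hy
    have hyv : y.1 = (P a).sum fun k r => r • (x k).1 := by
      simp only [y, Finsupp.sum, AddSubmonoidClass.coe_finsetSum, Submodule.coe_smul]
    have hyd : y.1 ∈ A.deg g := by
      rw [hyv]
      refine Submodule.sum_mem _ fun k hk => Submodule.smul_mem _ _ ?_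
      rw [← hPd g a ha k (Finsupp.mem_support_iff.1 hk)]
      exact hx k
    -- `c` may be inhomogeneous, but its differential has degree `g`, so the component of degree `g
    -- - 1` has the same differential.
    refine ⟨A.proj (g - 1) c, A.proj_mem _ _, ?_⟩
    have := GVec.d_proj (d := A.diff) A.self.diff_mem (g - 1) c
    rw [sub_add_cancel] at this
    have h2 : A.mu [A.proj (g - 1) c] = A.mu [c] := by
      refine this.trans (A.proj_of_mem ?_)
      have h3 : A.mu [c] = a - y.1 := by rw [show a = y.1 + A.mu [c] from hc]; abel
      change A.mu [c] ∈ _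
      rw [h3]
      exact sub_mem ha hyd
    rw [h2, ← hyv]
    exact hc
  · have h1 : A.cls (A.mulZ (x i) (x j)) = A.cls (x (i + j)) := by
      refine (show A.cls (A.mulZ (x i) (x j)) = A.cls (x i) * A.cls (x j) from rfl).trans ?_
      rw [hxb, hxb, hxb, hb, hb, hb]
      exact (pow_add _ i j).symm
    obtain ⟨c, hc⟩ := A.exists_of_cls_eq h1
    have h2 : (A.mulZ (x i) (x j)).1 = sgn 𝕜 ((i : ZMod N) * δ) • A.mu [(x i).1, (x j).1] := by
      change A.mu [A.σ (x i).1, (x j).1] = _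
      rw [show A.σ (x i).1 = _ from A.σ_of_mem (hx i)]
      exact (A.mu_multilin.head _).map_smul _ _
    rw [h2] at hc
    refine ⟨sgn 𝕜 ((i : ZMod N) * δ) • c, ?_⟩
    have h3 : A.mu [sgn 𝕜 ((i : ZMod N) * δ) • c] = sgn 𝕜 ((i : ZMod N) * δ) • A.mu [c] := A.diff.map_smul _ _
    rw [h3, ← smul_add, ← hc, smul_smul, sgn_mul_self, one_smul]

variable {A : AInfAlg 𝕜 N} {δ : ZMod N}

/-- The element `u` of the cohomology algebra is the class of the generator. -/
def PolyBasis.Generates (D : PolyBasis A δ) (u : A.H) : Prop :=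
  ∀ k, A.cls ⟨D.e k, D.e_closed k⟩ = u ^ k

variable {D : PolyBasis A δ} {u : A.H}

theorem PolyBasis.Generates.cls_e_one (hu : D.Generates u) :
    A.cls ⟨D.e 1, D.e_closed 1⟩ = u := by rw [hu 1, pow_one]

theorem PolyBasis.Generates.mem (hu : D.Generates u) : u ∈ A.degH δ := by
  have h := D.e_deg 1
  rw [Nat.cast_one, one_mul] at h
  exact ⟨_, h, hu.cls_e_one⟩

/-- `D.P` only sees the class. This is needed for the cohomological unit, which need not be the
chosen cocycle `e 0`. -/
theorem PolyBasis.Generates.P_eq (hu : D.Generates u) {x : A} (hx : A.mu [x] = 0) (k : ℕ)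
    (h : A.cls ⟨x, hx⟩ = u ^ k) : D.P x = Finsupp.single k 1 := by
  obtain ⟨b, hb⟩ := A.exists_of_cls_eq (h.trans (hu k).symm)
  rw [show x = D.e k + A.mu [b] from hb, map_add, D.P_e, D.P_diff, add_zero]

theorem AInfMod.act_mul (M : AInfMod A) (m : M.H) (a b : A.H) :
    M.act m (a * b) = M.act (M.act m a) b := (M.act_assoc m a b).symm

theorem AInfMod.act_pow (M : AInfMod A) (m : M.H) (a : A.H) (k : ℕ) :
    M.act m (a ^ k) = ((M.act.flip a) ^ k) m := by
  induction k with
  | zero => exact M.act_one m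
  | succ k ih => rw [pow_succ, AInfMod.act_mul, ih, pow_succ', Module.End.mul_apply]; rfl

theorem AInfMod.mu_mu (M : AInfMod A) (m : M) : M.mu [] (M.mu [] m) = 0 := by
  have := M.rel [] m
  simpa [splitSum_nil, insertSum_nil, A.mu_nil, AInfMod.mu_zero_cons] using this

theorem AInfMod.curv_mu (M : AInfMod A) : curv M.mu = 0 := mu_rel M

theorem exists_section (V : GVec 𝕜 N) (d : V →ₗ[𝕜] V)
    (hd : ∀ g, ∀ x ∈ V.deg g, d x ∈ V.deg (g + 1)) (hdd : ∀ x, d (d x) = 0) :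
    ∃ (i : CohOf d →ₗ[𝕜] V) (p : V →ₗ[𝕜] CohOf d),
      (∀ v, d (i v) = 0) ∧ (∀ v, p (i v) = v) ∧ (∀ g, ∀ v ∈ cohDeg V d g, i v ∈ V.deg g) ∧
      (∀ g, ∀ x ∈ V.deg g, p x ∈ cohDeg V d g) ∧ (∀ x, p (d x) = 0) ∧
      (∀ x, d x = 0 → p x = 0 → ∃ y, x = d y) ∧
      ∀ x : LinearMap.ker d, p x = Submodule.Quotient.mk x := by
  obtain ⟨i, p, hi, hid, hpd, hp, hp0⟩ := exists_cohomology_section V d hd hdd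
  refine ⟨i, p, fun v => (hi v).1, fun v => ?_, hid, hpd, hp0, fun x hx h => ?_, hp⟩
  · exact (hp ⟨i v, (hi v).1⟩).trans (hi v).2
  · have := (hp ⟨x, hx⟩).symm.trans h
    obtain ⟨y, hy⟩ := (Submodule.Quotient.mk_eq_zero _).1 this
    exact ⟨y, hy.symm⟩

theorem AInfMod.exists_section (M : AInfMod A) :
    ∃ (i : CohOf M.diff →ₗ[𝕜] M) (p : M →ₗ[𝕜] CohOf M.diff),
      (∀ v, M.mu [] (i v) = 0) ∧ (∀ v, p (i v) = v) ∧
      (∀ g, ∀ v ∈ cohDeg M.toGVec M.diff g, i v ∈ M.deg g) ∧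
      (∀ g, ∀ x ∈ M.deg g, p x ∈ cohDeg M.toGVec M.diff g) ∧ (∀ x, p (M.mu [] x) = 0) ∧
      (∀ x, M.mu [] x = 0 → p x = 0 → ∃ y, x = M.mu [] y) ∧
      ∀ x : LinearMap.ker M.diff, p x = M.cls x :=
  AInf.exists_section M.toGVec M.diff M.diff_mem M.mu_mu

/-- The operations of an `A∞`-module, with representatives of its cohomology. -/
noncomputable def AInfMod.toPolyMod (M : AInfMod A) (hu : D.Generates u) : PolyMod D where
  toGVec := M.toGVec
  mu := M.mu
  mu_mem := mu_mem_homDeg M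
  mu_mu := M.mu_mu
  mu_one := M.rel_one
  i := M.exists_section.choose
  p := M.exists_section.choose_spec.choose
  mu_i := M.exists_section.choose_spec.choose_spec.1
  p_i := M.exists_section.choose_spec.choose_spec.2.1
  i_mem := M.exists_section.choose_spec.choose_spec.2.2.1
  p_mem := M.exists_section.choose_spec.choose_spec.2.2.2.1
  p_mu := M.exists_section.choose_spec.choose_spec.2.2.2.2.1
  exact := M.exists_section.choose_spec.choose_spec.2.2.2.2.2.1
  q := M.act.flip u
  q_mem _ _ hv := M.act_mem hv hu.mem
  q_spec k x hx := by
    have hp := M.exists_section.choose_spec.choose_spec.2.2.2.2.2.2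
    refine (hp (M.actZ ⟨x, hx⟩ ⟨D.e k, D.e_closed k⟩)).trans ?_
    rw [← AInfMod.act_cls, hu k, M.act_pow, ← hp]

theorem AInfMod.p_toPolyMod (M : AInfMod A) (hu : D.Generates u) (x : LinearMap.ker M.diff) :
    (M.toPolyMod hu).p x.1 = M.cls x :=
  M.exists_section.choose_spec.choose_spec.2.2.2.2.2.2 x

end Basis

end AInf

namespace AInf

set_option linter.unusedSectionVars false

/-! ### Realizing an operator by an `A∞`-module with zero differential -/

section OfOperator

variable {𝕜 : Type u} [Field 𝕜] {N : ℕ} {A : AInfAlg 𝕜 N} {δ : ZMod N} (D : PolyBasis A δ)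
  {V : GVec 𝕜 N} (q : V →ₗ[𝕜] V)

/-- The action of the basic cocycles by the powers of `q`. -/
noncomputable def powerAction : List ℕ → V →ₗ[𝕜] V
  | [k] => (q ^ k) ∘ₗ V.σ
  | _ => 0

/-- The operations with zero differential, the action of the basic cocycles by the powers of `q`,
and higher operations `f`. -/
noncomputable def operatorMu (f : List A → V →ₗ[𝕜] V) : List A → V →ₗ[𝕜] V
  | [] => 0
  | [a] => repr D (powerAction q) [a]
  | a :: b :: l => f (a :: b :: l)

theorem operatorMu_of_length {f : List A → V →ₗ[𝕜] V} {l : List A} (hl : 2 ≤ l.length) :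
    operatorMu D q f l = f l := by
  match l, hl with
  | _ :: _ :: _, _ => rfl

theorem operatorMu_sub (f : List A → V →ₗ[𝕜] V) {s : List A → V →ₗ[𝕜] V}
    (hs : VanishBelow 2 s) : operatorMu D q (f - s) = operatorMu D q f - s := by
  funext l
  by_cases hl : 2 ≤ l.length
  · rw [operatorMu_of_length D q hl, Pi.sub_apply, Pi.sub_apply, operatorMu_of_length D q hl]
  · rw [Pi.sub_apply, hs l (not_le.1 hl), sub_zero]
    match l, hl with
    | [], _ => rfl
    | [_], _ => rfl
    | _ :: _ :: _, hl => simp at hl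

theorem operatorMu_congr {f f' : List A → V →ₗ[𝕜] V} {l : List A} (h : f l = f' l) :
    operatorMu D q f l = operatorMu D q f' l := by
  match l, h with
  | [], _ => rfl
  | [_], _ => rfl
  | _ :: _ :: _, h => exact h

theorem operatorMu_singleton (f : List A → V →ₗ[𝕜] V) (a : A) :
    operatorMu D q f [a] = Finsupp.linearCombination 𝕜 (fun k => (q ^ k) ∘ₗ V.σ) (D.P a) := rfl

theorem operatorMu_e (f : List A → V →ₗ[𝕜] V) (k : ℕ) :
    operatorMu D q f [D.e k] = (q ^ k) ∘ₗ V.σ := by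
  rw [operatorMu_singleton, D.P_e, Finsupp.linearCombination_single, one_smul]

theorem operatorMu_diff (f : List A → V →ₗ[𝕜] V) (a : A) : operatorMu D q f [A.mu [a]] = 0 := by
  rw [operatorMu_singleton, D.P_diff, map_zero]

variable [Fact (Even N)]

theorem GVec.σ_mem (V : GVec 𝕜 N) {g : ZMod N} {x : V} (hx : x ∈ V.deg g) : V.σ x ∈ V.deg g := by
  rw [V.σ_of_mem hx]
  exact Submodule.smul_mem _ _ hx

variable {q} (hq : ∀ g, ∀ v ∈ V.deg g, q v ∈ V.deg (g + δ))

include hq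

theorem operatorMu_mem {f : List A → V →ₗ[𝕜] V} (hf : f ∈ gDeg A V V 1) :
    operatorMu D q f ∈ gDeg A V V 1 := by
  have h1 : repr D (powerAction q) ∈ gDeg A V V 1 := repr_mem fun K g v hv => by
    match K with
    | [] => exact zero_mem _
    | [k] =>
      have := pow_apply_mem q hq k g _ (V.σ_mem hv)
      have e : g + ((([k] : List ℕ).sum : ZMod N) * δ - ([k] : List ℕ).length) + 1 = g + k * δ := by
        simp only [List.sum_singleton, List.length_singleton, Nat.cast_one]
        ring
      rw [e]
      exact this
    | _ :: _ :: _ => exact zero_mem _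
  have h2 : operatorMu D q f
      = fun l => (fun n : ℕ => if n < 2 then repr D (powerAction q) else f) l.length l := by
    funext l
    match l with
    | [] => rfl
    | [_] => rfl
    | a :: b :: l => simp [operatorMu]
  rw [h2]
  refine gDeg_of_length (F := fun n : ℕ => if n < 2 then repr D (powerAction q) else f)
    fun n => ?_
  split_ifs
  · exact h1
  · exact hf

/-- The differential is zero, so the space is its own cohomology and the two maps are inverse to
each other. -/
theorem exists_section_operatorMu (f : List A → V →ₗ[𝕜] V) :
    ∃ (i : CohOf (operatorMu D q f []) →ₗ[𝕜] V) (p : V →ₗ[𝕜] CohOf (operatorMu D q f [])),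
      (∀ v, p (i v) = v) ∧ (∀ x, i (p x) = x) ∧
      (∀ g, ∀ v ∈ cohDeg V (operatorMu D q f []) g, i v ∈ V.deg g) ∧
      ∀ g, ∀ x ∈ V.deg g, p x ∈ cohDeg V (operatorMu D q f []) g := by
  obtain ⟨i, p, hi, hid, hpd, hp, hp0⟩ := exists_cohomology_section V (operatorMu D q f [])
    (fun g x _ => zero_mem _) (fun _ => rfl)
  have hpi : ∀ v, p (i v) = v := fun v => (hp ⟨i v, (hi v).1⟩).trans (hi v).2
  refine ⟨i, p, hpi, fun x => ?_, hid, hpd⟩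
  have h1 : p (x - i (p x)) = 0 := by rw [map_sub, hpi, sub_self]
  obtain ⟨y, hy⟩ := (Submodule.Quotient.mk_eq_zero _).1 ((hp ⟨x - i (p x), rfl⟩).symm.trans h1)
  exact (sub_eq_zero.1 hy.symm).symm

/-- The first operations of the module, with representatives of the cohomology. -/
noncomputable def operatorPolyMod {f : List A → V →ₗ[𝕜] V} (hf : f ∈ gDeg A V V 1) :
    PolyMod D where
  toGVec := V
  mu := operatorMu D q f
  mu_mem := operatorMu_mem D hq hf
  mu_mu _ := rfl
  mu_one a m := by
    rw [operatorMu_diff, LinearMap.zero_apply, add_zero]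
    change 0 + operatorMu D q f [a] 0 = 0
    rw [map_zero, add_zero]
  i := (exists_section_operatorMu D hq f).choose
  p := (exists_section_operatorMu D hq f).choose_spec.choose
  mu_i _ := rfl
  p_i := (exists_section_operatorMu D hq f).choose_spec.choose_spec.1
  i_mem := (exists_section_operatorMu D hq f).choose_spec.choose_spec.2.2.1
  p_mem := (exists_section_operatorMu D hq f).choose_spec.choose_spec.2.2.2
  p_mu _ := map_zero _
  exact x _ h := ⟨0, by
    rw [← (exists_section_operatorMu D hq f).choose_spec.choose_spec.2.1 x, h, map_zero]
    rfl⟩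
  q := (exists_section_operatorMu D hq f).choose_spec.choose ∘ₗ q ∘ₗ
    (exists_section_operatorMu D hq f).choose
  q_mem g v hv := (exists_section_operatorMu D hq f).choose_spec.choose_spec.2.2.2 _ _
    (hq _ _ ((exists_section_operatorMu D hq f).choose_spec.choose_spec.2.2.1 g v hv))
  q_spec k x _ := by
    obtain ⟨-, hip, -⟩ := (exists_section_operatorMu D hq f).choose_spec.choose_spec
    rw [operatorMu_e, LinearMap.comp_apply, V.σ_σ]
    induction k with
    | zero => rfl
    | succ k ih =>
      rw [pow_succ', pow_succ', Module.End.mul_apply, Module.End.mul_apply, ← ih]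
      simp only [LinearMap.comp_apply, hip]

/-- This is `q ^ j ∘ q ^ i = q ^ (i + j)` with signs: the higher operations `f` do not enter, as the
differential is zero and the basic cocycles are closed. It disposes of the obstruction in length
two. -/
theorem curv_operatorMu_e {f : List A → V →ₗ[𝕜] V} (hf : f ∈ gDeg A V V 1) (i j : ℕ) :
    curv (operatorMu D q f) [D.e i, D.e j] = 0 := by
  have hm := (operatorMu_mem D hq hf).1
  have e1 : operatorMu D q f [0, D.e i, D.e j] = 0 := hm.head_zero _
  have e2 : operatorMu D q f [A.τ (D.e i), 0, D.e j] = 0 := hm.map_zero [A.τ (D.e i)] [D.e j]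
  have e3 : operatorMu D q f [A.τ (D.e i), A.τ (D.e j), 0] = 0 :=
    hm.map_zero [A.τ (D.e i), A.τ (D.e j)] []
  have e4 : operatorMu D q f [0, D.e j] = 0 := hm.head_zero _
  have e5 : operatorMu D q f [A.τ (D.e i), 0] = 0 := hm.map_zero [A.τ (D.e i)] []
  obtain ⟨b, hb⟩ := D.e_mul i j
  have e6 : operatorMu D q f [A.mu [D.e i, D.e j]]
      = sgn 𝕜 ((i : ZMod N) * δ) • ((q ^ (i + j)) ∘ₗ V.σ) := by
    rw [hb, operatorMu_singleton, map_add, D.P_diff, add_zero, map_smul, D.P_e, map_smul,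
      Finsupp.linearCombination_single, one_smul]
  have e7 : operatorMu D q f [] = 0 := rfl
  refine V.hom_ext fun g m hg => ?_
  simp only [curv, gComp_apply, gIns_apply, insertSum_cons, insertSum_nil, splitSum_cons,
    splitSum_nil, A.mu_nil, Pi.add_apply, LinearMap.add_apply, LinearMap.comp_apply,
    e1, e2, e3, e4, e5, e6, e7, D.e_closed, operatorMu_e, LinearMap.zero_apply,
    zero_add, add_zero, map_zero, LinearMap.smul_apply]
  have hqi := pow_apply_mem q hq i g m hg
  rw [V.σ_of_mem hg, map_smul, map_smul, V.σ_of_mem hqi, map_smul, map_smul, GVec.τ,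
    LinearMap.neg_apply, map_neg, V.σ_σ, map_neg, sgn_add, add_comm i j, pow_add,
    Module.End.mul_apply, smul_smul, ← mul_assoc, sgn_mul_self, one_mul, smul_neg, add_neg_cancel]

theorem curv_congr {μ ν : List A → V →ₗ[𝕜] V} (hμ : IsMultilin 𝕜 μ) (hν : IsMultilin 𝕜 ν)
    {l : List A} (h : ∀ x, x.length ≤ l.length → μ x = ν x) : curv μ l = curv ν l := by
  rw [curv, curv, Pi.add_apply, Pi.add_apply, gComp_congr h h, gIns_apply, gIns_apply,
    insertSum_congr hμ hν h]

/-- The action of a polynomial generator on a graded vector space extends to the operations of an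
`A∞`-module. -/
theorem exists_curv_operatorMu_eq_zero :
    ∃ f ∈ gDeg A V V 1, curv (operatorMu D q f) = 0 := by
  -- Obstruction theory: `f` is corrected so that the relations hold in one more length at each
  -- stage, the curvature being closed by `gD_curv`.
  let G : ℕ → (List A → V →ₗ[𝕜] V) → Prop := fun n f =>
    f ∈ gDeg A V V 1 ∧ VanishBelow (n + 2) (curv (operatorMu D q f))
  have h0 : G 0 0 := ⟨zero_mem _,
    (operatorPolyMod D hq (zero_mem (gDeg A V V 1))).curv_vanishBelow⟩
  have hstep : ∀ n f, G n f → ∃ f', G (n + 1) f' ∧ VanishBelow n (f' - f) := by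
    rintro n f ⟨hf, hR⟩
    let M : PolyMod D := operatorPolyMod D hq hf
    have hμ : M.mu ∈ gDeg A M.toGVec M.toGVec 1 := M.mu_mem
    have hRd : curv M.mu ∈ gDeg A M.toGVec M.toGVec (1 + 1) := gDeg_curv hμ
    have hB : gD M.mu M.mu (1 + 1) (curv M.mu) = 0 := gD_curv hμ
    have key : ∃ s ∈ gDeg A V V 1, VanishBelow (n + 1) s ∧ VanishBelow 2 s ∧
        VanishBelow (n + 3) (curv M.mu - gD M.mu M.mu 1 s) ∧
        VanishBelow (n + 3) (gComp A V V V s s) := by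
      have e : (1 + 1 - 1 : ZMod N) = 1 := add_sub_cancel_right 1 1
      cases n with
      | zero =>
        -- In length two the classes vanish by `curv_operatorMu_e`, and the correction has length
        -- two. A bar primitive, of length one, would alter the prescribed action.
        obtain ⟨s, hs, hsl, -, hRs⟩ := exists_step_of_class_eq_zero hRd hR
          (by rw [hB]; exact fun _ _ => rfl) fun K hK g m _ _ => by
            obtain ⟨i, j, rfl⟩ := List.length_eq_two.1 hK
            have : curv M.mu [D.e i, D.e j] = 0 := curv_operatorMu_e D hq hf i j
            rw [List.map_cons, List.map_cons, List.map_nil, this, LinearMap.zero_apply, map_zero]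
        rw [e] at hs hRs
        exact ⟨s, hs, hsl.vanishBelow.mono (by omega), hsl.vanishBelow, hRs,
          (gComp_vanishBelow hsl.vanishBelow hsl.vanishBelow).mono (by omega)⟩
      | succ n =>
        -- From here on a bar primitive has length at least two, so the differential and the action
        -- of single entries stay as prescribed.
        obtain ⟨s, hs, hsv, -, hRs⟩ := exists_step (d := n + 1) hRd hR
          (by rw [hB]; exact fun _ _ => rfl)
        rw [e] at hs hRs
        exact ⟨s, hs, hsv, hsv.mono (by omega), hRs,
          (gComp_vanishBelow hsv hsv).mono (by omega)⟩
    obtain ⟨s, hs, hsv, hs2, hRs, hss⟩ := key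
    refine ⟨f - s, ⟨sub_mem hf hs, ?_⟩, ?_⟩
    · rw [operatorMu_sub D q f hs2, curv_sub]
      exact hRs.add hss
    · rw [sub_sub_cancel_left]
      intro l hl
      rw [Pi.neg_apply, hsv l (by omega), neg_zero]
  obtain ⟨s, hs, hstab⟩ := exists_stable_seq G h0 hstep
  have hlim := gDeg_of_length (F := fun n => s (n + 1)) fun n => (hs (n + 1)).1
  refine ⟨fun l => s (l.length + 1) l, hlim, funext fun l => ?_⟩
  have h2 : curv (operatorMu D q fun l => s (l.length + 1) l) l
      = curv (operatorMu D q (s (l.length + 1))) l :=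
    curv_congr hq (operatorMu_mem D hq hlim).1 (operatorMu_mem D hq (hs _).1).1 fun x hx =>
      operatorMu_congr D q (hstab _ _ x (Nat.lt_succ_self _) (by omega)).symm
  rw [h2]
  exact (hs (l.length + 1)).2 l (by omega)

variable {D} {u : A.H} (hu : D.Generates u)

/-- An `A∞`-module with zero differential on which the generator acts by `q`. -/
noncomputable def operatorMod (hu : D.Generates u) : AInfMod A where
  toGVec := V
  mu := operatorMu D q (exists_curv_operatorMu_eq_zero D hq).choose
  mu_multilin := (operatorMu_mem D hq (exists_curv_operatorMu_eq_zero D hq).choose_spec.1).1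
  mu_deg := (operatorMu_mem D hq (exists_curv_operatorMu_eq_zero D hq).choose_spec.1).2
  rel l m := by
    have h := (exists_curv_operatorMu_eq_zero D hq).choose_spec.2
    have := LinearMap.congr_fun (congrFun h l) m
    rwa [curv, Pi.add_apply, LinearMap.add_apply, gComp_apply, splitSum_linearMap_apply] at this
  mul_one m _ := ⟨0, by
    rw [operatorMu_singleton, hu.P_eq A.mu_one 0 (pow_zero u).symm, Finsupp.linearCombination_single,
      map_zero, add_zero, one_smul, pow_zero, LinearMap.comp_apply, V.σ_σ]
    rfl⟩

theorem operatorMod_mu_e_one (x : V) : (operatorMod hq hu).mu [D.e 1] x = q (V.σ x) := by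
  change operatorMu D q (exists_curv_operatorMu_eq_zero D hq).choose [D.e 1] x = _
  rw [operatorMu_e, pow_one, LinearMap.comp_apply]

end OfOperator

end AInf

namespace AInf

set_option linter.unusedSectionVars false

/-! ### Graded categories: isomorphisms, fully faithful functors and lifts -/

section GrCat

variable {𝕜 : Type u} [Field 𝕜] {N : ℕ}

namespace GrCat

variable (C : GrCat.{u, v, w} 𝕜 N)

theorem IsInverse.symm {C : GrCat.{u, v, w} 𝕜 N} {X Y : C.Obj} {f : C.Hom X Y 0} {g : C.Hom Y X 0}
    (h : C.IsInverse f g) : C.IsInverse g f := ⟨h.2, h.1⟩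

theorem comp_left_cancel {X Y Z : C.Obj} {k : ZMod N} {f : C.Hom Y Z 0} {g : C.Hom Z Y 0}
    (h : C.IsInverse f g) (x : C.Hom X Y k) :
    C.comp (zero_add k) g (C.comp (zero_add k) f x) = x := by
  rw [← C.assoc (add_zero 0) (zero_add k) (zero_add k) (zero_add k), h.1, C.id_comp]

theorem comp_right_cancel {X Y Z : C.Obj} {k : ZMod N} {f : C.Hom X Y 0} {g : C.Hom Y X 0}
    (h : C.IsInverse f g) (x : C.Hom X Z k) :
    C.comp (add_zero k) (C.comp (add_zero k) x g) f = x := by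
  rw [C.assoc (add_zero k) (add_zero 0) (add_zero k) (add_zero k), h.1, C.comp_id]

theorem isInverse_of_comp {X Y : C.Obj} {f : C.Hom X Y 0} {g h : C.Hom Y X 0}
    (hg : C.comp (add_zero 0) g f = C.id X) (hh : C.comp (add_zero 0) f h = C.id Y) :
    C.IsInverse f g := by
  refine ⟨hg, ?_⟩
  have e : g = h := by
    have := C.assoc (add_zero 0) (add_zero 0) (add_zero 0) (add_zero 0) g f h
    rw [hg, hh, C.id_comp, C.comp_id] at this
    exact this.symm
  rw [e, hh]

/-- `f` has the left inverse `a g` and the right inverse `g b`, and these must agree. -/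
theorem exists_isInverse_of_comp {X Y : C.Obj} {f : C.Hom X Y 0} {g : C.Hom Y X 0}
    {a : C.Hom X X 0} {b : C.Hom Y Y 0}
    (ha : C.IsInverse (C.comp (add_zero 0) g f) a) (hb : C.IsInverse (C.comp (add_zero 0) f g) b) :
    ∃ h, C.IsInverse f h := by
  refine ⟨C.comp (add_zero 0) a g, C.isInverse_of_comp (h := C.comp (add_zero 0) g b) ?_ ?_⟩
  · rw [C.assoc (add_zero 0) (add_zero 0) (add_zero 0) (add_zero 0)]
    exact ha.1
  · rw [← C.assoc (add_zero 0) (add_zero 0) (add_zero 0) (add_zero 0)]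
    exact hb.2

theorem IsInverse.comp {C : GrCat.{u, v, w} 𝕜 N} {X Y Z : C.Obj} {f : C.Hom X Y 0}
    {g : C.Hom Y X 0} {f' : C.Hom Y Z 0} {g' : C.Hom Z Y 0} (h : C.IsInverse f g)
    (h' : C.IsInverse f' g') :
    C.IsInverse (C.comp (add_zero 0) f' f) (C.comp (add_zero 0) g g') := by
  constructor
  · rw [C.assoc (add_zero 0) (add_zero 0) (add_zero 0) (add_zero 0)]
    have := C.comp_left_cancel h' f
    rw [this, h.1]
  · rw [C.assoc (add_zero 0) (add_zero 0) (add_zero 0) (add_zero 0)]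
    have := C.comp_left_cancel h.symm g'
    rw [this, h'.2]

/-- Transport of morphisms along isomorphisms of the source and of the target. -/
def conj {X Y X' Y' : C.Obj} (k : ZMod N) (g : C.Hom Y Y' 0) (f : C.Hom X' X 0) :
    C.Hom X Y k →ₗ[𝕜] C.Hom X' Y' k :=
  ((C.comp (add_zero k)).flip f) ∘ₗ C.comp (zero_add k) g

theorem conj_apply {X Y X' Y' : C.Obj} {k : ZMod N} (g : C.Hom Y Y' 0) (f : C.Hom X' X 0)
    (x : C.Hom X Y k) :
    C.conj k g f x = C.comp (add_zero k) (C.comp (zero_add k) g x) f := rfl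

theorem conj_conj {X Y X' Y' : C.Obj} {k : ZMod N} {g : C.Hom Y Y' 0} {g' : C.Hom Y' Y 0}
    {f : C.Hom X' X 0} {f' : C.Hom X X' 0} (hg : C.IsInverse g g') (hf : C.IsInverse f f')
    (x : C.Hom X Y k) : C.conj k g' f' (C.conj k g f x) = x := by
  rw [conj_apply, conj_apply, ← C.assoc (zero_add k) (add_zero k) (add_zero k) (zero_add k),
    C.comp_left_cancel hg, C.comp_right_cancel hf.symm]

theorem conj_bijective {X Y X' Y' : C.Obj} (k : ZMod N) {g : C.Hom Y Y' 0} {g' : C.Hom Y' Y 0}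
    {f : C.Hom X' X 0} {f' : C.Hom X X' 0} (hg : C.IsInverse g g') (hf : C.IsInverse f f') :
    Function.Bijective (C.conj k g f : C.Hom X Y k → C.Hom X' Y' k) :=
  Function.bijective_iff_has_inverse.2 ⟨C.conj k g' f', C.conj_conj hg hf,
    C.conj_conj hg.symm hf.symm⟩

theorem conj_id {X X' : C.Obj} {g : C.Hom X X' 0} {g' : C.Hom X' X 0} (hg : C.IsInverse g g') :
    C.conj 0 g g' (C.id X) = C.id X' := by
  rw [conj_apply]
  have := C.comp_id g
  rw [this, hg.2]

theorem conj_comp {X Y Z X' Y' Z' : C.Obj} {j k l : ZMod N} (h : j + k = l) {a : C.Hom X' X 0}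
    {b : C.Hom Y' Y 0} {b' : C.Hom Y Y' 0} {c : C.Hom Z Z' 0} (hb : C.IsInverse b b')
    (y : C.Hom Y Z j) (x : C.Hom X Y k) :
    C.conj l c a (C.comp h y x) = C.comp h (C.conj j c b y) (C.conj k b' a x) := by
  simp only [conj_apply]
  rw [← C.assoc (zero_add j) h h (zero_add l), C.assoc h (add_zero k) (add_zero l) h,
    C.assoc (zero_add k) (add_zero k) (add_zero k) (zero_add k),
    ← C.assoc (add_zero j) (zero_add k) h h, C.comp_right_cancel hb.symm]

end GrCat

/-- A functor that is bijective on morphisms of all degrees. -/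
def GrFunctor.FullyFaithful {C : GrCat.{u, v, w} 𝕜 N} {D : GrCat.{u, v', w'} 𝕜 N}
    {a : C.Obj → D.Obj} (F : GrFunctor C D a) : Prop :=
  ∀ (X Y : C.Obj) (k : ZMod N),
    Function.Bijective (F.map : C.Hom X Y k →ₗ[𝕜] D.Hom (a X) (a Y) k)

section FullyFaithful

variable {C : GrCat.{u, v, w} 𝕜 N} {D : GrCat.{u, v', w'} 𝕜 N} {a : C.Obj → D.Obj}
  {F : GrFunctor C D a} (hF : F.FullyFaithful)

/-- The inverse of a fully faithful functor on morphisms. -/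
noncomputable def GrFunctor.FullyFaithful.preimage (X Y : C.Obj) (k : ZMod N) :
    D.Hom (a X) (a Y) k →ₗ[𝕜] C.Hom X Y k :=
  (LinearEquiv.ofBijective _ (hF X Y k)).symm.toLinearMap

theorem GrFunctor.FullyFaithful.map_preimage {X Y : C.Obj} {k : ZMod N}
    (f : D.Hom (a X) (a Y) k) : F.map (hF.preimage X Y k f) = f :=
  (LinearEquiv.ofBijective _ (hF X Y k)).apply_symm_apply f

theorem GrFunctor.FullyFaithful.preimage_bijective (X Y : C.Obj) (k : ZMod N) :
    Function.Bijective (hF.preimage X Y k) :=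
  (LinearEquiv.ofBijective _ (hF X Y k)).symm.bijective

theorem GrFunctor.FullyFaithful.isInverse {X Y : C.Obj} {f : D.Hom (a X) (a Y) 0}
    {g : D.Hom (a Y) (a X) 0} (h : D.IsInverse f g) :
    C.IsInverse (hF.preimage X Y 0 f) (hF.preimage Y X 0 g) := by
  constructor
  · apply (hF _ _ _).1
    rw [F.map_comp, hF.map_preimage, hF.map_preimage, h.1, F.map_id]
  · apply (hF _ _ _).1
    rw [F.map_comp, hF.map_preimage, hF.map_preimage, h.2, F.map_id]

end FullyFaithful

/-- The lift of a functor `F` through a fully faithful functor `G`, along isomorphisms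
`G (o X) ≅ F X`. -/
noncomputable def GrFunctor.lift {C : GrCat.{u, v, w} 𝕜 N} {D : GrCat.{u, v', w'} 𝕜 N}
    {S : GrCat.{u, v, w} 𝕜 N} {a : C.Obj → S.Obj} {b : D.Obj → S.Obj} {o : C.Obj → D.Obj}
    (F : GrFunctor C S a) {G : GrFunctor D S b} (hG : G.FullyFaithful)
    (θ : ∀ X, S.Hom (b (o X)) (a X) 0) (θ' : ∀ X, S.Hom (a X) (b (o X)) 0)
    (hθ : ∀ X, S.IsInverse (θ X) (θ' X)) : GrFunctor C D o where
  map {X Y k} := hG.preimage _ _ k ∘ₗ S.conj k (θ' Y) (θ X) ∘ₗ F.map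
  map_id X := by
    apply (hG _ _ _).1
    simp only [LinearMap.comp_apply, hG.map_preimage, F.map_id, G.map_id]
    exact S.conj_id (hθ X).symm
  map_comp {X Y Z j k l} h g f := by
    apply (hG _ _ _).1
    simp only [LinearMap.comp_apply, hG.map_preimage, F.map_comp, G.map_comp]
    exact S.conj_comp h (hθ Y) _ _

section Lift

variable {C : GrCat.{u, v, w} 𝕜 N} {D : GrCat.{u, v', w'} 𝕜 N}
    {S : GrCat.{u, v, w} 𝕜 N} {a : C.Obj → S.Obj} {b : D.Obj → S.Obj} {o : C.Obj → D.Obj}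
    {F : GrFunctor C S a} {G : GrFunctor D S b} (hF : F.FullyFaithful) (hG : G.FullyFaithful)
    {θ : ∀ X, S.Hom (b (o X)) (a X) 0} {θ' : ∀ X, S.Hom (a X) (b (o X)) 0}
    (hθ : ∀ X, S.IsInverse (θ X) (θ' X))

/-- Under `G` the lift becomes `F` conjugated by the isomorphisms, so these are natural. Besides
giving quasi-inverses, the square identifies the maps that the lift induces. -/
theorem GrFunctor.comp_map_lift {X Y : C.Obj} {k : ZMod N} (f : C.Hom X Y k) :
    S.comp (zero_add k) (θ Y) (G.map ((F.lift hG θ θ' hθ).map f))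
      = S.comp (add_zero k) (F.map f) (θ X) := by
  simp only [GrFunctor.lift, LinearMap.comp_apply, hG.map_preimage, GrCat.conj_apply]
  rw [← S.assoc (zero_add k) (add_zero k) (add_zero k) (zero_add k),
    S.comp_left_cancel (hθ Y).symm]

include hF in
theorem GrFunctor.fullyFaithful_lift : (F.lift hG θ θ' hθ).FullyFaithful := fun X Y k => by
  have := (hG.preimage_bijective _ _ k).comp
    ((S.conj_bijective k (hθ Y).symm (hθ X)).comp (hF X Y k))
  exact this

end Lift

/-- A fully faithful and essentially surjective functor has a quasi-inverse. -/
theorem GrFunctor.IsEquivalence.isEquivalent {C : GrCat.{u, v, w} 𝕜 N} {D : GrCat.{u, v, w} 𝕜 N}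
    {a : C.Obj → D.Obj} {F : GrFunctor C D a} (h : F.IsEquivalence) : D.IsEquivalent C := by
  obtain ⟨hF, hs⟩ := h
  have hF : F.FullyFaithful := hF
  choose b f g hfg using hs
  -- A quasi-inverse is the lift of the identity functor through `F`. Its naturality square is one
  -- of the two isomorphisms; the other is obtained on the objects `a X` and reflected by `F`.
  let G : GrFunctor D C b := (GrFunctor.refl D).lift hF f g hfg
  have hG : ∀ {X Y : D.Obj} {k : ZMod N} (x : D.Hom X Y k),
      D.comp (zero_add k) (f Y) (F.map (G.map x)) = D.comp (add_zero k) x (f X) := fun x =>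
    GrFunctor.comp_map_lift hF hfg x
  refine ⟨b, a, G, F, ⟨f, g, hfg, fun X Y k x => hG x⟩,
    ⟨fun X => hF.preimage _ _ 0 (f (a X)), fun X => hF.preimage _ _ 0 (g (a X)),
      fun X => hF.isInverse (hfg (a X)), fun X Y k x => ?_⟩⟩
  apply (hF _ _ _).1
  rw [F.map_comp, F.map_comp, hF.map_preimage, hF.map_preimage]
  exact hG (F.map x)

end GrCat

/-! ### Strict dg functors and their action on cohomology -/

section DGFun

variable {𝕜 : Type u} [Field 𝕜] {N : ℕ}

/-- A strict functor of dg categories. -/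
structure DGFun (C : DGCat.{u, v, w} 𝕜 N) (D : DGCat.{u, v', w'} 𝕜 N) where
  obj : C.Obj → D.Obj
  map : ∀ {X Y : C.Obj}, C.Hom X Y →ₗ[𝕜] D.Hom (obj X) (obj Y)
  map_mem : ∀ {X Y : C.Obj} {k : ZMod N} {f : C.Hom X Y}, f ∈ C.hom X Y k →
    map f ∈ D.hom (obj X) (obj Y) k
  map_id : ∀ X, map (C.id X) = D.id (obj X)
  map_comp : ∀ {X Y Z : C.Obj} (g : C.Hom Y Z) (f : C.Hom X Y),
    map (C.comp g f) = D.comp (map g) (map f)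
  map_d : ∀ {X Y : C.Obj} {k : ZMod N} {f : C.Hom X Y}, f ∈ C.hom X Y k →
    map (C.d k f) = D.d k (map f)

namespace DGFun

variable {C : DGCat.{u, v, w} 𝕜 N} {D : DGCat.{u, v', w'} 𝕜 N} (F : DGFun C D)

theorem map_mem_Z {X Y : C.Obj} {k : ZMod N} (f : C.Hom X Y) (hf : f ∈ C.Z X Y k) :
    F.map f ∈ D.Z (F.obj X) (F.obj Y) k :=
  ⟨F.map_mem hf.1, LinearMap.mem_ker.2 (by
    rw [← F.map_d hf.1, LinearMap.mem_ker.1 hf.2, _root_.map_zero])⟩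

/-- The induced map on cohomology classes of morphisms. -/
def cohMap (X Y : C.Obj) (k : ZMod N) : C.Coh X Y k →ₗ[𝕜] D.Coh (F.obj X) (F.obj Y) k :=
  Submodule.mapQ _ _ (F.map.restrict F.map_mem_Z) (by
    rintro ⟨_, hf⟩ ⟨h, hh, rfl⟩
    exact ⟨F.map h, F.map_mem hh, (F.map_d hh).symm⟩)

/-- The induced functor on cohomology. -/
def coh : GrFunctor C.cohomology D.cohomology F.obj where
  map {X Y k} := F.cohMap X Y k
  map_id X := congrArg D.cls (Subtype.ext (F.map_id X))
  map_comp h g f := by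
    obtain ⟨g, rfl⟩ := Submodule.mkQ_surjective _ g
    obtain ⟨f, rfl⟩ := Submodule.mkQ_surjective _ f
    exact congrArg D.cls (Subtype.ext (F.map_comp g.1 f.1))

theorem fullyFaithful_coh
    (surj : ∀ {X Y : C.Obj} {k : ZMod N}, ∀ g ∈ D.Z (F.obj X) (F.obj Y) k, ∃ f ∈ C.Z X Y k,
      F.map f - g ∈ D.B (F.obj X) (F.obj Y) k)
    (inj : ∀ {X Y : C.Obj} {k : ZMod N}, ∀ f ∈ C.Z X Y k, F.map f ∈ D.B (F.obj X) (F.obj Y) k →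
      f ∈ C.B X Y k) : F.coh.FullyFaithful := by
  intro X Y k
  suffices Function.Bijective (F.cohMap X Y k) from this
  constructor
  · refine (injective_iff_map_eq_zero (F.cohMap X Y k)).2 fun f hf => ?_
    obtain ⟨f, rfl⟩ := Submodule.mkQ_surjective _ f
    have h : (⟨F.map f.1, F.map_mem_Z _ f.2⟩ : D.Z (F.obj X) (F.obj Y) k)
        ∈ (D.B (F.obj X) (F.obj Y) k).submoduleOf (D.Z (F.obj X) (F.obj Y) k) :=
      (Submodule.Quotient.mk_eq_zero _).1 hf
    exact (Submodule.Quotient.mk_eq_zero _).2 (inj f.1 f.2 h)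
  · intro g
    obtain ⟨g, rfl⟩ := Submodule.mkQ_surjective _ g
    obtain ⟨f, hf, h⟩ := surj g.1 g.2
    exact ⟨C.cls ⟨f, hf⟩, (Submodule.Quotient.eq _).2 h⟩

/-- A dg functor that is surjective on morphisms, with acyclic kernels, is fully faithful on
cohomology. -/
theorem fullyFaithful_coh_of_kernel
    (surj : ∀ {X Y : C.Obj} {k : ZMod N}, ∀ g ∈ D.hom (F.obj X) (F.obj Y) k,
      ∃ f ∈ C.hom X Y k, F.map f = g)
    (ker : ∀ {X Y : C.Obj} {k : ZMod N}, ∀ f ∈ C.Z X Y k, F.map f = 0 →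
      ∃ s ∈ C.hom X Y (k - 1), F.map s = 0 ∧ C.d (k - 1) s = f) : F.coh.FullyFaithful := by
  refine F.fullyFaithful_coh (fun {X Y k} g hg => ?_) fun {X Y k} f hf h => ?_
  · obtain ⟨f, hf, rfl⟩ := surj g hg.1
    -- A lift of a closed morphism need not be closed, but its differential is a closed element of
    -- the kernel; a primitive within the kernel corrects the lift without changing its image.
    obtain ⟨s, hs, hs0, hs1⟩ := ker (k := k + 1) (C.d k f) ⟨C.d_mem hf, C.d_d hf⟩ (by
      rw [F.map_d hf]
      exact hg.2)
    rw [add_sub_cancel_right] at hs hs1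
    refine ⟨f - s, ⟨sub_mem hf hs, ?_⟩, ?_⟩
    · change C.d k (f - s) = 0
      rw [map_sub, hs1, sub_self]
    · rw [map_sub, hs0, sub_zero, sub_self]
      exact zero_mem _
  · obtain ⟨g, hg, hgf⟩ := h
    obtain ⟨t, ht, rfl⟩ := surj g hg
    have hdt : C.d (k - 1) t ∈ C.hom X Y k := by
      have := C.d_mem ht
      rwa [sub_add_cancel] at this
    have hdd : C.d k (C.d (k - 1) t) = 0 := by
      have := C.d_d ht
      rwa [sub_add_cancel] at this
    -- A lift of the primitive of the image is a primitive of `f` up to a closed element of the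
    -- kernel.
    obtain ⟨s, hs, -, hs1⟩ := ker (f - C.d (k - 1) t) ⟨sub_mem hf.1 hdt, by
      change C.d k (f - C.d (k - 1) t) = 0
      rw [map_sub, hdd, LinearMap.mem_ker.1 hf.2, sub_zero]⟩ (by
      rw [map_sub, F.map_d ht, hgf, sub_self])
    exact ⟨t + s, add_mem ht hs, by rw [_root_.map_add, hs1, add_sub_cancel]⟩

end DGFun

end DGFun

end AInf

namespace AInf

set_option linter.unusedSectionVars false

/-! ### The dg category of complexes with an operator -/

section Twist

variable {𝕜 : Type u} [Field 𝕜] {N : ℕ}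

/-- The linear maps of degree `k`. -/
def GVec.degHom (V W : GVec 𝕜 N) (k : ZMod N) : Submodule 𝕜 (V →ₗ[𝕜] W) where
  carrier := {f | ∀ g, ∀ x ∈ V.deg g, f x ∈ W.deg (g + k)}
  add_mem' hf hf' g x hx := add_mem (hf g x hx) (hf' g x hx)
  zero_mem' _ _ _ := zero_mem _
  smul_mem' c _ hf g x hx := Submodule.smul_mem _ c (hf g x hx)

theorem GVec.comp_mem_degHom {V W X : GVec 𝕜 N} {j k l : ZMod N} {g : W →ₗ[𝕜] X} {f : V →ₗ[𝕜] W}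
    (hg : g ∈ W.degHom X j) (hf : f ∈ V.degHom W k) (h : j + k = l) :
    g ∘ₗ f ∈ V.degHom X l := fun i x hx => by
  rw [← h, show i + (j + k) = i + k + j by ring]
  exact hg _ _ (hf _ _ hx)

/-- A complex with an endomorphism `U` of degree `δ` that anticommutes with the differential. -/
structure TwistObj (𝕜 : Type u) [Field 𝕜] (N : ℕ) (δ : ZMod N) extends GVec 𝕜 N where
  d : carrier →ₗ[𝕜] carrier
  U : carrier →ₗ[𝕜] carrier
  d_mem : d ∈ toGVec.degHom toGVec 1
  U_mem : U ∈ toGVec.degHom toGVec δ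
  d_d : ∀ x, d (d x) = 0
  d_U : ∀ x, d (U x) + U (d x) = 0

namespace TwistObj

variable {δ : ZMod N} (X Y Z : TwistObj 𝕜 N δ)

instance : CoeSort (TwistObj 𝕜 N δ) (Type u) := ⟨fun X => X.carrier⟩

/-- Pairs of linear maps: a map and a homotopy for its compatibility with `U`. -/
abbrev Hom : Type u := (X →ₗ[𝕜] Y) × (X →ₗ[𝕜] Y)

/-- The morphisms of degree `k`. -/
def hom (k : ZMod N) : Submodule 𝕜 (Hom X Y) :=
  (X.degHom Y.toGVec k).prod (X.degHom Y.toGVec (k + δ - 1))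

variable {X Y Z}

/-- The composite of two morphisms. -/
def comp : Hom Y Z →ₗ[𝕜] Hom X Y →ₗ[𝕜] Hom X Z :=
  LinearMap.mk₂ 𝕜 (fun g f => (g.1 ∘ₗ f.1, g.2 ∘ₗ f.1 + g.1 ∘ₗ f.2))
    (fun g g' f => Prod.ext (LinearMap.add_comp _ _ _) (by
      simp only [Prod.fst_add, Prod.snd_add, LinearMap.add_comp]; abel))
    (fun c g f => Prod.ext rfl (by
      simp only [Prod.smul_fst, Prod.smul_snd, LinearMap.smul_comp, smul_add]))
    (fun g f f' => Prod.ext (LinearMap.comp_add _ _ _) (by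
      simp only [Prod.fst_add, Prod.snd_add, LinearMap.comp_add]; abel))
    (fun c g f => Prod.ext (LinearMap.comp_smul _ _ _) (by
      simp only [Prod.smul_fst, Prod.smul_snd, LinearMap.comp_smul, smul_add]))

theorem comp_fst (g : Hom Y Z) (f : Hom X Y) : (comp g f).1 = g.1 ∘ₗ f.1 := rfl

theorem comp_snd (g : Hom Y Z) (f : Hom X Y) :
    (comp g f).2 = g.2 ∘ₗ f.1 + g.1 ∘ₗ f.2 := rfl

/-- The differential on morphisms of degree `k`. -/
def D (k : ZMod N) : Hom X Y →ₗ[𝕜] Hom X Y where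
  toFun f := (Y.d ∘ₗ f.1 - sgn 𝕜 k • (f.1 ∘ₗ X.d),
    Y.d ∘ₗ f.2 + Y.U ∘ₗ f.1 - sgn 𝕜 k • (f.2 ∘ₗ X.d + f.1 ∘ₗ X.U))
  map_add' f f' := Prod.ext
    (by simp only [Prod.fst_add, LinearMap.comp_add, LinearMap.add_comp, smul_add]; abel)
    (by simp only [Prod.fst_add, Prod.snd_add, LinearMap.comp_add, LinearMap.add_comp, smul_add]
        abel)
  map_smul' c f := Prod.ext
    (by simp only [Prod.smul_fst, LinearMap.comp_smul, LinearMap.smul_comp, smul_sub,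
          RingHom.id_apply, smul_comm (sgn 𝕜 k) c])
    (by simp only [Prod.smul_fst, Prod.smul_snd, LinearMap.comp_smul, LinearMap.smul_comp,
          smul_sub, smul_add, RingHom.id_apply, smul_comm (sgn 𝕜 k) c])

theorem D_fst_apply (k : ZMod N) (f : Hom X Y) (x : X) :
    (D k f).1 x = Y.d (f.1 x) - sgn 𝕜 k • f.1 (X.d x) := rfl

theorem D_snd_apply (k : ZMod N) (f : Hom X Y) (x : X) :
    (D k f).2 x = Y.d (f.2 x) + Y.U (f.1 x) - sgn 𝕜 k • (f.2 (X.d x) + f.1 (X.U x)) := rfl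

theorem D_mem {k : ZMod N} {f : Hom X Y} (hf : f ∈ hom X Y k) : D k f ∈ hom X Y (k + 1) := by
  refine ⟨sub_mem ?_ (Submodule.smul_mem _ _ ?_), sub_mem (add_mem ?_ ?_)
    (Submodule.smul_mem _ _ (add_mem ?_ ?_))⟩
  · exact GVec.comp_mem_degHom Y.d_mem hf.1 (add_comm _ _)
  · exact GVec.comp_mem_degHom hf.1 X.d_mem rfl
  · exact GVec.comp_mem_degHom Y.d_mem hf.2 (by ring)
  · exact GVec.comp_mem_degHom Y.U_mem hf.1 (by ring)
  · exact GVec.comp_mem_degHom hf.2 X.d_mem (by ring)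
  · exact GVec.comp_mem_degHom hf.1 X.U_mem (by ring)

variable [Fact (Even N)]

theorem D_D (k : ZMod N) (f : Hom X Y) : D (k + 1) (D k f) = 0 := by
  have h1 : ∀ y : Y, Y.U (Y.d y) = -Y.d (Y.U y) := fun y =>
    (neg_eq_of_add_eq_zero_right (Y.d_U y)).symm
  have h2 : ∀ x : X, f.1 (X.U (X.d x)) = -f.1 (X.d (X.U x)) := fun x => by
    rw [← map_neg, ← neg_eq_of_add_eq_zero_right (X.d_U x)]
  refine Prod.ext (LinearMap.ext fun x => ?_) (LinearMap.ext fun x => ?_)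
  · simp only [D_fst_apply, map_sub, map_smul, X.d_d, Y.d_d, map_zero, sgn_add, sgn_one,
      Prod.fst_zero, LinearMap.zero_apply]
    module
  · simp only [D_fst_apply, D_snd_apply, map_sub, map_add, map_smul, X.d_d, Y.d_d, map_zero,
      sgn_add, sgn_one, Prod.snd_zero, LinearMap.zero_apply, h1, h2]
    module

theorem D_comp {j k : ZMod N} (g : Hom Y Z) (f : Hom X Y) :
    D (j + k) (comp g f) = comp (D j g) f + sgn 𝕜 j • comp g (D k f) := by
  refine Prod.ext (LinearMap.ext fun x => ?_) (LinearMap.ext fun x => ?_)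
  · simp only [D_fst_apply, comp_fst, LinearMap.comp_apply, Prod.fst_add, Prod.smul_fst,
      LinearMap.add_apply, LinearMap.smul_apply, map_sub, map_smul, sgn_add]
    module
  · simp only [D_fst_apply, D_snd_apply, comp_fst, comp_snd, LinearMap.comp_apply, Prod.snd_add,
      Prod.smul_snd, LinearMap.add_apply, LinearMap.smul_apply, map_sub, map_add, map_smul, sgn_add]
    module

end TwistObj

/-- The dg category of complexes with an operator. -/
noncomputable def twistDG (𝕜 : Type u) [Field 𝕜] (N : ℕ) [Fact (Even N)] (δ : ZMod N) :
    DGCat.{u, u + 1, u} 𝕜 N where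
  Obj := TwistObj 𝕜 N δ
  Hom := TwistObj.Hom
  hom := TwistObj.hom
  id X := (LinearMap.id, 0)
  id_mem X := ⟨fun g x hx => by simpa using hx, zero_mem _⟩
  comp := TwistObj.comp
  comp_mem hg hf := ⟨GVec.comp_mem_degHom hg.1 hf.1 rfl,
    add_mem (GVec.comp_mem_degHom hg.2 hf.1 (by ring)) (GVec.comp_mem_degHom hg.1 hf.2 (by ring))⟩
  id_comp f := Prod.ext rfl (by
    change (0 : _ →ₗ[𝕜] _) ∘ₗ f.1 + LinearMap.id ∘ₗ f.2 = f.2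
    rw [LinearMap.zero_comp, LinearMap.id_comp, zero_add])
  comp_id f := Prod.ext rfl (by
    change f.2 ∘ₗ LinearMap.id + f.1 ∘ₗ (0 : _ →ₗ[𝕜] _) = f.2
    rw [LinearMap.comp_zero, LinearMap.comp_id, add_zero])
  assoc f g h := Prod.ext rfl (by
    simp only [TwistObj.comp_fst, TwistObj.comp_snd, LinearMap.add_comp, LinearMap.comp_add,
      LinearMap.comp_assoc]
    abel)
  d := TwistObj.D
  d_mem := TwistObj.D_mem
  d_d _ := TwistObj.D_D _ _
  d_comp _ _ := TwistObj.D_comp _ _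

section Whitehead

variable [Fact (Even N)] {δ : ZMod N} {X Y : TwistObj 𝕜 N δ}

/-- A chain map between complexes over a field that vanishes on cohomology is null-homotopic. -/
theorem exists_homotopy {X Y : GVec 𝕜 N} {dX : X →ₗ[𝕜] X} {dY : Y →ₗ[𝕜] Y}
    (hX : dX ∈ X.degHom X 1) (hXX : ∀ x, dX (dX x) = 0)
    {k : ZMod N} {ε : 𝕜} (hε : ε * ε = 1) {f : X →ₗ[𝕜] Y} (hf : f ∈ X.degHom Y k)
    (hfd : ∀ x, dY (f x) = ε • f (dX x))
    (h0 : ∀ x, dX x = 0 → ∃ y, f x = dY y) (hY : dY ∈ Y.degHom Y 1) :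
    ∃ s ∈ X.degHom Y (k - 1), ∀ x, f x = dY (s x) + ε • s (dX x) := by
  obtain ⟨s, hs, hs'⟩ := X.exists_nullhomotopy dX hX hXX Y.deg (fun _ => dY) k ε hε f hf (fun g x hx => hfd x) (fun g x hx hd => by
      obtain ⟨y, hy⟩ := h0 x hd
      refine ⟨Y.proj (g + (k - 1)) y, Y.proj_mem _ _, ?_⟩
      have := GVec.d_proj hY (g + (k - 1)) y
      rw [this, ← hy, show g + (k - 1) + 1 = g + k by ring, Y.proj_of_mem (hf g x hx)])
  refine ⟨s, hs, fun x => ?_⟩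
  induction x using internal_induction X.internal with
  | hom g x hx => exact hs' g x hx
  | zero => simp
  | add a b ha hb => simp only [map_add, ha, hb, smul_add]; abel

end Whitehead

end Twist

end AInf

namespace AInf

set_option linter.unusedSectionVars false

/-! ### A Whitehead theorem for complexes with an operator -/

section Whitehead

variable {𝕜 : Type u} [Field 𝕜] {N : ℕ} [Fact (Even N)] {δ : ZMod N} {X Y : TwistObj 𝕜 N δ}

theorem TwistObj.d_fst {k : ZMod N} {f : TwistObj.Hom X Y} (hf : TwistObj.D k f = 0) (x : X) :
    Y.d (f.1 x) = sgn 𝕜 k • f.1 (X.d x) := by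
  have := LinearMap.congr_fun (congrArg Prod.fst hf) x
  rw [TwistObj.D_fst_apply] at this
  exact sub_eq_zero.1 this

theorem TwistObj.d_snd {k : ZMod N} {f : TwistObj.Hom X Y} (hf : TwistObj.D k f = 0) (x : X) :
    Y.d (f.2 x) + Y.U (f.1 x) = sgn 𝕜 k • (f.2 (X.d x) + f.1 (X.U x)) := by
  have := LinearMap.congr_fun (congrArg Prod.snd hf) x
  rw [TwistObj.D_snd_apply] at this
  exact sub_eq_zero.1 this

theorem TwistObj.mem_Z {k : ZMod N} {f : TwistObj.Hom X Y} (hf : f ∈ TwistObj.hom X Y k)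
    (h1 : ∀ x, Y.d (f.1 x) = sgn 𝕜 k • f.1 (X.d x))
    (h2 : ∀ x, Y.d (f.2 x) + Y.U (f.1 x) = sgn 𝕜 k • (f.2 (X.d x) + f.1 (X.U x))) :
    f ∈ (twistDG 𝕜 N δ).Z X Y k :=
  ⟨hf, Prod.ext (LinearMap.ext fun x => sub_eq_zero.2 (h1 x))
    (LinearMap.ext fun x => sub_eq_zero.2 (h2 x))⟩

/-- Closed morphisms that are homologous to the identity on the underlying complexes are
invertible. -/
theorem exists_isInverse_of_unipotent (e : (twistDG 𝕜 N δ).Z X X 0)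
    (h : ∀ x, X.d x = 0 → ∃ y, e.1.1 x - x = X.d y) :
    ∃ e', (twistDG 𝕜 N δ).cohomology.IsInverse ((twistDG 𝕜 N δ).cls e) e' := by
  obtain ⟨⟨a, z'⟩, ⟨ha, hz'⟩, hD⟩ := e
  have hD : TwistObj.D 0 (a, z') = 0 := hD
  have hda : ∀ x, X.d (a x) = a (X.d x) := fun x => by
    have := TwistObj.d_fst hD x
    rwa [sgn_zero, one_smul] at this
  obtain ⟨s, hs, hsa⟩ := exists_homotopy (f := a - LinearMap.id) X.d_mem X.d_d (one_mul (1 : 𝕜))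
    (sub_mem ha fun g x hx => by simpa using hx) (fun x => by simp [hda]) h X.d_mem
  -- up to homotopy, the first component is the identity
  let t : TwistObj.Hom X X := (s, 0)
  have ht : t ∈ TwistObj.hom X X (0 - 1) := ⟨hs, zero_mem _⟩
  have hs1 : sgn 𝕜 (0 - 1 : ZMod N) = -1 := by rw [sgn_sub_one, sgn_zero]
  have ht1 : (TwistObj.D (0 - 1) t).1 = a - LinearMap.id := by
    ext x
    rw [TwistObj.D_fst_apply, hsa, hs1]
    simp [t]
  let z := z' - (TwistObj.D (0 - 1) t).2
  have hDt : TwistObj.D (0 - 1) t ∈ TwistObj.hom X X 0 := by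
    have := TwistObj.D_mem ht
    rwa [sub_add_cancel] at this
  have hDDt : TwistObj.D 0 (TwistObj.D (0 - 1) t) = 0 := by
    have := TwistObj.D_D (0 - 1) t
    rwa [sub_add_cancel] at this
  have hez : ((LinearMap.id, z) : TwistObj.Hom X X) = (a, z') - TwistObj.D (0 - 1) t :=
    Prod.ext (by rw [Prod.fst_sub, ht1, sub_sub_cancel]) rfl
  have hz : z ∈ X.degHom X.toGVec (0 + δ - 1) := sub_mem hz' hDt.2
  have hDz : TwistObj.D 0 ((LinearMap.id, z) : TwistObj.Hom X X) = 0 := by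
    rw [hez, map_sub, hD, hDDt, sub_zero]
  have hdz : ∀ x, X.d (z x) = z (X.d x) := fun x => by
    have := TwistObj.d_snd hDz x
    rw [sgn_zero, one_smul] at this
    exact add_right_cancel this
  have hid : (LinearMap.id : X →ₗ[𝕜] X) ∈ X.degHom X.toGVec 0 := fun g x hx => by simpa using hx
  have hmem : ∀ y ∈ X.degHom X.toGVec (0 + δ - 1), (∀ x, X.d (y x) = y (X.d x)) →
      ((LinearMap.id, y) : TwistObj.Hom X X) ∈ (twistDG 𝕜 N δ).Z X X 0 := fun y hy hdy =>
    TwistObj.mem_Z ⟨hid, hy⟩ (fun x => by rw [sgn_zero, one_smul]; rfl)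
      (fun x => by rw [sgn_zero, one_smul, hdy]; rfl)
  let e₁ : (twistDG 𝕜 N δ).Z X X 0 := ⟨(LinearMap.id, z), hmem z hz hdz⟩
  -- Composition has no term quadratic in the second components, so `(1, z)` and `(1, -z)` are
  -- inverse to each other exactly.
  let e₂ : (twistDG 𝕜 N δ).Z X X 0 := ⟨(LinearMap.id, -z), hmem (-z) (neg_mem hz) fun x => by
    simp [hdz]⟩
  have hcls : (twistDG 𝕜 N δ).cls ⟨(a, z'), ⟨ha, hz'⟩, hD⟩ = (twistDG 𝕜 N δ).cls e₁ :=
    (Submodule.Quotient.eq _).2 ⟨t, ht, by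
      change TwistObj.D (0 - 1) t = (a, z') - (LinearMap.id, z)
      rw [hez, sub_sub_cancel]⟩
  refine ⟨(twistDG 𝕜 N δ).cls e₂, ?_⟩
  rw [hcls]
  constructor
  · exact congrArg (twistDG 𝕜 N δ).cls (Subtype.ext (Prod.ext rfl (by
      change (-z) ∘ₗ LinearMap.id + LinearMap.id ∘ₗ z = 0
      simp)))
  · exact congrArg (twistDG 𝕜 N δ).cls (Subtype.ext (Prod.ext rfl (by
      change z ∘ₗ LinearMap.id + LinearMap.id ∘ₗ (-z) = 0
      simp)))

/-- A chain map between complexes over a field that is bijective on cohomology has an inverse up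
to homotopy, which factors through the cohomology. -/
theorem exists_quasi_inverse {X Y : GVec 𝕜 N} {dX : X →ₗ[𝕜] X} {dY : Y →ₗ[𝕜] Y}
    (hX : dX ∈ X.degHom X 1) (hXX : ∀ x, dX (dX x) = 0) (hY : dY ∈ Y.degHom Y 1)
    (hYY : ∀ y, dY (dY y) = 0) {f : X →ₗ[𝕜] Y} (hf : f ∈ X.degHom Y 0)
    (hfd : ∀ x, dY (f x) = f (dX x)) (inj : ∀ x, dX x = 0 → ∀ y, f x = dY y → ∃ x', x = dX x')
    (surj : ∀ y, dY y = 0 → ∃ x z, dX x = 0 ∧ f x = y + dY z) :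
    ∃ g ∈ Y.degHom X 0, (∀ y, dX (g y) = 0) ∧ (∀ y, g (dY y) = 0) ∧
      (∀ y, dY y = 0 → ∃ z, f (g y) - y = dY z) ∧ ∀ x, dX x = 0 → ∃ z, g (f x) - x = dX z := by
  obtain ⟨i, p, hi, hpi, hid, hpd, hp0, hex, -⟩ := exists_section X dX hX hXX
  obtain ⟨j, q, hj, hqj, hjd, hqd, hq0, hex', -⟩ := exists_section Y dY hY hYY
  have hqf : ∀ x, dX x = 0 → q (f (i (p x))) = q (f x) := fun x hx => by
    obtain ⟨b, hb⟩ := hex (x - i (p x)) (by rw [map_sub, hx, hi, sub_zero])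
      (by rw [map_sub, hpi, sub_self])
    have h := congrArg (fun y => q (f y)) hb
    simp only [← hfd, hq0, map_sub] at h
    exact (sub_eq_zero.1 h).symm
  -- The induced map on cohomology. With its inverse `G`, the map `i G q` has values in cocycles and
  -- kills coboundaries, so it is a chain map that factors through the cohomology.
  let F : CohOf dX →ₗ[𝕜] CohOf dY := q ∘ₗ f ∘ₗ i
  have hF : Function.Bijective F := by
    constructor
    · refine (injective_iff_map_eq_zero F).2 fun v hv => ?_
      obtain ⟨y, hy⟩ := hex' (f (i v)) (by rw [hfd, hi, map_zero]) hv
      obtain ⟨x', hx'⟩ := inj _ (hi v) y hy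
      rw [← hpi v, hx', hp0]
    · intro w
      obtain ⟨x, z, hx, hxz⟩ := surj (j w) (hj w)
      refine ⟨p x, ?_⟩
      change q (f (i (p x))) = w
      rw [hqf x hx, hxz, map_add, hqj, hq0, add_zero]
  let G : CohOf dY →ₗ[𝕜] CohOf dX := (LinearEquiv.ofBijective F hF).symm.toLinearMap
  have hFG : ∀ w, F (G w) = w := (LinearEquiv.ofBijective F hF).apply_symm_apply
  have hGF : ∀ v, G (F v) = v := (LinearEquiv.ofBijective F hF).symm_apply_apply
  -- The inverse of a homogeneous bijection is homogeneous, because the bijection commutes with the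
  -- projections to the degrees.
  have hGd : ∀ g, ∀ w ∈ cohDeg Y dY g, G w ∈ cohDeg X dX g := fun g w hw => by
    let HX : GVec 𝕜 N := ⟨CohOf dX, cohDeg X dX, cohDeg_internal X dX hX⟩
    let HY : GVec 𝕜 N := ⟨CohOf dY, cohDeg Y dY, cohDeg_internal Y dY hY⟩
    have hFd : ∀ g, ∀ v ∈ HX.deg g, F v ∈ HY.deg g := fun g v hv => by
      have := hf g _ (hid g v hv)
      rw [add_zero] at this
      exact hqd g _ this
    have hFp : ∀ v, F (HX.proj g v) = HY.proj g (F v) := fun v => by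
      induction v using internal_induction HX.internal with
      | hom h y hy =>
        by_cases hgh : g = h
        · subst hgh
          rw [HX.proj_of_mem hy, HY.proj_of_mem (hFd _ _ hy)]
        · rw [HX.proj_of_mem_ne hgh hy, HY.proj_of_mem_ne hgh (hFd _ _ hy), map_zero]
      | zero => simp
      | add y z hy hz => simp only [map_add, hy, hz]
    have h1 : F (HX.proj g (G w)) = w := by
      rw [hFp, hFG]
      exact HY.proj_of_mem hw
    have h2 := hGF (HX.proj g (G w))
    rw [h1] at h2
    rw [h2]
    exact HX.proj_mem g _
  refine ⟨i ∘ₗ G ∘ₗ q, fun g y hy => ?_, fun y => hi _, fun y => ?_, fun y hy => ?_, fun x hx => ?_⟩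
  · rw [add_zero]
    exact hid g _ (hGd g _ (hqd g y hy))
  · simp only [LinearMap.comp_apply, hq0, map_zero]
  · refine hex' _ ?_ ?_
    · simp only [LinearMap.comp_apply, map_sub, hfd, hi, hy, map_zero, sub_zero]
    · rw [map_sub]
      exact sub_eq_zero.2 (hFG (q y))
  · refine hex _ ?_ ?_
    · simp only [LinearMap.comp_apply, map_sub, hi, hx, sub_zero]
    · simp only [LinearMap.comp_apply, map_sub, hpi]
      rw [← hqf x hx]
      exact sub_eq_zero.2 (hGF (p x))

/-- A closed morphism that is bijective on cohomology is invertible. -/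
theorem exists_isInverse_of_quasiIso (f : (twistDG 𝕜 N δ).Z X Y 0)
    (inj : ∀ x, X.d x = 0 → ∀ y, f.1.1 x = Y.d y → ∃ x', x = X.d x')
    (surj : ∀ y, Y.d y = 0 → ∃ x z, X.d x = 0 ∧ f.1.1 x = y + Y.d z) :
    ∃ g, (twistDG 𝕜 N δ).cohomology.IsInverse ((twistDG 𝕜 N δ).cls f) g := by
  obtain ⟨⟨f₀, f₁⟩, ⟨hf₀, hf₁⟩, hD⟩ := f
  have hD : TwistObj.D 0 (f₀, f₁) = 0 := hD
  have hfd : ∀ x, Y.d (f₀ x) = f₀ (X.d x) := fun x => by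
    have := TwistObj.d_fst hD x
    rwa [sgn_zero, one_smul] at this
  have hfU : ∀ x, Y.d (f₁ x) + Y.U (f₀ x) = f₁ (X.d x) + f₀ (X.U x) := fun x => by
    have := TwistObj.d_snd hD x
    rwa [sgn_zero, one_smul] at this
  have hdU : ∀ (Z : TwistObj 𝕜 N δ) (z : Z), Z.d (Z.U z) = -Z.U (Z.d z) := fun Z z =>
    eq_neg_of_add_eq_zero_left (Z.d_U z)
  obtain ⟨g₀, hg₀, hdg, hgd, hfg, hgf⟩ := exists_quasi_inverse X.d_mem X.d_d Y.d_mem Y.d_d hf₀ hfd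
    inj surj
  -- The failure of `g₀` to commute with the operators. On a cocycle `y`, both `f₀ (U g₀ y)` and `f₀
  -- (g₀ U y)` are homologous to `U y`; as `f₀` is injective on cohomology, `w` vanishes there and
  -- is null-homotopic. A null-homotopy supplies the second component of the inverse.
  let w := X.U ∘ₗ g₀ - g₀ ∘ₗ Y.U
  have hw : ∀ y, w y = X.U (g₀ y) - g₀ (Y.U y) := fun y => rfl
  have hdw : ∀ y, X.d (w y) = 0 := fun y => by
    rw [hw, map_sub, hdg, hdU, hdg, map_zero, neg_zero, sub_zero]
  obtain ⟨s, hs, hsw⟩ := exists_homotopy (f := w) (ε := -1) (k := δ) Y.d_mem Y.d_d (by ring)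
    (sub_mem (GVec.comp_mem_degHom X.U_mem hg₀ (add_zero δ))
      (GVec.comp_mem_degHom hg₀ Y.U_mem (zero_add δ)))
    (fun y => by
      have h : Y.U (Y.d y) = -Y.d (Y.U y) := by rw [hdU, neg_neg]
      rw [hdw, hw, hgd, h, map_neg, hgd, neg_zero, map_zero, sub_zero, smul_zero])
    (fun y hy => by
      have hUy : Y.d (Y.U y) = 0 := by rw [hdU, hy, map_zero, neg_zero]
      obtain ⟨a, ha⟩ := hfg y hy
      obtain ⟨b, hb⟩ := hfg (Y.U y) hUy
      have h1 := hfU (g₀ y)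
      rw [hdg, map_zero, zero_add] at h1
      have h2 : Y.U (f₀ (g₀ y)) = Y.U y - Y.d (Y.U a) := by
        rw [hdU, sub_neg_eq_add, ← ha, map_sub, add_sub_cancel]
      exact inj _ (hdw y) (f₁ (g₀ y) - Y.U a - b) (by
        rw [hw, map_sub, ← h1, h2, map_sub, map_sub, ← hb]
        abel))
    X.d_mem
  have hg : ((g₀, -s) : TwistObj.Hom Y X) ∈ (twistDG 𝕜 N δ).Z Y X 0 := by
    refine TwistObj.mem_Z ⟨hg₀, neg_mem (by rwa [zero_add])⟩ (fun y => ?_) (fun y => ?_)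
    · rw [hdg, hgd, smul_zero]
    · have h := hsw y
      rw [hw, sub_eq_iff_eq_add] at h
      rw [sgn_zero, one_smul, h]
      simp only [LinearMap.neg_apply, map_neg, neg_smul, one_smul]
      abel
  let f : (twistDG 𝕜 N δ).Z X Y 0 := ⟨(f₀, f₁), ⟨hf₀, hf₁⟩, hD⟩
  let g : (twistDG 𝕜 N δ).Z Y X 0 := ⟨(g₀, -s), hg⟩
  -- Both composites are homologous to the identity on the underlying complexes, hence invertible,
  -- and then `f` is invertible; its inverse need not be the class of `g` itself.
  obtain ⟨a, ha⟩ := exists_isInverse_of_unipotent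
    ((twistDG 𝕜 N δ).compZ (add_zero 0) g f) hgf
  obtain ⟨b, hb⟩ := exists_isInverse_of_unipotent
    ((twistDG 𝕜 N δ).compZ (add_zero 0) f g) hfg
  exact (twistDG 𝕜 N δ).cohomology.exists_isInverse_of_comp
    (f := (twistDG 𝕜 N δ).cls f) (g := (twistDG 𝕜 N δ).cls g) ha hb

end Whitehead

end AInf

namespace AInf

set_option linter.unusedSectionVars false

/-! ### Restricting `A∞`-modules to the action of the generator -/

section Restriction

variable {𝕜 : Type u} [Field 𝕜] {N : ℕ} [Fact (Even N)] {A : AInfAlg 𝕜 N} {δ : ZMod N}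

theorem homDeg_mu_zero {M P : AInfMod A} {t : PreHom M P} (ht : IsMultilin 𝕜 t) (x y : List A) :
    t (x ++ 0 :: y) = 0 := (IsLinearMap.mk' _ (ht x y)).map_zero

theorem preD_nil_apply {M P : AInfMod A} (k : ZMod N) {t : PreHom M P} (ht : IsMultilin 𝕜 t)
    (m : M) : preD M P k t [] m = P.mu [] (t [] m) - sgn 𝕜 k • t [] (M.mu [] m) := by
  have h0 : t [0] = 0 := homDeg_mu_zero ht [] []
  simp only [preD_apply, Pi.sub_apply, Pi.smul_apply, Pi.add_apply, preComp_apply, preIns_apply,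
    splitSum_nil, insertSum_nil, A.mu_nil, h0, LinearMap.zero_comp, add_zero]
  rfl

theorem preD_singleton_apply {M P : AInfMod A} (k : ZMod N) {t : PreHom M P}
    (ht : IsMultilin 𝕜 t) {a : A} (ha : A.mu [a] = 0) (m : M) :
    preD M P k t [a] m = P.mu [] (t [a] m) + P.mu [a] (t [] m)
      - sgn 𝕜 k • (t [a] (M.mu [] m) + t [] (M.mu [a] m)) := by
  have h0 : t [0] = 0 := homDeg_mu_zero ht [] []
  have h1 : t [0, a] = 0 := homDeg_mu_zero ht [] [a]
  have h2 : t [A.τ a, 0] = 0 := homDeg_mu_zero ht [A.τ a] []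
  simp only [preD_apply, Pi.sub_apply, Pi.smul_apply, Pi.add_apply, preComp_apply, preIns_apply,
    splitSum_cons, splitSum_nil, insertSum_cons, insertSum_nil, A.mu_nil, ha, h0, h1, h2,
    LinearMap.zero_comp, add_zero, LinearMap.sub_apply, LinearMap.smul_apply, LinearMap.add_apply,
    LinearMap.comp_apply]
  rw [add_comm (P.mu [a] (t [] m))]

/-- The complex underlying an `A∞`-module, with the operator given by the generator. -/
noncomputable def AInfMod.twist (D : PolyBasis A δ) (M : AInfMod A) : TwistObj 𝕜 N δ where
  toGVec := M.toGVec
  d := M.mu []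
  U := M.mu [D.e 1]
  d_mem g x hx := M.diff_mem g x hx
  U_mem g x hx := by
    have := M.mu_deg _ _ (RDeg.singleton (D.e_deg 1)) g x hx
    rwa [Nat.cast_one, one_mul, add_assoc, sub_add_cancel] at this
  d_d := M.mu_mu
  d_U x := by
    have := M.rel_one (D.e 1) x
    rwa [D.e_closed, M.mu_zero_cons, LinearMap.zero_apply, add_zero] at this

/-- The dg functor that only remembers the operations with at most one entry. -/
noncomputable def twistFun (D : PolyBasis A δ) : DGFun A.modDG (twistDG 𝕜 N δ) where
  obj := AInfMod.twist D
  map {M P} := (show PreHom M P →ₗ[𝕜] TwistObj.Hom (M.twist D) (P.twist D) from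
    { toFun := fun t => (t [], t [D.e 1])
      map_add' := fun _ _ => rfl
      map_smul' := fun _ _ => rfl })
  map_mem {M P k t} ht := by
    refine ⟨fun g x hx => ?_, fun g x hx => ?_⟩
    · have := ht.2 [] 0 RDeg.nil g x hx
      rwa [add_zero] at this
    · have := ht.2 _ _ (RDeg.singleton (D.e_deg 1)) g x hx
      rwa [Nat.cast_one, one_mul, show g + (δ - 1) + k = g + (k + δ - 1) by ring] at this
  map_id M := rfl
  map_comp {M P Q} g f := by
    refine Prod.ext ?_ ?_
    · exact splitSum_nil fun x y => (show PreHom P Q from g) y ∘ₗ (show PreHom M P from f) x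
    · change splitSum (fun x y => g y ∘ₗ f x) [D.e 1] = g [D.e 1] ∘ₗ f [] + g [] ∘ₗ f [D.e 1]
      rw [splitSum_cons, splitSum_nil]
  map_d {M P k t} ht := Prod.ext (LinearMap.ext fun x => preD_nil_apply k ht.1 x)
    (LinearMap.ext fun x => preD_singleton_apply k ht.1 (D.e_closed 1) x)

/-- The multilinear family with prescribed operations with at most one entry. -/
noncomputable def PolyBasis.extend (D : PolyBasis A δ) {V W : Type u} [AddCommGroup V]
    [Module 𝕜 V] [AddCommGroup W] [Module 𝕜 W] (f : (V →ₗ[𝕜] W) × (V →ₗ[𝕜] W)) :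
    List A → V →ₗ[𝕜] W
  | [] => f.1
  | [a] => D.P a 1 • f.2
  | _ :: _ :: _ => 0

theorem PolyBasis.extend_mem (D : PolyBasis A δ) {M P : AInfMod A} {k : ZMod N}
    {f : TwistObj.Hom (M.twist D) (P.twist D)} (hf : f ∈ TwistObj.hom _ _ k) :
    (show PreHom M P from D.extend f) ∈ homDeg M P k := by
  have h2 : ∀ l : List A, 2 ≤ l.length → D.extend f l = 0
    | [], h => by simp at h
    | [_], h => by simp at h
    | _ :: _ :: _, _ => rfl
  have h3 : ∀ x y : List A, 1 ≤ x.length + y.length →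
      IsLinearMap 𝕜 fun a => D.extend f (x ++ a :: y) := fun x y h => by
    rw [show (fun a => D.extend f (x ++ a :: y)) = fun _ => 0 from
      funext fun a => h2 _ (by rw [List.length_append, List.length_cons]; omega)]
    exact ⟨fun _ _ => (add_zero _).symm, fun r _ => (smul_zero r).symm⟩
  refine ⟨?_, fun l r hl g m hm => ?_⟩
  · rintro (_ | ⟨b, x⟩) (_ | ⟨b', x'⟩)
    · exact ⟨fun a b => by simp [extend, add_smul], fun r a => by simp [extend, mul_smul]⟩
    · exact h3 _ _ (by simp)
    · exact h3 _ _ (by simp)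
    · exact h3 _ _ (by simp; omega)
  · cases hl with
    | nil =>
      have := hf.1 g m hm
      rwa [← add_zero g] at this
    | @cons a l g' r ha hl =>
      cases hl with
      | cons _ _ => exact zero_mem _
      | nil =>
        change D.P a 1 • f.2 m ∈ _
        by_cases h0 : D.P a 1 = 0
        · rw [h0, zero_smul]; exact zero_mem _
        · refine Submodule.smul_mem _ _ ?_
          have := hf.2 g m hm
          rw [← D.P_deg g' a ha 1 h0, Nat.cast_one, one_mul, add_zero,
            show g + (δ - 1) + k = g + (k + δ - 1) by ring]
          exact this

/-- The two remembered components can be prescribed freely by `PolyBasis.extend`, and the kernel is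
acyclic by `exists_primitive`. -/
theorem PolyBasis.Generates.fullyFaithful_coh_twistFun {D : PolyBasis A δ} {x : A.H}
    (hx : D.Generates x) : (twistFun D).coh.FullyFaithful := by
  refine (twistFun D).fullyFaithful_coh_of_kernel (fun {M P k} f hf => ?_)
    (fun {M P k} t ht h => ?_)
  · exact ⟨_, D.extend_mem hf, Prod.ext rfl (by
      change D.P (D.e 1) 1 • f.2 = f.2
      rw [D.P_e, Finsupp.single_eq_same, one_smul])⟩
  · have h := Prod.ext_iff.1 h
    obtain ⟨s, hs, hs0, hs1, hst⟩ := exists_primitive (M := M.toPolyMod hx) (P := P.toPolyMod hx)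
      M.curv_mu P.curv_mu ht.1 h.1 h.2 ht.2
    exact ⟨s, hs, Prod.ext hs0 hs1, hst⟩

end Restriction

end AInf

namespace AInf

set_option linter.unusedSectionVars false

/-! ### Removing homotopy components on free objects -/

section Free

variable {𝕜 : Type u} [Field 𝕜] {N : ℕ} [Fact (Even N)] {δ : ZMod N}

theorem GVec.σ_apply {V W : GVec 𝕜 N} {k : ZMod N} {f : V →ₗ[𝕜] W} (hf : f ∈ V.degHom W k)
    (x : V) : W.σ (f x) = sgn 𝕜 k • f (V.σ x) := by
  induction x using internal_induction V.internal with
  | hom g x hx =>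
    rw [W.σ_of_mem (hf g x hx), V.σ_of_mem hx, map_smul, smul_smul, sgn_add, mul_comm]
  | zero => simp
  | add x y hx hy => rw [map_add, map_add, hx, hy, map_add, map_add, smul_add]

/-- There is a homogeneous basis that consists of orbits of the operator `U`, up to signs. -/
def TwistObj.Free (X : TwistObj 𝕜 N δ) : Prop :=
  ∃ (ι : Type u) (b : Module.Basis (ι × ℕ) 𝕜 X) (g : ι → ZMod N),
    (∀ j (i : ℕ), b (j, i) ∈ X.deg (g j + (i : ZMod N) * δ)) ∧
      ∀ j (i : ℕ), X.U (b (j, i)) = sgn 𝕜 (g j + (i : ZMod N) * δ) • b (j, i + 1)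

namespace TwistObj

variable {X Y : TwistObj 𝕜 N δ}

/-- Along an orbit of basis vectors the equation determines the value of `w` on each vector from the
value on the preceding one. The value on the first vector is free and is set to zero. -/
theorem Free.exists_commutator_eq (hX : X.Free) {k : ZMod N} {y : X →ₗ[𝕜] Y}
    (hy : y ∈ X.degHom Y.toGVec (k + δ)) :
    ∃ w ∈ X.degHom Y.toGVec k, ∀ x, Y.U (w x) - sgn 𝕜 k • w (X.U x) = y x := by
  obtain ⟨ι, b, g, hb, hU⟩ := hX
  let v : ι → ℕ → Y := fun j i => Nat.rec 0
    (fun i v => (sgn 𝕜 k * sgn 𝕜 (g j + (i : ZMod N) * δ)) • (Y.U v - y (b (j, i)))) i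
  have hv : ∀ j i, v j (i + 1)
      = (sgn 𝕜 k * sgn 𝕜 (g j + (i : ZMod N) * δ)) • (Y.U (v j i) - y (b (j, i))) := fun j i => rfl
  have hvd : ∀ j (i : ℕ), v j i ∈ Y.deg (g j + (i : ZMod N) * δ + k) := fun j i => by
    induction i with
    | zero => exact zero_mem _
    | succ i ih =>
      rw [hv, Nat.cast_succ, show g j + ((i : ZMod N) + 1) * δ + k = g j + i * δ + k + δ by ring]
      refine Submodule.smul_mem _ _ (sub_mem (Y.U_mem _ _ ih) ?_)
      rw [add_assoc _ k]
      exact hy _ _ (hb j i)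
  let w : X →ₗ[𝕜] Y := b.constr 𝕜 fun p => v p.1 p.2
  have hw : ∀ j i, w (b (j, i)) = v j i := fun j i => b.constr_basis 𝕜 _ _
  refine ⟨w, fun h x hx => ?_, fun x => ?_⟩
  · rw [← b.linearCombination_repr x, Finsupp.linearCombination_apply, map_finsuppSum]
    refine Submodule.sum_mem _ fun p hp => ?_
    obtain ⟨j, i⟩ := p
    dsimp only
    rw [map_smul, hw]
    refine Submodule.smul_mem _ _ ?_
    have := X.toGVec.eq_of_repr_ne_zero b (w := fun p => g p.1 + (p.2 : ZMod N) * δ) (fun p => hb p.1 p.2) hx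
      (Finsupp.mem_support_iff.1 hp)
    rw [← this]
    exact hvd j i
  · suffices Y.U ∘ₗ w - sgn 𝕜 k • (w ∘ₗ X.U) = y from LinearMap.congr_fun this x
    refine b.ext fun ⟨j, i⟩ => ?_
    change Y.U (w (b (j, i))) - sgn 𝕜 k • w (X.U (b (j, i))) = _
    rw [hU, map_smul, hw, hw, hv, smul_smul, smul_smul,
      show sgn 𝕜 k * sgn 𝕜 (g j + (i : ZMod N) * δ) * (sgn 𝕜 k * sgn 𝕜 (g j + (i : ZMod N) * δ))
        = (sgn 𝕜 k * sgn 𝕜 k) * (sgn 𝕜 (g j + (i : ZMod N) * δ) * sgn 𝕜 (g j + (i : ZMod N) * δ)) by ring,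
      sgn_mul_self, sgn_mul_self, one_mul, one_smul, sub_sub_cancel]

theorem D_inl {k : ZMod N} {f : X →ₗ[𝕜] Y} {z : X →ₗ[𝕜] Y}
    (h : ∀ x, Y.U (f x) - sgn 𝕜 k • f (X.U x) = z x) :
    D k (f, 0) = (Y.d ∘ₗ f - sgn 𝕜 k • (f ∘ₗ X.d), z) := by
  refine Prod.ext rfl (LinearMap.ext fun x => ?_)
  rw [D_snd_apply, ← h]
  simp

theorem commutator_eq_zero {k : ZMod N} {f : X →ₗ[𝕜] Y} {g : X →ₗ[𝕜] Y}
    (h : D k (f, 0) = (g, 0)) (x : X) : Y.U (f x) = sgn 𝕜 k • f (X.U x) := by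
  have := LinearMap.congr_fun (congrArg Prod.snd h) x
  rw [D_snd_apply] at this
  refine sub_eq_zero.1 ?_
  simpa using this

/-- Choose `h` whose commutator with the operators is `-f.2`. Adding the differential of `(h, 0)`
then cancels the homotopy component of `f`. -/
theorem Free.exists_strict (hX : X.Free) {k : ZMod N} {f : Hom X Y} (hf : f ∈ hom X Y k)
    (hd : D k f = 0) : ∃ F ∈ X.degHom Y.toGVec k, D k (F, 0) = 0 ∧
      ∃ h ∈ hom X Y (k - 1), D (k - 1) h = (F, 0) - f := by
  obtain ⟨h, hh, hhU⟩ := hX.exists_commutator_eq (k := k - 1) (y := -f.2) (by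
    rw [show k - 1 + δ = k + δ - 1 by ring]
    exact neg_mem hf.2)
  have hm : ((h, 0) : Hom X Y) ∈ hom X Y (k - 1) := ⟨hh, zero_mem _⟩
  have hD := D_inl hhU
  have hDm := D_mem hm
  rw [sub_add_cancel] at hDm
  have hDD := D_D (k - 1) ((h, 0) : Hom X Y)
  rw [sub_add_cancel] at hDD
  refine ⟨f.1 + (D (k - 1) (h, 0)).1, add_mem hf.1 hDm.1, ?_, (h, 0), hm, ?_⟩
  · have : ((f.1 + (D (k - 1) (h, 0)).1, 0) : Hom X Y) = f + D (k - 1) (h, 0) :=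
      Prod.ext rfl (by rw [hD]; exact (add_neg_cancel _).symm)
    rw [this, map_add, hd, hDD, add_zero]
  · refine Prod.ext ?_ ?_
    · exact (add_sub_cancel_left f.1 _).symm
    · rw [hD]; exact (zero_sub _).symm

/-- The same device one degree lower: subtract from `h` the differential of `(w, 0)`, whose second
component is `h.2`. -/
theorem Free.exists_strict_primitive (hX : X.Free) {k : ZMod N} {f : X →ₗ[𝕜] Y} {h : Hom X Y}
    (hh : h ∈ hom X Y (k - 1)) (hd : D (k - 1) h = (f, 0)) :
    ∃ H ∈ X.degHom Y.toGVec (k - 1), D (k - 1) (H, 0) = (f, 0) := by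
  obtain ⟨w, hw, hwU⟩ := hX.exists_commutator_eq (k := k - 1 - 1) (y := h.2) (by
    rw [show k - 1 - 1 + δ = k - 1 + δ - 1 by ring]
    exact hh.2)
  have hm : ((w, 0) : Hom X Y) ∈ hom X Y (k - 1 - 1) := ⟨hw, zero_mem _⟩
  have hD := D_inl hwU
  have hDm := D_mem hm
  rw [sub_add_cancel] at hDm
  have hDD := D_D (k - 1 - 1) ((w, 0) : Hom X Y)
  rw [sub_add_cancel] at hDD
  refine ⟨h.1 - (D (k - 1 - 1) (w, 0)).1, sub_mem hh.1 hDm.1, ?_⟩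
  have : ((h.1 - (D (k - 1 - 1) (w, 0)).1, 0) : Hom X Y) = h - D (k - 1 - 1) (w, 0) :=
    Prod.ext rfl (by rw [hD]; exact (sub_self _).symm)
  rw [this, map_sub, hd, hDD, sub_zero]

end TwistObj

end Free

/-! ### Total complexes of resolutions as complexes with an operator -/

section Resolution

variable {𝕜 : Type u} [Field 𝕜] {N : ℕ} {B : Type u} [Ring B] [Algebra 𝕜 B]
  {𝒜 : ZMod N → Submodule 𝕜 B} {V : GMod 𝒜}

theorem ProjRes.totDeg_internal (R : ProjRes V) : DirectSum.IsInternal R.totDeg := by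
  classical
  refine internal_of_diag _ (fun g => DFinsupp.mapRange.linearMap fun p : ℕ =>
    (R.X p).proj (g + p)) ?_ ?_ ?_
  · intro g x hx
    refine DFinsupp.ext fun p => ?_
    exact (R.X p).proj_of_mem (hx p)
  · intro g h hgh x hx
    refine DFinsupp.ext fun p => ?_
    exact (R.X p).proj_of_mem_ne (fun e => hgh (add_right_cancel e)) (hx p)
  · intro x
    induction x using DFinsupp.induction with
    | h0 => exact zero_mem _
    | ha p y x _ _ hx =>
      refine add_mem ?_ hx
      refine (R.X p).mem_of_proj_mem (Submodule.comap
        (DFinsupp.lsingle (R := 𝕜) (M := fun p => (R.X p).carrier) p) (⨆ g, R.totDeg g)) y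
        fun g => ?_
      refine Submodule.mem_iSup_of_mem (g - p) fun q => ?_
      change DFinsupp.single (β := fun p => (R.X p).carrier) p ((R.X p).proj g y) q ∈ _
      by_cases h : p = q
      · subst h
        rw [DFinsupp.single_eq_same, sub_add_cancel]
        exact (R.X p).proj_mem g y
      · rw [DFinsupp.single_eq_of_ne (Ne.symm h)]
        exact zero_mem _

/-- The total module of a resolution, as a graded vector space. -/
def ProjRes.totGVec (R : ProjRes V) : GVec 𝕜 N where
  carrier := R.Tot
  deg := R.totDeg
  internal := R.totDeg_internal

variable [Fact (Even N)] {δ : ZMod N} {u : B}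

/-- The sign operator on the total module. -/
noncomputable def ProjRes.totσ (R : ProjRes V) : R.Tot →ₗ[𝕜] R.Tot := R.totGVec.σ

theorem ProjRes.totσ_of_mem (R : ProjRes V) {g : ZMod N} {x : R.Tot} (hx : x ∈ R.totDeg g) :
    R.totσ x = sgn 𝕜 g • x := R.totGVec.σ_of_mem hx

theorem ProjRes.totσ_totσ (R : ProjRes V) (x : R.Tot) : R.totσ (R.totσ x) = x := R.totGVec.σ_σ x

theorem ProjRes.totσ_apply {W : GMod 𝒜} {R : ProjRes V} {S : ProjRes W} {k : ZMod N}
    {f : R.Tot →ₗ[𝕜] S.Tot} (hf : f ∈ R.totGVec.degHom S.totGVec k) (x : R.Tot) :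
    S.totσ (f x) = sgn 𝕜 k • f (R.totσ x) := GVec.σ_apply hf x

theorem ProjRes.op_smul_smul (R : ProjRes V) (a : B) (c : 𝕜) (x : R.Tot) :
    MulOpposite.op a • c • x = c • MulOpposite.op a • x := smul_comm _ _ _

/-- The total complex of a resolution, with the operator given by an element of the algebra. -/
noncomputable def ProjRes.twist (R : ProjRes V) (hu : u ∈ 𝒜 δ) : TwistObj 𝕜 N δ where
  toGVec := R.totGVec
  d := R.totD.restrictScalars 𝕜
  U := (show R.Tot →ₗ[𝕜] R.Tot from Module.toModuleEnd 𝕜 R.Tot (MulOpposite.op u)) ∘ₗ R.totσ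
  d_mem g x hx := R.totD_mem hx
  U_mem g x hx p := by
    change MulOpposite.op u • R.totσ x p ∈ _
    have h := (R.X p).smul_mem _ _ u _ hu (R.totGVec.σ_mem hx p)
    rwa [show g + p + δ = g + δ + p by ring] at h
  d_d x := R.totD_totD x
  d_U x := by
    change R.totD (MulOpposite.op u • R.totσ x) + MulOpposite.op u • R.totσ (R.totD x) = 0
    have h : R.totσ (R.totD x) = sgn 𝕜 (1 : ZMod N) • R.totD (R.totσ x) :=
      ProjRes.totσ_apply (f := R.totD.restrictScalars 𝕜) (fun g x hx => R.totD_mem hx) x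
    rw [h, sgn_one, map_smul, neg_one_smul, smul_neg, add_neg_cancel]

end Resolution

end AInf

namespace AInf

set_option linter.unusedSectionVars false

/-! ### The canonical resolution over a polynomial algebra -/

section Resolution

variable {𝕜 : Type u} [Field 𝕜] {N : ℕ} [Fact (Even N)] {B : Type u} [Ring B] [Algebra 𝕜 B]
  {𝒜 : ZMod N → Submodule 𝕜 B} [GradedAlgebra 𝒜] {V W : GMod 𝒜} {δ : ZMod N} {u : B}

theorem basis_dfinsupp_apply {ι : Type v} [DecidableEq ι] {M : ι → Type w}
    [∀ i, AddCommGroup (M i)] [∀ i, Module 𝕜 (M i)] {η : ι → Type v'}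
    (b : ∀ i, Module.Basis (η i) 𝕜 (M i)) (i : ι) (j : η i) :
    DFinsupp.basis b ⟨i, j⟩ = DFinsupp.single i (b i j) := by
  classical
  refine Module.Basis.apply_eq_iff.2 (Finsupp.ext ?_)
  rintro ⟨k, l⟩
  change (b k).repr (DFinsupp.single i (b i j) k) l = _
  by_cases h : i = k
  · subst h
    rw [DFinsupp.single_eq_same, Module.Basis.repr_self]
    exact (Finsupp.single_apply_left sigma_mk_injective j l 1).symm
  · rw [DFinsupp.single_eq_of_ne (Ne.symm h), map_zero,
      Finsupp.single_eq_of_ne (fun e => h (congrArg Sigma.fst e).symm)]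
    rfl

/-- The canonical resolution is free over a polynomial algebra. -/
theorem free_twist_stdRes (hu : u ∈ 𝒜 δ) (b : Module.Basis ℕ 𝕜 B) (hb : ∀ k, b k = u ^ k)
    (V : GMod 𝒜) : ((stdRes V).twist hu).Free := by
  classical
  let ι : Type u := Σ p : ℕ, Σ g, (syzygy V p).deg g
  let bo : Module.Basis ℕ 𝕜 Bᵐᵒᵖ := b.map (MulOpposite.opLinearEquiv 𝕜)
  let bX : ∀ p : ℕ, Module.Basis (Σ _ : (Σ g, (syzygy V p).deg g), ℕ) 𝕜
      ((Σ g, (syzygy V p).deg g) →₀ Bᵐᵒᵖ) := fun p => Finsupp.basis fun _ => bo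
  let bT : Module.Basis (Σ p : ℕ, Σ _ : (Σ g, (syzygy V p).deg g), ℕ) 𝕜
      (Π₀ p : ℕ, ((Σ g, (syzygy V p).deg g) →₀ Bᵐᵒᵖ)) := DFinsupp.basis bX
  let eq : (Σ p : ℕ, Σ _ : (Σ g, (syzygy V p).deg g), ℕ) ≃ ι × ℕ :=
    { toFun := fun x => (⟨x.1, x.2.1⟩, x.2.2)
      invFun := fun x => ⟨x.1.1, x.1.2, x.2⟩
      left_inv := fun _ => rfl
      right_inv := fun _ => rfl }
  let y : ∀ (j : ι), ℕ → (stdRes V).X j.1 := fun j i =>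
    (Finsupp.single j.2 (MulOpposite.op (u ^ i)) : (Σ g, (syzygy V j.1).deg g) →₀ Bᵐᵒᵖ)
  let ξ : ι → ℕ → (stdRes V).Tot := fun j i => DFinsupp.single j.1 (y j i)
  have hval : ∀ j i, bT.reindex eq (j, i) = ξ j i := by
    rintro ⟨p, g⟩ i
    have h : bX p ⟨g, i⟩ = Finsupp.single g (MulOpposite.op (u ^ i)) := by
      rw [show bX p = Finsupp.basis fun _ => bo from rfl, Finsupp.coe_basis, ← hb]
      rfl
    refine (bT.reindex_apply eq (⟨p, g⟩, i)).trans ?_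
    exact (basis_dfinsupp_apply bX p ⟨g, i⟩).trans (congrArg (DFinsupp.single p) h)
  -- A generator of internal degree `g` in homological degree `p` has total degree `g - p`, and `u ^
  -- i` adds `i δ`.
  have hξ : ∀ (j : ι) (i : ℕ),
      ξ j i ∈ (stdRes V).totDeg ((j.2.1 - (j.1 : ZMod N)) + (i : ZMod N) * δ) := by
    rintro ⟨p, g, m⟩ i q
    by_cases h : p = q
    · subst h
      rw [show ξ ⟨p, g, m⟩ i p = y ⟨p, g, m⟩ i from DFinsupp.single_eq_same]
      intro j
      change ((Finsupp.single (⟨g, m⟩ : Σ g, (syzygy V p).deg g) (MulOpposite.op (u ^ i))) j).unop ∈ _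
      by_cases h : ⟨g, m⟩ = j
      · subst h
        rw [Finsupp.single_eq_same]
        have := SetLike.pow_mem_graded i hu
        rw [nsmul_eq_mul] at this
        change u ^ i ∈ 𝒜 (g - (p : ZMod N) + (i : ZMod N) * δ + (p : ZMod N) - g)
        rwa [show g - (p : ZMod N) + (i : ZMod N) * δ + (p : ZMod N) - g = (i : ZMod N) * δ by ring]
      · rw [Finsupp.single_eq_of_ne (Ne.symm h)]
        exact zero_mem _
    · rw [show ξ ⟨p, g, m⟩ i q = 0 from DFinsupp.single_eq_of_ne (Ne.symm h)]
      exact zero_mem _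
  have hU : ∀ (j : ι) (i : ℕ), MulOpposite.op u • (stdRes V).totσ (ξ j i)
      = sgn 𝕜 ((j.2.1 - (j.1 : ZMod N)) + (i : ZMod N) * δ) • ξ j (i + 1) := by
    intro j i
    rw [ProjRes.totσ_of_mem _ (hξ j i), ProjRes.op_smul_smul]
    congr 1
    refine (DFinsupp.single_smul (β := fun p => ((stdRes V).X p).carrier) _ _).symm.trans ?_
    refine congrArg (DFinsupp.single (β := fun p => ((stdRes V).X p).carrier) j.1) ?_
    refine (Finsupp.smul_single _ _ _).trans ?_
    rw [smul_eq_mul, ← MulOpposite.op_mul, ← pow_succ]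
  exact ⟨ι, bT.reindex eq, fun j => j.2.1 - (j.1 : ZMod N),
    fun j i => (hval j i).symm.subst (motive := fun x => x ∈ (stdRes V).totDeg _) (hξ j i),
    fun j i => (congrArg ((stdRes V).twist hu).U (hval j i)).trans ((hU j i).trans
      (congrArg (fun x : (stdRes V).Tot => sgn 𝕜 _ • x) (hval j (i + 1)).symm))⟩

/-- A linear map that commutes with the operator, up to the Koszul sign, commutes with the action
of the element. -/
theorem ProjRes.op_smul_apply {R : ProjRes V} {S : ProjRes W} (hu : u ∈ 𝒜 δ) {k : ZMod N}
    {f : R.Tot →ₗ[𝕜] S.Tot} (hf : f ∈ R.totGVec.degHom S.totGVec k)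
    (h : ∀ x, (S.twist hu).U (f x) = sgn 𝕜 k • f ((R.twist hu).U x)) (x : R.Tot) :
    f (MulOpposite.op u • x) = MulOpposite.op u • f x := by
  have h1 : MulOpposite.op u • S.totσ (f (R.totσ x))
    = sgn 𝕜 k • f (MulOpposite.op u • R.totσ (R.totσ x)) := h (R.totσ x)
  rw [ProjRes.totσ_apply hf, ProjRes.totσ_totσ, ProjRes.op_smul_smul] at h1
  have h2 := congrArg (sgn 𝕜 k • ·) h1
  simpa only [smul_smul, sgn_mul_self, one_smul] using h2.symm

/-- Commuting with the operator up to the Koszul sign amounts to commuting with `u`, hence with its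
powers, and these span the algebra. -/
theorem ProjRes.exists_linearMap {R : ProjRes V} {S : ProjRes W} (hu : u ∈ 𝒜 δ)
    (b : Module.Basis ℕ 𝕜 B) (hb : ∀ k, b k = u ^ k) {k : ZMod N}
    {f : R.Tot →ₗ[𝕜] S.Tot} (hf : f ∈ R.totGVec.degHom S.totGVec k)
    (h : ∀ x, (S.twist hu).U (f x) = sgn 𝕜 k • f ((R.twist hu).U x)) :
    ∃ F : R.Tot →ₗ[Bᵐᵒᵖ] S.Tot, F.restrictScalars 𝕜 = f := by
  have h1 := ProjRes.op_smul_apply hu hf h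
  have h2 : ∀ (i : ℕ) x, f (MulOpposite.op (u ^ i) • x) = MulOpposite.op (u ^ i) • f x := by
    intro i
    induction i with
    | zero => intro x; simp
    | succ i ih =>
      intro x
      rw [pow_succ, MulOpposite.op_mul, mul_smul, h1, ih, mul_smul]
  have h3 : ∀ (a : B) x, f (MulOpposite.op a • x) = MulOpposite.op a • f x := by
    intro a x
    have ha := b.mem_span a
    induction ha using Submodule.span_induction with
    | mem a ha =>
      obtain ⟨i, rfl⟩ := ha
      rw [hb]
      exact h2 i x
    | zero => rw [MulOpposite.op_zero, zero_smul, zero_smul, map_zero]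
    | add a a' _ _ h h' => rw [MulOpposite.op_add, add_smul, add_smul, map_add, h, h']
    | smul c a _ h => rw [MulOpposite.op_smul, smul_assoc, smul_assoc, map_smul, h]
  exact ⟨{ f with map_smul' := fun a x => h3 a.unop x }, rfl⟩

theorem ProjRes.commutator_eq_zero {R : ProjRes V} {S : ProjRes W} (a : B) {k : ZMod N}
    {f : R.Tot →ₗ[Bᵐᵒᵖ] S.Tot} (hf : f ∈ R.totHom S k) (x : R.Tot) :
    MulOpposite.op a • S.totσ (f x) - sgn 𝕜 k • f (MulOpposite.op a • R.totσ x) = 0 := by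
  have : S.totσ (f x) = sgn 𝕜 k • f (R.totσ x) :=
    ProjRes.totσ_apply (f := f.restrictScalars 𝕜) hf x
  rw [this, ProjRes.op_smul_smul, map_smul, sub_self]

/-- The dg functor that forgets the module structure of the canonical resolutions. -/
noncomputable def resFun (hu : u ∈ 𝒜 δ) : DGFun (resDG 𝒜) (twistDG 𝕜 N δ) where
  obj V := (stdRes V).twist hu
  map {V W} := (show ((stdRes V).Tot →ₗ[Bᵐᵒᵖ] (stdRes W).Tot) →ₗ[𝕜]
      TwistObj.Hom ((stdRes V).twist hu) ((stdRes W).twist hu) from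
    { toFun := fun f => (f.restrictScalars 𝕜, 0)
      map_add' := fun _ _ => Prod.ext rfl (add_zero _).symm
      map_smul' := fun _ _ => Prod.ext rfl (smul_zero _).symm })
  map_mem {V W k f} hf := ⟨hf, zero_mem _⟩
  map_id V := rfl
  map_comp {V W X} g f := by
    let g' : (stdRes W).Tot →ₗ[Bᵐᵒᵖ] (stdRes X).Tot := g
    exact Prod.ext rfl (LinearMap.ext fun x => ((zero_add _).trans (map_zero g')).symm)
  map_d {V W k f} hf := by
    let f' : (stdRes V).Tot →ₗ[Bᵐᵒᵖ] (stdRes W).Tot := f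
    refine ((TwistObj.D_inl (z := 0) (k := k) (X := (stdRes V).twist hu)
      (Y := (stdRes W).twist hu) (f := f'.restrictScalars 𝕜) fun x => ?_).trans ?_).symm
    · exact ProjRes.commutator_eq_zero u hf x
    · rfl

/-- Since the resolutions are free, closed morphisms and primitives in the target can be replaced by
ones without homotopy component. Those are linear over the algebra, so they come from the source. -/
theorem fullyFaithful_coh_resFun (hu : u ∈ 𝒜 δ) (b : Module.Basis ℕ 𝕜 B)
    (hb : ∀ k, b k = u ^ k) : (resFun hu).coh.FullyFaithful := by
  refine (resFun hu).fullyFaithful_coh (fun {V W k} g hg => ?_) fun {V W k} f hf hfB => ?_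
  · obtain ⟨F, hF, hFD, h, hh, hD⟩ := (free_twist_stdRes hu b hb V).exists_strict hg.1 hg.2
    obtain ⟨F, rfl⟩ := ProjRes.exists_linearMap hu b hb hF (TwistObj.commutator_eq_zero (g := 0) hFD)
    refine ⟨F, ⟨hF, ?_⟩, h, hh, hD⟩
    have h1 := congrArg Prod.fst hFD
    exact LinearMap.ext fun x => LinearMap.congr_fun h1 x
  · obtain ⟨h, hh, hD⟩ := hfB
    obtain ⟨H, hH, hHD⟩ := (free_twist_stdRes hu b hb V).exists_strict_primitive hh hD
    obtain ⟨H, rfl⟩ := ProjRes.exists_linearMap hu b hb hH (TwistObj.commutator_eq_zero hHD)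
    have h1 := congrArg Prod.fst hHD
    exact ⟨H, hH, LinearMap.ext fun x => LinearMap.congr_fun h1 x⟩

end Resolution

end AInf

namespace AInf

set_option linter.unusedSectionVars false

/-! ### The augmentation of a resolution as a quasi-isomorphism -/

section Augmentation

variable {𝕜 : Type u} [Field 𝕜] {N : ℕ} {B : Type u} [Ring B] [Algebra 𝕜 B]
  {𝒜 : ZMod N → Submodule 𝕜 B} {V : GMod 𝒜}

namespace ProjRes

variable (R : ProjRes V)

/-- The augmentation of the total module. -/
def aug : R.Tot →ₗ[𝕜] V := (R.ε ∘ₗ DFinsupp.lapply 0).restrictScalars 𝕜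

theorem aug_apply (x : R.Tot) : R.aug x = R.ε (x 0) := rfl

theorem aug_mem : R.aug ∈ R.totGVec.degHom V.toGVec 0 := fun g x hx => by
  have := R.ε_mem _ _ (hx 0)
  rw [Nat.cast_zero] at this
  exact this

theorem aug_totD (x : R.Tot) : R.aug (R.totD x) = 0 := by
  rw [aug_apply, totD_apply]
  exact (R.exact_zero _).2 ⟨_, rfl⟩

theorem totD_single_zero (x : R.X 0) :
    R.totD (DFinsupp.single (β := fun p => (R.X p).carrier) 0 x) = 0 := by
  refine DFinsupp.ext fun p => ?_
  rw [totD_apply, DFinsupp.single_eq_of_ne (Nat.succ_ne_zero p), map_zero]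
  rfl

theorem totD_single_succ (p : ℕ) (x : R.X (p + 1)) :
    R.totD (DFinsupp.single (β := fun p => (R.X p).carrier) (p + 1) x)
      = DFinsupp.single (β := fun p => (R.X p).carrier) p (R.d p x) := by
  refine DFinsupp.ext fun q => ?_
  rw [totD_apply]
  by_cases h : p = q
  · subst h; rw [DFinsupp.single_eq_same, DFinsupp.single_eq_same]
  · rw [DFinsupp.single_eq_of_ne (Ne.symm h),
      DFinsupp.single_eq_of_ne (fun e => h (Nat.succ_injective e).symm), map_zero]

/-- Exactness provides a preimage in each homological degree separately, and the finite support of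
`x` makes their sum an element of the total module. -/
theorem exists_totD_eq {x : R.Tot} (hx : R.totD x = 0) (h : R.aug x = 0) :
    ∃ y, x = R.totD y := by
  classical
  have h1 : ∀ p, ∃ y : R.X (p + 1), R.d p y = x p := fun p => by
    cases p with
    | zero => exact (R.exact_zero _).1 h
    | succ p =>
      refine (R.exact_succ p _).1 ?_
      rw [← totD_apply, hx]
      rfl
  choose y hy using h1
  refine ⟨∑ p ∈ x.support, DFinsupp.single (β := fun p => (R.X p).carrier) (p + 1) (y p), ?_⟩
  rw [map_sum]
  simp only [totD_single_succ, hy]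
  exact DFinsupp.sum_single.symm

variable [Fact (Even N)] {δ : ZMod N} {u : B}

theorem aug_U (x : R.Tot) :
    R.aug (MulOpposite.op u • R.totσ x) = MulOpposite.op u • V.σ (R.aug x) := by
  have h : V.σ (R.aug x) = sgn 𝕜 (0 : ZMod N) • R.aug (R.totσ x) := GVec.σ_apply R.aug_mem x
  rw [h, sgn_zero, one_smul]
  exact R.ε.map_smul _ _

/-- Maps from a graded module to a complex with an operator that induce an isomorphism on
cohomology induce an isomorphism in the cohomology category. -/
theorem exists_isInverse_twist (hu : u ∈ 𝒜 δ) {Y : TwistObj 𝕜 N δ} {j ζ : V →ₗ[𝕜] Y}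
    (hj : j ∈ V.degHom Y.toGVec 0) (hζ : ζ ∈ V.degHom Y.toGVec (δ - 1))
    (hdj : ∀ v, Y.d (j v) = 0)
    (hdζ : ∀ v, Y.d (ζ v) + Y.U (j v) = j (MulOpposite.op u • V.σ v))
    (inj : ∀ v y, j v = Y.d y → v = 0) (surj : ∀ y, Y.d y = 0 → ∃ v z, j v = y + Y.d z) :
    ∃ (h : ((j ∘ₗ R.aug, ζ ∘ₗ R.aug) : TwistObj.Hom (R.twist hu) Y) ∈
        (twistDG 𝕜 N δ).Z (R.twist hu) Y 0) (g : _),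
      (twistDG 𝕜 N δ).cohomology.IsInverse ((twistDG 𝕜 N δ).cls ⟨_, h⟩) g := by
  have h : ((j ∘ₗ R.aug, ζ ∘ₗ R.aug) : TwistObj.Hom (R.twist hu) Y) ∈
        (twistDG 𝕜 N δ).Z (R.twist hu) Y 0 := by
    have h1 : ∀ x : R.Tot, Y.d (j (R.aug x)) = sgn 𝕜 (0 : ZMod N) • j (R.aug (R.totD x)) :=
      fun x => by rw [hdj, aug_totD, map_zero, smul_zero]
    have h2 : ∀ x : R.Tot, Y.d (ζ (R.aug x)) + Y.U (j (R.aug x)) = sgn 𝕜 (0 : ZMod N) •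
        (ζ (R.aug (R.totD x)) + j (R.aug (MulOpposite.op u • R.totσ x))) := fun x => by
      rw [hdζ, aug_totD, aug_U, map_zero, zero_add, sgn_zero, one_smul]
    exact TwistObj.mem_Z ⟨GVec.comp_mem_degHom hj R.aug_mem (add_zero 0),
      GVec.comp_mem_degHom hζ R.aug_mem (by ring)⟩ h1 h2
  -- Injectivity on cohomology is the acyclicity of the augmented resolution. For surjectivity,
  -- classes are lifted through `ε` to homological degree zero, where every element is a cocycle.
  refine ⟨h, exists_isInverse_of_quasiIso ⟨_, h⟩ (fun x hx y hy => ?_) fun y hy => ?_⟩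
  · exact R.exists_totD_eq hx (inj _ _ hy)
  · obtain ⟨v, z, hv⟩ := surj y hy
    obtain ⟨x, rfl⟩ := R.ε_surjective v
    refine ⟨DFinsupp.single (β := fun p => (R.X p).carrier) 0 x, z, R.totD_single_zero x, ?_⟩
    rw [← hv]
    change j (R.ε (DFinsupp.single (β := fun p => (R.X p).carrier) 0 x 0)) = _
    rw [DFinsupp.single_eq_same]

end ProjRes

end Augmentation

/-! ### Comparing a module with the resolution of its cohomology -/

section Comparison

variable {𝕜 : Type u} [Field 𝕜] {N : ℕ} [Fact (Even N)] {A : AInfAlg 𝕜 N} {δ : ZMod N}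
  {D : PolyBasis A δ} {u : A.H} (hu : D.Generates u)

/-- The cohomology as a graded vector space. -/
def PolyMod.cohGVec (P : PolyMod D) : GVec 𝕜 N :=
  ⟨CohOf (P.mu []), cohDeg P.toGVec (P.mu []), cohDeg_internal P.toGVec (P.mu []) P.mu_nil_mem⟩

/-- The chosen representatives of the cohomology classes commute with the action of the generator
up to homotopy. -/
theorem PolyMod.exists_homotopy (P : PolyMod D) :
    ∃ ζ ∈ P.cohGVec.degHom P.toGVec (δ - 1), ∀ v : CohOf (P.mu []),
        P.mu [] (ζ v) + P.mu [D.e 1] (P.i v) = P.i (P.q (P.cohGVec.σ v)) := by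
  obtain ⟨h, hh, hdh⟩ := P.toGVec.exists_partial_homotopy (P.mu []) P.mu_nil_mem
  let σ' : CohOf (P.mu []) →ₗ[𝕜] CohOf (P.mu []) := P.cohGVec.σ
  have hσ : ∀ v, σ' (σ' v) = v := P.cohGVec.σ_σ
  -- The defect `f` consists of cocycles whose classes vanish by `q_spec`, the sign operator undoing
  -- the sign in the action on cohomology. Its values are therefore coboundaries, and `d h d = d`
  -- makes `h ∘ f` a primitive.
  let f : CohOf (P.mu []) →ₗ[𝕜] P.carrier := P.i ∘ₗ P.q ∘ₗ σ' - P.mu [D.e 1] ∘ₗ P.i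
  have hf : ∀ v, f v = P.i (P.q (σ' v)) - P.mu [D.e 1] (P.i v) := fun v => rfl
  have hfd : f ∈ P.cohGVec.degHom P.toGVec δ := fun g v hv => by
    refine sub_mem (P.i_mem _ _ (P.q_mem _ _ (P.cohGVec.σ_mem hv))) ?_
    have := P.mu_mem.2 _ _ (RDeg.singleton (D.e_deg 1)) g _ (P.i_mem g v hv)
    rwa [Nat.cast_one, one_mul, add_assoc, sub_add_cancel] at this
  have hdf : ∀ v, P.mu [] (f v) = 0 := fun v => by
    have h1 := P.mu_one (D.e 1) (P.i v)
    have h0 : P.mu [0] = 0 := P.mu_mem.1.head_zero []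
    rw [D.e_closed, h0, P.mu_i, map_zero, LinearMap.zero_apply, add_zero, add_zero] at h1
    rw [hf, map_sub, P.mu_i, h1, sub_zero]
  have hpf : ∀ v, P.p (f v) = 0 := fun v => by
    have h1 : P.toGVec.σ (P.i (σ' v)) = P.i v := by
      have h2 : P.toGVec.σ (P.i (σ' v)) = sgn 𝕜 (0 : ZMod N) • P.i (σ' (σ' v)) :=
        GVec.σ_apply (V := P.cohGVec) (W := P.toGVec) (f := P.i)
          (fun g v hv => by rw [add_zero]; exact P.i_mem g v hv) (σ' v)
      rw [h2, hσ, sgn_zero, one_smul]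
    have h3 := P.q_spec 1 (P.i (σ' v)) (P.mu_i _)
    rw [h1, P.p_i, pow_one] at h3
    rw [hf, map_sub, P.p_i, h3, sub_self]
  refine ⟨h ∘ₗ f, GVec.comp_mem_degHom (W := P.toGVec) (j := -1) (fun g x hx => ?_) hfd (by ring),
    fun v => ?_⟩
  · rw [← sub_eq_add_neg]; exact hh g x hx
  · obtain ⟨y, hy⟩ := P.exact (f v) (hdf v) (hpf v)
    change P.mu [] (h (f v)) + _ = P.i (P.q (σ' v))
    rw [hy, hdh, ← hy, hf, sub_add_cancel]

end Comparison

end AInf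

namespace AInf

set_option linter.unusedSectionVars false

section Comparison

variable {𝕜 : Type u} [Field 𝕜] {N : ℕ} [Fact (Even N)] {A : AInfAlg 𝕜 N} {δ : ZMod N}
  {D : PolyBasis A δ} {u : A.H} (hu : D.Generates u)

/-- Representatives of the cohomology classes. -/
noncomputable def AInfMod.rep (M : AInfMod A) : CohOf (M.mu []) →ₗ[𝕜] M := (M.toPolyMod hu).i

/-- A projection to the cohomology. -/
noncomputable def AInfMod.cohProj (M : AInfMod A) : M →ₗ[𝕜] CohOf (M.mu []) := (M.toPolyMod hu).p

theorem AInfMod.diff_rep (M : AInfMod A) (v : CohOf (M.mu [])) : M.mu [] (M.rep hu v) = 0 :=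
  (M.toPolyMod hu).mu_i v

theorem AInfMod.cohProj_rep (M : AInfMod A) (v : CohOf (M.mu [])) :
    M.cohProj hu (M.rep hu v) = v := (M.toPolyMod hu).p_i v

theorem AInfMod.cohProj_diff (M : AInfMod A) (x : M) : M.cohProj hu (M.mu [] x) = 0 :=
  (M.toPolyMod hu).p_mu x

theorem AInfMod.cohProj_eq_cls (M : AInfMod A) {x : M} (hx : M.mu [] x = 0) :
    M.cohProj hu x = M.cls ⟨x, hx⟩ := M.p_toPolyMod hu ⟨x, hx⟩

theorem AInfMod.exists_rep_cohProj (M : AInfMod A) (x : M) (hx : M.mu [] x = 0) :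
    ∃ z, M.rep hu (M.cohProj hu x) = x + M.mu [] z := by
  have h1 : M.mu [] (M.rep hu (M.cohProj hu x) - x) = 0 := by
    rw [map_sub, M.diff_rep, hx, sub_zero]
  obtain ⟨z, hz⟩ := (M.toPolyMod hu).exact _ h1
    ((map_sub (M.cohProj hu) _ _).trans (by rw [M.cohProj_rep, sub_self]; rfl))
  exact ⟨z, by rw [add_comm]; exact sub_eq_iff_eq_add.1 hz⟩

/-- The resolution of the cohomology of an `A∞`-module is quasi-isomorphic to the module, as a
complex with an operator. -/
theorem AInfMod.exists_comparison (M : AInfMod A) :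
    ∃ θ : (twistDG 𝕜 N δ).Z ((resFun hu.mem).obj M.toGMod) ((twistFun D).obj M) 0,
      (∀ x : (stdRes M.toGMod).Tot, (show TwistObj.Hom _ _ from θ.1).1 x
        = M.rep hu ((stdRes M.toGMod).aug x)) ∧
      ∃ g, (twistDG 𝕜 N δ).cohomology.IsInverse ((twistDG 𝕜 N δ).cls θ) g := by
  let P := M.toPolyMod hu
  obtain ⟨ζ, hζ, hdζ⟩ := P.exists_homotopy
  obtain ⟨h, g, hg⟩ := (stdRes M.toGMod).exists_isInverse_twist (u := u) hu.mem (Y := M.twist D)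
    (j := P.i) (ζ := ζ) (fun g v hv => by rw [add_zero]; exact P.i_mem g v hv) hζ P.mu_i hdζ
    (fun v y hy => (M.cohProj_rep hu v).symm.trans
      ((congrArg (M.cohProj hu) hy).trans (M.cohProj_diff hu y)))
    (fun y hy => ⟨M.cohProj hu y, M.exists_rep_cohProj hu y hy⟩)
  exact ⟨⟨_, h⟩, fun x => rfl, g, hg⟩

/-- Every graded module over the cohomology algebra is realized by an `A∞`-module. -/
theorem exists_realization (V : GMod A.degH) :
    ∃ (X : AInfMod A) (f : (twistDG 𝕜 N δ).cohomology.Hom ((resFun hu.mem).obj V)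
        ((twistFun D).obj X) 0) (g : _),
      (twistDG 𝕜 N δ).cohomology.IsInverse f g := by
  let q : V →ₗ[𝕜] V := Module.toModuleEnd 𝕜 V (MulOpposite.op u)
  have hq : ∀ g, ∀ v ∈ V.deg g, q v ∈ V.deg (g + δ) := fun g v hv =>
    V.smul_mem g δ u v hu.mem hv
  let X : AInfMod A := operatorMod hq hu
  have h0 : ∀ x, X.mu [] x = 0 := fun x => rfl
  -- As the differential of `X` is zero and the generator acts by `q` exactly, the identity of `V`
  -- with zero homotopy is a comparison map.
  obtain ⟨h, g, hg⟩ := (stdRes V).exists_isInverse_twist (u := u) hu.mem (Y := X.twist D)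
    (j := LinearMap.id) (ζ := 0) (fun g v hv => by rw [add_zero]; exact hv) (zero_mem _) h0
    (fun v => (zero_add _).trans (operatorMod_mu_e_one hq hu v)) (fun v y hy => hy.trans (h0 y))
    (fun y _ => ⟨y, 0, ((congrArg (y + ·) (h0 0)).trans (add_zero y)).symm⟩)
  exact ⟨X, _, g, hg⟩

end Comparison

/-! ### The comparison functor and the maps it induces -/

section Main

variable {𝕜 : Type u} [Field 𝕜] {N : ℕ} [Fact (Even N)] {A : AInfAlg 𝕜 N} {δ : ZMod N}
  {D : PolyBasis A δ} {u : A.H} (hu : D.Generates u)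

theorem cohMap_eq {M P : AInfMod A} {k : ZMod N} {t : PreHom M P} (ht : t ∈ homDeg M P k)
    (hd : preD M P k t = 0) (v : CohOf (M.mu [])) :
    cohMap t ht hd v = P.cohProj hu (t [] (M.rep hu v)) := by
  have hm := M.diff_rep hu v
  have hv : M.cls ⟨M.rep hu v, hm⟩ = v := (M.cohProj_eq_cls hu hm).symm.trans (M.cohProj_rep hu v)
  have hp : P.mu [] (t [] (M.rep hu v)) = 0 := by
    rw [closed_diff ht hd, hm, map_zero, smul_zero]
  rw [P.cohProj_eq_cls hu hp]
  conv_lhs => rw [← hv]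
  rfl

/-- A functor that is compatible with the comparison morphisms induces the induced maps. -/
theorem induces_of_comp_eq {M P : AInfMod A} {k : ZMod N}
    {θM : (twistDG 𝕜 N δ).Z ((resFun hu.mem).obj M.toGMod) ((twistFun D).obj M) 0}
    {θP : (twistDG 𝕜 N δ).Z ((resFun hu.mem).obj P.toGMod) ((twistFun D).obj P) 0}
    (hM : ∀ x : (stdRes M.toGMod).Tot, (show TwistObj.Hom _ _ from θM.1).1 x
        = M.rep hu ((stdRes M.toGMod).aug x))
    (hP : ∀ x : (stdRes P.toGMod).Tot, (show TwistObj.Hom _ _ from θP.1).1 x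
        = P.rep hu ((stdRes P.toGMod).aug x))
    {t : PreHom M P} (ht : t ∈ homDeg M P k) (hd : preD M P k t = 0)
    {φ : (modExt A.degH).Hom M.toGMod P.toGMod k}
    (h : (twistDG 𝕜 N δ).cohomology.comp (zero_add k) ((twistDG 𝕜 N δ).cls θP)
        ((resFun hu.mem).coh.map φ)
      = (twistDG 𝕜 N δ).cohomology.comp (add_zero k)
        ((twistFun D).coh.map (A.modDG.cls (⟨t, ht, hd⟩ : A.modDG.Z M P k)))
        ((twistDG 𝕜 N δ).cls θM)) :
    Induces φ (cohMap t ht hd : M.H → P.H) := by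
  rintro ⟨f, hf⟩ rfl x
  -- The naturality square commutes in cohomology, so its two composites differ by the differential
  -- of some `s`.
  obtain ⟨s, -, hs⟩ := (Submodule.Quotient.eq _).1 h
  let f' : (stdRes M.toGMod).Tot →ₗ[A.Hᵐᵒᵖ] (stdRes P.toGMod).Tot := f
  -- An element of homological degree zero is a cocycle of the total complex. There `s` contributes
  -- only a coboundary, which the projection to cohomology kills.
  let y : (stdRes M.toGMod).Tot := DFinsupp.single (β := fun p => ((stdRes M.toGMod).X p).carrier) 0 x
  let s₀ : (stdRes M.toGMod).Tot →ₗ[𝕜] P := (show TwistObj.Hom _ _ from s).1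
  have h1 : P.mu [] (s₀ y) - sgn 𝕜 (k - 1) • s₀ ((stdRes M.toGMod).totD y)
      = P.rep hu ((stdRes P.toGMod).aug (f' y)) - t [] (M.rep hu ((stdRes M.toGMod).aug y)) :=
    (LinearMap.congr_fun (congrArg Prod.fst hs) y).trans
      (congrArg₂ (fun a b : P => a - b) (hP (f' y)) (congrArg (t []) (hM y)))
  have h2 := congrArg (P.cohProj hu) h1
  rw [ProjRes.totD_single_zero, map_zero, smul_zero, sub_zero, P.cohProj_diff, map_sub] at h2
  have h3 : (stdRes M.toGMod).aug y = (stdRes M.toGMod).ε x :=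
    congrArg (stdRes M.toGMod).ε
      (DFinsupp.single_eq_same (β := fun p => ((stdRes M.toGMod).X p).carrier)
        (i := 0) (b := x))
  refine (cohMap_eq hu ht hd _).trans ?_
  rw [← h3]
  exact (sub_eq_zero.1 h2.symm).symm.trans (P.cohProj_rep hu _)

/-- The functor induced by the comparison with complexes with an operator. -/
theorem PolyBasis.Generates.exists_functor {D : PolyBasis A δ} {u : A.H} (hu : D.Generates u)
    (b : Module.Basis ℕ 𝕜 A.H) (hb : ∀ k, b k = u ^ k) :
    ∃ H : GrFunctor A.modDG.cohomology (modExt A.degH) AInfMod.toGMod,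
      H.IsEquivalence ∧
      ∀ (M P : AInfMod A) (k : ZMod N) (t : PreHom M P) (ht : t ∈ homDeg M P k)
        (hd : preD M P k t = 0),
        Induces (H.map (A.modDG.cls (⟨t, ht, hd⟩ : A.modDG.Z M P k)))
          (cohMap t ht hd : M.H → P.H) := by
  choose θ hθ θ' hθ' using AInfMod.exists_comparison hu
  have hF := hu.fullyFaithful_coh_twistFun
  have hG : (resFun hu.mem).coh.FullyFaithful := fullyFaithful_coh_resFun hu.mem b hb
  -- Transport `twistFun` through the fully faithful `resFun`, along the comparison isomorphisms
  -- between a module and the resolution of its cohomology.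
  refine ⟨(twistFun D).coh.lift hG (fun M => (twistDG 𝕜 N δ).cls (θ M)) θ' hθ',
    ⟨GrFunctor.fullyFaithful_lift hF hG hθ', fun V => ?_⟩, fun M P k t ht hd => ?_⟩
  · obtain ⟨X, f, g, hfg⟩ := exists_realization hu V
    -- For a realization `X` of `V`, the resolutions of the cohomology of `X` and of `V` are both
    -- isomorphic to `X` in the cohomology of `twistDG`, and `resFun` reflects the resulting
    -- isomorphism.
    have key := (hθ' X).comp hfg.symm
    exact ⟨X, _, _, hG.isInverse (X := X.toGMod) (Y := V) key⟩
  · have key := GrFunctor.comp_map_lift (F := (twistFun D).coh) hG hθ' (X := M) (Y := P) (k := k)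
      (A.modDG.cls (⟨t, ht, hd⟩ : A.modDG.Z M P k))
    exact induces_of_comp_eq hu (hθ M) (hθ P) ht hd key

end Main

end AInf

open AInf in
theorem mainTheorem11 {𝕜 : Type u} [Field 𝕜] {N : ℕ} [Fact (Even N)] {n : ℕ} (hn : 2 ≤ n)
    (A : AInfAlg 𝕜 N) (e : A.H ≃ₐ[𝕜] Polynomial 𝕜)
    (he : e.symm Polynomial.X ∈ A.degH (1 - (n : ZMod N))) :
    (∃ H : GrFunctor A.modDG.cohomology (modExt A.degH) AInfMod.toGMod,
      H.IsEquivalence ∧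
      ∀ (M P : AInfMod A) (k : ZMod N) (t : PreHom M P) (ht : t ∈ homDeg M P k)
        (hd : preD M P k t = 0),
        Induces (H.map (A.modDG.cls (⟨t, ht, hd⟩ : A.modDG.Z M P k)))
          (cohMap t ht hd : M.H → P.H)) ∧
    GrCat.IsEquivalent (modExt A.degH) A.modDG.cohomology := by
  -- Only two facts about the isomorphism with the polynomial ring enter: the powers of the preimage
  -- of the variable form a basis, and that preimage is homogeneous of the stated degree.
  obtain ⟨D, hD⟩ := exists_polyBasis A e he
  have hu : D.Generates (e.symm Polynomial.X) := hD
  obtain ⟨H, hH, hind⟩ := hu.exists_functor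
    ((Polynomial.basisMonomials 𝕜).map e.symm.toLinearEquiv) fun k => by
      have h : e.symm (Polynomial.basisMonomials 𝕜 k) = e.symm Polynomial.X ^ k := by
        rw [Polynomial.coe_basisMonomials, ← map_pow, Polynomial.X_pow_eq_monomial]
      exact h
  exact ⟨⟨H, hH, hind⟩, hH.isEquivalent⟩
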